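/- **Setting.** Let $M\subset\mathbb R^n$ be open and let $\Sigma\subset M$ be a smooth normal crossings variety, i.e. a finite union of closed smooth hypersurfaces of $M$ such that near every point of $M$ there are local coordinates, centred at the point, in which $\Sigma=\{x_1\cdots x_c=0\}$ for some $0\le c\le n$. Let $X$ be a piecewise smooth vector field on $(M,\Sigma)$: the restriction of $X$ to each connected component $W$ of $M\setminus\Sigma$ extends to a smooth vector field on $M$. Let $m$ be a mollifier on $\mathbb R^n$ (smooth, $m\ge 0$, $\int m=1$, compact support), let $m_\varepsilon(x)=\varepsilon^{-n}m(x/\varepsilon)$, and let $$X_\varepsilon=m_\varepsilon*X:\ x\mapsto\int m_\varepsilon(u)\,X(x-u)\,du\qquad(\varepsilon>0),$$ considered at the points $x$ with $x-\operatorname{supp} m_\varepsilon\subset M$; these points form an open set that contains any given compact subset of $M$ when $\varepsilon$ is small. Let $\gamma$ be a sewing-type periodic orbit of $X$ that meets $\Sigma$: a simple closed curve $\gamma=\gamma_1\cup\dots\cup\gamma_k\subset M$, $k\ge1$, where $\gamma_i$ goes from $p_i\in\Sigma$ to $p_{i+1}\in\Sigma$ (with $p_{k+1}=p_1$), the interior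 of $\gamma_i$ lies in a connected component $W_i$ of $M\setminus\Sigma$ and is a regular orbit of $X|_{W_i}$ with the orientation of the flow, $\Sigma$ is smooth (has exactly one local component) at each $p_i$, and the smooth extension of $X|_{W_i}$ is transverse to $\Sigma$ (in particular non-zero) at $p_i$ and $p_{i+1}$. Let $P_i:(\Sigma,p_i)\to(\Sigma,p_{i+1})$ be the germ of transition map which sends $x$ to the next point of $\Sigma$ on the orbit of $X|_{W_i}$ starting at $x$. Put $p=p_1$ and let $P=P_k\circ\dots\circ P_1:(\Sigma,p)\to(\Sigma,p)$ be the sewing Poincaré map. **Proposition.** The germ $P$ is well defined, and it extends to a smooth map germ $$P^{\mathrm{reg}}:(\Sigma,p)\times(\mathbb R_{\ge0},0)\to(\Sigma,p)\times(\mathbb R_{\ge0},0),\qquad P^{\mathrm{reg}}(x,\varepsilon)=(P_\varepsilon(x),\varepsilon),\quad P_0=P,$$ such that for $\varepsilon>0$ the map $P_\varepsilon$ is the Poincaré first return map of $X_\varepsilon$. Explicitly, there are open neighbourhoods $U\subset S$ of $p$ in $\Sigma$ and $\varepsilon_0>0$ such that $P^{\mathrm{reg}}$ is defined and smooth on $U\times[0,\varepsilon_0)$,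 with $P^{\mathrm{reg}}(p,0)=(p,0)$ and $P^{\mathrm{reg}}(x,0)=(P(x),0)$ for $x\in U$, and such that for every $\varepsilon\in(0,\varepsilon_0)$ the field $X_\varepsilon$ is transverse to $\Sigma$ at every point of $S$ and, for every $x\in U$, the orbit of $X_\varepsilon$ starting at $x$ returns to $S$, for the first time at the point $P_\varepsilon(x)$. -/

import Mathlib

open Set Topology MeasureTheory
open scoped ContDiff

namespace PiecewiseSmooth

/-- Euclidean `n`-space. -/
abbrev Eu (n : ℕ) : Type := EuclideanSpace ℝ (Fin n)

/-! ### Piecewise smooth spaces `(M, Sig)`, with `M` an open subset of `ℝⁿ` -/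

/-- `e` is a system of smooth local coordinates on an open subset of `M`, defined near `p` and
with `e p = 0`, in which `Sig` is the locus `{x₁ ⋯ x_c = 0}` (coordinates are indexed from `0`,
so these are the coordinates with index `< c`); `c` is the number of local components at `p`. -/
structure IsAdaptedChart {n : ℕ} (M Sig : Set (Eu n)) (c : ℕ) (p : Eu n)
    (e : OpenPartialHomeomorph (Eu n) (Eu n)) : Prop where
  mem_source : p ∈ e.source
  source_subset : e.source ⊆ M
  map_base : e p = 0
  smooth : ContDiffOn ℝ ∞ e e.source
  smooth_symm : ContDiffOn ℝ ∞ e.symm e.target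
  le_dim : c ≤ n
  mem_iff : ∀ x ∈ e.source, x ∈ Sig ↔ ∃ j : Fin n, (j : ℕ) < c ∧ e x j = 0

/-- `S` is a (relatively closed, embedded) smooth submanifold of codimension one of `M`. -/
structure IsSmoothHypersurface {n : ℕ} (M S : Set (Eu n)) : Prop where
  subset : S ⊆ M
  closed_in : closure S ∩ M ⊆ S
  chart : ∀ p ∈ S, ∃ e, IsAdaptedChart M S 1 p e

/-- `Sig` is a (possibly empty) smooth normal crossings variety in `M`: a finite union of smooth
hypersurfaces of `M` such that adapted coordinates exist at every point of `M`. -/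
structure IsNormalCrossings {n : ℕ} (M Sig : Set (Eu n)) : Prop where
  components : ∃ (N : ℕ) (S : Fin N → Set (Eu n)),
    (∀ i, IsSmoothHypersurface M (S i)) ∧ Sig = ⋃ i, S i
  chart : ∀ p ∈ M, ∃ c e, IsAdaptedChart M Sig c p e

/-- `X` is a piecewise smooth vector field on `(M, Sig)`: its restriction to each connected
component of `M \ Sig` extends to a smooth vector field on `M`.
(The values of `X` on `Sig` and outside `M` are irrelevant.) -/
def IsPiecewiseSmoothField {n : ℕ} (M Sig : Set (Eu n)) (X : Eu n → Eu n) : Prop :=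
  ∀ x ∈ M \ Sig, ∃ Y : Eu n → Eu n, ContDiffOn ℝ ∞ Y M ∧
    EqOn X Y (connectedComponentIn (M \ Sig) x)

/-- `p` is a point of `Sig` at which `Sig` is smooth (exactly one local component, `{x₁ = 0}`) and
the vector `v` is not tangent to `Sig` at `p`, i.e. `dx₁(p) v ≠ 0`. -/
def IsTransverseAt {n : ℕ} (M Sig : Set (Eu n)) (p v : Eu n) : Prop :=
  ∃ e, IsAdaptedChart M Sig 1 p e ∧ ∀ j : Fin n, (j : ℕ) < 1 → fderiv ℝ e p v j ≠ 0

/-! ### Regularization by convolution -/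

/-- A mollifier in `ℝⁿ`. -/
structure IsMollifier {n : ℕ} (m : Eu n → ℝ) : Prop where
  smooth : ContDiff ℝ ∞ m
  nonneg : ∀ x, 0 ≤ m x
  integral_eq_one : ∫ x, m x = 1
  compact_support : HasCompactSupport m

/-- The rescaled mollifier `m_ε(x) = ε⁻ⁿ m(x/ε)`. -/
noncomputable def rescaledMollifier {n : ℕ} (m : Eu n → ℝ) (ε : ℝ) (x : Eu n) : ℝ :=
  (ε ^ n)⁻¹ * m (ε⁻¹ • x)

/-- The smoothed vector field `m_ε ∗ X : x ↦ ∫ m_ε(u) X(x - u) du`. -/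
noncomputable def smoothedField {n : ℕ} (m : Eu n → ℝ) (X : Eu n → Eu n) (ε : ℝ) :
    Eu n → Eu n :=
  convolution (rescaledMollifier m ε) X (ContinuousLinearMap.lsmul ℝ ℝ) volume

/-- The part of `M` on which `m_ε ∗ X` only involves values of `X` at points of `M`. It is open
and, as `ε → 0`, contains any given compact subset of `M`. -/
def smoothedDomain {n : ℕ} (M : Set (Eu n)) (m : Eu n → ℝ) (ε : ℝ) : Set (Eu n) :=
  {x | ∀ u ∈ tsupport (rescaledMollifier m ε), x - u ∈ M}

/-! ### Sewing-type periodic orbits and their Poincaré maps -/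

/-- A sewing-type periodic orbit of `X` that meets `Sig`, parametrized by time, starting at a
point of `Sig`. The crossing points are `p_i = γ (τ i)`; the `i`-th segment is `γ` restricted to
`[τ i, τ (i + 1)]`. (A segment has finite duration because it is compact and the
extension of `X` along it has no zero, and on its interior `X` has no zero because `γ` is
injective there.) -/
structure SewingOrbit {n : ℕ} (M Sig : Set (Eu n)) (X : Eu n → Eu n) where
  /-- the number of segments -/
  k : ℕ
  k_pos : 0 < k
  /-- the crossing times -/
  τ : Fin (k + 1) → ℝ
  τ_zero : τ 0 = 0
  τ_strictMono : StrictMono τ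
  /-- the curve -/
  γ : ℝ → Eu n
  continuousOn : ContinuousOn γ (Icc 0 (τ (Fin.last k)))
  closed : γ (τ (Fin.last k)) = γ 0
  simple : InjOn γ (Ico 0 (τ (Fin.last k)))
  /-- the connected component of `M \ Sig` containing the interior of each segment -/
  W : Fin k → Set (Eu n)
  W_component : ∀ i, ∃ x ∈ M \ Sig, W i = connectedComponentIn (M \ Sig) x
  mem_W : ∀ i : Fin k, ∀ t ∈ Ioo (τ i.castSucc) (τ i.succ), γ t ∈ W i
  hasDerivAt : ∀ i : Fin k, ∀ t ∈ Ioo (τ i.castSucc) (τ i.succ), HasDerivAt γ (X (γ t)) t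
  /-- each segment starts and ends on `Sig`, transversely: the smooth extension `Y` of `X|_{W i}`
  is transverse to `Sig` (in particular non-zero) at both end points of the segment -/
  transverse : ∀ i : Fin k, ∃ Y : Eu n → Eu n, ContDiffOn ℝ ∞ Y M ∧ EqOn X Y (W i) ∧
    IsTransverseAt M Sig (γ (τ i.castSucc)) (Y (γ (τ i.castSucc))) ∧
    IsTransverseAt M Sig (γ (τ i.succ)) (Y (γ (τ i.succ)))

/-- The orbit of `X|_W` starting at the point `x` of `Sig` meets `Sig` again (for the first time)
at `y`. -/
def IsTransition {n : ℕ} (Sig : Set (Eu n)) (X : Eu n → Eu n) (W : Set (Eu n))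
    (x y : Eu n) : Prop :=
  x ∈ Sig ∧ y ∈ Sig ∧ ∃ s > 0, ∃ c : ℝ → Eu n, ContinuousOn c (Icc 0 s) ∧ c 0 = x ∧ c s = y ∧
    ∀ t ∈ Ioo 0 s, c t ∈ W ∧ HasDerivAt c (X (c t)) t

namespace SewingOrbit

variable {n : ℕ} {M Sig : Set (Eu n)} {X : Eu n → Eu n}

/-- The base point `p = p₁` of the orbit. -/
def base (O : SewingOrbit M Sig X) : Eu n := O.γ 0

/-- `y` is reached from `x` by the successive transitions through `W₁, …, W_k`, that is,
`y = P_k (⋯ (P₁ x))` for the transition maps `P_i`. -/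
def Returns (O : SewingOrbit M Sig X) (x y : Eu n) : Prop :=
  ∃ z : Fin (O.k + 1) → Eu n, z 0 = x ∧ z (Fin.last O.k) = y ∧
    ∀ i : Fin O.k, IsTransition Sig X (O.W i) (z i.castSucc) (z i.succ)

/-- `P` represents the germ at `p` of the sewing Poincaré map `P_k ∘ ⋯ ∘ P₁ : (Sig, p) → (Sig, p)`:
near `p` its graph is the relation `Returns`. -/
def IsPoincareMap (O : SewingOrbit M Sig X) (P : Eu n → Eu n) : Prop :=
  ∀ᶠ x in 𝓝[Sig] O.base, ∀ y, O.Returns x y ↔ y = P x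

end SewingOrbit

/-- The orbit in `D` of the vector field `V` starting at `x` returns (in positive time) to the
section `S`, for the first time at the point `y`. -/
def IsFirstReturn {n : ℕ} (D : Set (Eu n)) (V : Eu n → Eu n) (S : Set (Eu n))
    (x y : Eu n) : Prop :=
  y ∈ S ∧ ∃ T > 0, ∃ c : ℝ → Eu n, c 0 = x ∧ c T = y ∧
    (∀ t ∈ Icc 0 T, c t ∈ D ∧ HasDerivWithinAt c (V (c t)) (Icc 0 T) t) ∧
    ∀ t ∈ Ioo 0 T, c t ∉ S

/-- `F` is smooth on the subset `A`: near each point of `A` it agrees on `A` with a smooth map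
defined on an open set of the ambient space. (For `A` an open part of `Sig × [0, ∞)`, with `Sig` a
smooth hypersurface, this is smoothness on the manifold with boundary `A`.) -/
def IsSmoothOnSubset {E F : Type*} [NormedAddCommGroup E] [NormedSpace ℝ E]
    [NormedAddCommGroup F] [NormedSpace ℝ F] (f : E → F) (A : Set E) : Prop :=
  ∀ a ∈ A, ∃ (O : Set E) (g : E → F), IsOpen O ∧ a ∈ O ∧ ContDiffOn ℝ ∞ g O ∧ EqOn f g (O ∩ A)

end PiecewiseSmooth

open PiecewiseSmooth

/-! `X_ε` degenerates as ε → 0 only in layers of width O(ε) around Σ, and each layer becomes regular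
after rescaling. Near a crossing point p, Σ is a graph φ = L - h = 0 with h constant along a vector
v and L v = 1 (`exists_graph_function`, `exists_crossing`). Put s = φ(x)/ε. By Hadamard's lemma
(`mul_slopeAvg`), φ(x - εu) = -ε (L u - a(x, u, ε) - s), where a is smooth also at ε = 0. A
volume-preserving shear turns the set of u where this is positive into a fixed half-space. Hence
X_ε(x) = G(x, s, ε) with G smooth for all real ε (`contDiff_layerField`,
`smoothedField_eq_layerField`). At ε = 0 the vector G(p, s, 0) is a convex combination of the two
one-sided fields, so dφ(G) > 0 there (`layerField_zero_pos`).

With s as time, the orbits in the layer solve dx/ds = ε G / dφ(G), which is smooth through ε = 0 and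
vanishes there. The passage through a layer is thus smooth in (x, ε) and is the identity at ε = 0
(`exists_layer_transition`). Between two layers `X_ε` is the convolution of one smooth field, again
smooth in (x, ε) up to ε = 0. The implicit function theorem then gives a smooth passage from φ₀ =
εR₀ to φ₁ = -εR₁, which becomes the transition map of the segment at ε = 0
(`exists_outer_transition`).

A half layer, an outer passage and another half layer compose to a map from Σ to Σ for each segment
(`exists_segment_map`), and these maps compose to P_ε (`SewingOrbit.exists_return_map`). The section
is kept away from the other crossing points, so the arc obtained is a first return; uniqueness of
integral curves makes it the only one (`IsArc.isFirstReturn_iff`). -/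

namespace PiecewiseSmooth

/-! ### Smooth dependence of short-time solutions on parameters, by the implicit function theorem in
a space of curves. -/

section Flow

universe u

variable {K : Type*} [TopologicalSpace K] [CompactSpace K]

/-- Pointwise application of a continuous family of linear maps to a continuous function. -/
noncomputable def pointwiseApply (K : Type*) [TopologicalSpace K] [CompactSpace K]
    (E F : Type*) [NormedAddCommGroup E] [NormedSpace ℝ E]
    [NormedAddCommGroup F] [NormedSpace ℝ F] : C(K, E →L[ℝ] F) →L[ℝ] C(K, E) →L[ℝ] C(K, F) :=
  LinearMap.mkContinuous₂
    (LinearMap.mk₂ ℝ (fun (A : C(K, E →L[ℝ] F)) (δ : C(K, E)) =>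
        (⟨fun k => A k (δ k), by fun_prop⟩ : C(K, F)))
      (fun _ _ _ => by ext; simp) (fun _ _ _ => by ext; simp) (fun _ _ _ => by ext; simp)
      (fun _ _ _ => by ext; simp)) 1
    (fun A δ => by
      rw [ContinuousMap.norm_le _ (by positivity)]
      intro k
      simpa using (A k).le_of_opNorm_le_of_le (A.norm_coe_le_norm k) (δ.norm_coe_le_norm k))

theorem pointwiseApply_apply {E F : Type*} [NormedAddCommGroup E] [NormedSpace ℝ E]
    [NormedAddCommGroup F] [NormedSpace ℝ F] (A : C(K, E →L[ℝ] F)) (δ : C(K, E)) (k : K) :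
    pointwiseApply K E F A δ k = A k (δ k) := rfl

/-- The superposition operator `α ↦ f ∘ α` on continuous functions is differentiable. -/
theorem hasFDerivAt_superposition {E F : Type*} [NormedAddCommGroup E] [NormedSpace ℝ E]
    [NormedAddCommGroup F] [NormedSpace ℝ F] {f : E → F} (hf : ContDiff ℝ 1 f) (α : C(K, E)) :
    HasFDerivAt (fun β : C(K, E) => (⟨fun k => f (β k), by fun_prop⟩ : C(K, F)))
      (pointwiseApply K E F ⟨fun k => fderiv ℝ f (α k),
        (hf.continuous_fderiv one_ne_zero).comp α.continuous⟩) α := by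
  rw [hasFDerivAt_iff_isLittleO_nhds_zero, Asymptotics.isLittleO_iff]
  intro c hc
  have hcompact : IsCompact (range α) := isCompact_range α.continuous
  -- Uniform continuity of the derivative around the compact range of α gives one radius for all
  -- `k`, so the mean value estimate holds in the sup norm.
  have hu := hcompact.uniformContinuousAt_of_continuousAt (fderiv ℝ f)
    (fun a _ => (hf.continuous_fderiv one_ne_zero).continuousAt) (Metric.dist_mem_uniformity hc)
  obtain ⟨δ, hδ, hδu⟩ := Metric.mem_uniformity_dist.1 hu
  filter_upwards [Metric.ball_mem_nhds (0 : C(K, E)) hδ] with η hη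
  rw [ContinuousMap.norm_le _ (by positivity)]
  intro k
  have hηk : ‖η k‖ < δ := (η.norm_coe_le_norm k).trans_lt (by simpa using hη)
  have key := (convex_ball (α k) δ).norm_image_sub_le_of_norm_fderiv_le' (𝕜 := ℝ) (f := f)
    (φ := fderiv ℝ f (α k)) (C := c) (x := α k) (y := α k + η k)
    (fun x _ => (hf.differentiable one_ne_zero).differentiableAt)
    (fun x hx => by
      have := hδu (a := α k) (b := x) (by rw [dist_comm]; exact hx) (mem_range_self k)
      rw [← dist_eq_norm, dist_comm]
      exact le_of_lt this)
    (Metric.mem_ball_self hδ) (by simpa using hηk)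
  simp only [add_sub_cancel_left] at key
  calc _ = ‖f (α k + η k) - f (α k) - fderiv ℝ f (α k) (η k)‖ := by
        simp [pointwiseApply_apply]
    _ ≤ c * ‖η k‖ := key
    _ ≤ c * ‖η‖ := by gcongr; exact η.norm_coe_le_norm k

/-- The derivative of superposition by f is, up to the bounded linear `pointwiseApply`,
superposition by the derivative of f. The induction therefore has to run over all targets F, and E
shares the universe of F so that `E →L[ℝ] F` is again an admissible target. -/
theorem contDiff_superposition_nat {E : Type u} [NormedAddCommGroup E] [NormedSpace ℝ E]
    (n : ℕ) : ∀ {F : Type u} [NormedAddCommGroup F] [NormedSpace ℝ F] {f : E → F}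
      (hf : ContDiff ℝ ∞ f), ContDiff ℝ n
        (fun β : C(K, E) => (⟨fun k => f (β k), hf.continuous.comp β.continuous⟩ : C(K, F))) := by
  induction n with
  | zero =>
    intro F _ _ f hf
    rw [Nat.cast_zero, contDiff_zero]
    exact ContinuousMap.continuous_postcomp (⟨f, hf.continuous⟩ : C(E, F))
  | succ n ih =>
    intro F _ _ f hf
    rw [Nat.cast_succ, contDiff_succ_iff_hasFDerivAt]
    refine ⟨fun α => pointwiseApply K E F ⟨fun k => fderiv ℝ f (α k),
      ((contDiff_infty_iff_fderiv.1 hf).2.continuous).comp α.continuous⟩, ?_, fun α =>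
      hasFDerivAt_superposition (hf.of_le (by simp)) α⟩
    exact (pointwiseApply K E F).contDiff.comp (ih (contDiff_infty_iff_fderiv.1 hf).2)

theorem contDiff_superposition {E F : Type u} [NormedAddCommGroup E] [NormedSpace ℝ E]
    [NormedAddCommGroup F] [NormedSpace ℝ F] {f : E → F} (hf : ContDiff ℝ ∞ f) :
    ContDiff ℝ ∞
      (fun β : C(K, E) => (⟨fun k => f (β k), hf.continuous.comp β.continuous⟩ : C(K, F))) :=
  contDiff_infty.2 fun n => contDiff_superposition_nat n hf

/-- Integration from `0`, as an operator on continuous functions on the unit interval. -/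
noncomputable def primitiveCLM (E : Type*) [NormedAddCommGroup E] [NormedSpace ℝ E] :
    C(Icc (0 : ℝ) 1, E) →L[ℝ] C(Icc (0 : ℝ) 1, E) :=
  LinearMap.mkContinuous
    { toFun := fun α => ⟨fun t => ∫ s in (0 : ℝ)..t, IccExtend zero_le_one α s,
        (intervalIntegral.continuous_primitive (fun a b =>
          (α.continuous.Icc_extend' (h := zero_le_one)).intervalIntegrable a b) 0).comp
            continuous_subtype_val⟩
      map_add' := fun α β => by
        ext t
        simp only [ContinuousMap.coe_mk, ContinuousMap.add_apply]
        rw [← intervalIntegral.integral_add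
          ((α.continuous.Icc_extend' (h := zero_le_one)).intervalIntegrable _ _)
          ((β.continuous.Icc_extend' (h := zero_le_one)).intervalIntegrable _ _)]
        rfl
      map_smul' := fun c α => by
        ext t
        simp only [ContinuousMap.coe_mk, ContinuousMap.smul_apply, RingHom.id_apply]
        rw [← intervalIntegral.integral_smul]
        rfl } 1
    (fun α => by
      rw [ContinuousMap.norm_le _ (by positivity)]
      intro t
      have h := intervalIntegral.norm_integral_le_of_norm_le_const (a := 0) (b := (t : ℝ))
        (f := IccExtend zero_le_one α) (C := ‖α‖) (fun s _ => α.norm_coe_le_norm _)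
      refine h.trans ?_
      rw [sub_zero, abs_of_nonneg t.2.1, one_mul]
      exact mul_le_of_le_one_right (norm_nonneg _) t.2.2)

theorem primitiveCLM_apply {E : Type*} [NormedAddCommGroup E] [NormedSpace ℝ E]
    (α : C(Icc (0 : ℝ) 1, E)) (t : Icc (0 : ℝ) 1) :
    primitiveCLM E α t = ∫ s in (0 : ℝ)..t, IccExtend zero_le_one α s := rfl

/-- The implicit function theorem, with smoothness on a neighbourhood. -/
theorem exists_implicitFunction {E₁ E₂ F : Type*}
    [NormedAddCommGroup E₁] [NormedSpace ℝ E₁] [CompleteSpace E₁]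
    [NormedAddCommGroup E₂] [NormedSpace ℝ E₂] [CompleteSpace E₂]
    [NormedAddCommGroup F] [NormedSpace ℝ F] [CompleteSpace F]
    {f : E₁ × E₂ → F} {u : E₁ × E₂} (hf : ∀ᶠ v in 𝓝 u, ContDiffAt ℝ ∞ f v)
    (hinv : (fderiv ℝ f u ∘L .inr ℝ E₁ E₂).IsInvertible) :
    ∃ ψ : E₁ → E₂, ψ u.1 = u.2 ∧ (∀ᶠ x in 𝓝 u.1, ContDiffAt ℝ ∞ ψ x) ∧
      (∀ᶠ x in 𝓝 u.1, f (x, ψ x) = f u) ∧ ∀ᶠ v in 𝓝 u, f v = f u ↔ ψ v.1 = v.2 := by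
  have hfu : ContDiffAt ℝ ∞ f u := hf.self_of_nhds
  have hn : (∞ : WithTop ℕ∞) ≠ 0 := by simp
  set ψ := hfu.implicitFunction hn hinv with hψ
  have hψu : ψ u.1 = u.2 := hfu.implicitFunction_apply_self hn hinv
  have hψc : ContDiffAt ℝ 1 ψ u.1 := (hfu.contDiffAt_implicitFunction hn hinv).of_le (by simp)
  have hcont : ContinuousAt (fun x => (x, ψ x)) u.1 := continuousAt_id.prodMk hψc.continuousAt
  have htend : Filter.Tendsto (fun x => (x, ψ x)) (𝓝 u.1) (𝓝 u) := by
    have := hcont.tendsto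
    rwa [hψu] at this
  have heq := hfu.eventually_apply_implicitFunction hn hinv
  refine ⟨ψ, hψu, ?_, heq, hfu.eventually_apply_eq_iff_implicitFunction hn hinv⟩
  -- `ContDiffAt ℝ ∞` at one point does not give smoothness on a neighbourhood. Invertibility is an
  -- open condition, so the theorem is applied again at each nearby point (x, ψ x); local uniqueness
  -- identifies the new implicit function with ψ.
  have hinv' : ∀ᶠ v in 𝓝 u, (fderiv ℝ f v ∘L .inr ℝ E₁ E₂).IsInvertible := by
    obtain ⟨e, he⟩ := hinv
    have hc : ContinuousAt (fun v => fderiv ℝ f v ∘L ContinuousLinearMap.inr ℝ E₁ E₂) u :=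
      ((hfu.fderiv_right (m := 0) (by simp)).continuousAt).clm_comp continuousAt_const
    have := hc.eventually_mem (he ▸ ContinuousLinearEquiv.nhds e)
    filter_upwards [this] with v hv using hv
  have hc' : ∀ᶠ x in 𝓝 u.1, ContinuousAt ψ x := by
    filter_upwards [hψc.eventually (by simp)] with x hx using hx.continuousAt
  filter_upwards [htend.eventually hf, htend.eventually hinv', heq.eventually_nhds, hc']
    with x hx hxi hxe hxc
  have hx' := hx.eventually_apply_eq_iff_implicitFunction hn hxi
  have hcx : Filter.Tendsto (fun y => (y, ψ y)) (𝓝 x) (𝓝 (x, ψ x)) :=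
    continuousAt_id.prodMk hxc
  refine (hx.contDiffAt_implicitFunction hn hxi).congr_of_eventuallyEq ?_
  filter_upwards [hcx.eventually hx', hxe] with y hy hye
  exact (hy.1 (hye.trans hxe.self_of_nhds.symm)).symm

/-- Solutions of `α' = t f(α)`, `α(0) = x` on the unit interval depend smoothly on `(x, t)`,
for `t` small. -/
theorem exists_smooth_solution {E : Type u} [NormedAddCommGroup E] [NormedSpace ℝ E]
    [CompleteSpace E] {f : E → E} (hf : ContDiff ℝ ∞ f) (x₀ : E) :
    ∃ ψ : E × ℝ → C(Icc (0 : ℝ) 1, E), (∀ᶠ q in 𝓝 (x₀, (0 : ℝ)), ContDiffAt ℝ ∞ ψ q) ∧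
      ∀ᶠ q in 𝓝 (x₀, (0 : ℝ)), ∀ r : Icc (0 : ℝ) 1,
        ψ q r = q.1 + q.2 • ∫ s in (0 : ℝ)..r, f (IccExtend zero_le_one (ψ q) s) := by
  set N : C(Icc (0 : ℝ) 1, E) → C(Icc (0 : ℝ) 1, E) :=
    fun β => ⟨fun k => f (β k), hf.continuous.comp β.continuous⟩
  have hN : ContDiff ℝ ∞ N := contDiff_superposition hf
  set c : E →L[ℝ] C(Icc (0 : ℝ) 1, E) := ContinuousLinearMap.const ℝ _
  set H : (E × ℝ) × C(Icc (0 : ℝ) 1, E) → C(Icc (0 : ℝ) 1, E) :=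
    fun v => v.2 - c v.1.1 - v.1.2 • primitiveCLM E (N v.2) with hH
  have hHs : ContDiff ℝ ∞ H := by
    refine (contDiff_snd.sub (c.contDiff.comp (contDiff_fst.comp contDiff_fst))).sub ?_
    exact (contDiff_snd.comp contDiff_fst).smul
      ((primitiveCLM E).contDiff.comp (hN.comp contDiff_snd))
  -- At t = 0 the integral term drops out, so the partial derivative in the curve is the identity.
  have hderiv : fderiv ℝ H ((x₀, 0), c x₀) ∘L .inr ℝ (E × ℝ) C(Icc (0 : ℝ) 1, E) = .id ℝ _ := by
    have h1 : HasFDerivAt (fun α => H ((x₀, 0), α))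
        (fderiv ℝ H ((x₀, 0), c x₀) ∘L .inr ℝ (E × ℝ) C(Icc (0 : ℝ) 1, E)) (c x₀) :=
      ((hHs.differentiable (by simp)).differentiableAt.hasFDerivAt).comp (c x₀)
        (hasFDerivAt_prodMk_right (x₀, (0 : ℝ)) (c x₀))
    have h2 : HasFDerivAt (fun α => H ((x₀, 0), α)) (.id ℝ _) (c x₀) := by
      simp only [hH, zero_smul, sub_zero]
      exact (hasFDerivAt_id _).sub_const _
    exact h1.unique h2
  obtain ⟨ψ, -, hψs, hψe, -⟩ := exists_implicitFunction (f := H) (u := ((x₀, 0), c x₀))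
    (Filter.Eventually.of_forall fun v => hHs.contDiffAt)
    (by rw [hderiv]; exact ⟨ContinuousLinearEquiv.refl ℝ _, rfl⟩)
  refine ⟨ψ, hψs, ?_⟩
  filter_upwards [hψe] with q hq r
  have h0 : H ((x₀, 0), c x₀) = 0 := by simp [hH]
  rw [h0, hH, sub_eq_zero] at hq
  have := congrArg (fun β : C(Icc (0 : ℝ) 1, E) => β r) (sub_eq_iff_eq_add.1 hq)
  simp only [ContinuousMap.add_apply, ContinuousMap.smul_apply, primitiveCLM_apply] at this
  rw [this, add_comm]
  rfl

end Flow

/-! ### The global smooth flow of a compactly supported field. -/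

section GlobalFlow

universe u

/-- A bounded Lipschitz vector field has global integral curves. -/
theorem exists_global_integralCurve {E : Type*} [NormedAddCommGroup E] [NormedSpace ℝ E]
    [CompleteSpace E] {f : E → E} {K : NNReal} (hK : LipschitzWith K f) {C : ℝ}
    (hC : ∀ x, ‖f x‖ ≤ C) (x : E) :
    ∃ c : ℝ → E, c 0 = x ∧ ∀ t, HasDerivAt c (f (c t)) t := by
  have hC0 : 0 ≤ C := (norm_nonneg _).trans (hC x)
  have hloc : ∀ a : ℝ, 0 < a → ∃ c : ℝ → E, c 0 = x ∧ ∀ t ∈ Ioo (-a) a, HasDerivAt c (f (c t)) t := by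
    intro a ha
    -- With speed at most C a curve stays within C * a of x during time a, so Picard–Lindelöf
    -- applies on an interval of any length.
    have hP : IsPicardLindelof (fun _ => f) (tmin := -a) (tmax := a)
        ⟨0, by constructor <;> linarith⟩ x ⟨C * a, by positivity⟩ 0 ⟨C, hC0⟩ K :=
      IsPicardLindelof.of_time_independent (fun y _ => hC y) hK.lipschitzOnWith
        (by simp only [sub_zero, zero_sub, neg_neg, max_self, NNReal.coe_zero]; exact le_refl (C * a))
    obtain ⟨c, hc0, hc⟩ := hP.exists_eq_forall_mem_Icc_hasDerivWithinAt₀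
    exact ⟨c, hc0, fun t ht => (hc t (Ioo_subset_Icc_self ht)).hasDerivAt (Icc_mem_nhds ht.1 ht.2)⟩
  choose! c hc0 hc using hloc
  have heq : ∀ a b : ℝ, 0 < a → a ≤ b → EqOn (c a) (c b) (Ioo (-a) a) := fun a b ha hab =>
    ODE_solution_unique_of_mem_Ioo (v := fun _ => f) (s := fun _ => univ) (K := K)
      (t₀ := 0) (fun _ _ => hK.lipschitzOnWith) (by constructor <;> linarith)
      (fun t ht => ⟨hc a ha t ht, mem_univ _⟩)
      (fun t ht => ⟨hc b (ha.trans_le hab) t ⟨by linarith [ht.1], by linarith [ht.2]⟩, mem_univ _⟩)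
      ((hc0 a ha).trans (hc0 b (ha.trans_le hab)).symm)
  refine ⟨fun t => c (|t| + 1) t, hc0 _ (by positivity), fun t => ?_⟩
  have hpos : 0 < |t| + 1 := by positivity
  have hmem : t ∈ Ioo (-(|t| + 1)) (|t| + 1) :=
    ⟨by linarith [neg_abs_le t], by linarith [le_abs_self t]⟩
  have hmem' : t ∈ Ioo (-(|t| + 2)) (|t| + 2) := ⟨by linarith [hmem.1], by linarith [hmem.2]⟩
  have h2 := hc (|t| + 2) (by positivity) t hmem'
  change HasDerivAt (fun t => c (|t| + 1) t) (f (c (|t| + 1) t)) t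
  rw [show c (|t| + 1) t = c (|t| + 2) t from heq _ _ hpos (by linarith) hmem]
  refine h2.congr_of_eventuallyEq ?_
  have : ∀ᶠ s in 𝓝 t, |s| < |t| + 1 := (continuous_abs.tendsto t).eventually
    (gt_mem_nhds (by linarith))
  filter_upwards [this] with s hs
  exact heq _ _ (by positivity) (by linarith)
    ⟨by linarith [neg_abs_le s], by linarith [le_abs_self s]⟩

/-- A smooth compactly supported vector field has a smooth global flow. -/
theorem exists_smooth_flow {E : Type u} [NormedAddCommGroup E] [NormedSpace ℝ E]
    [CompleteSpace E] {f : E → E} (hf : ContDiff ℝ ∞ f) (hsupp : HasCompactSupport f) :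
    ∃ Φ : E × ℝ → E, ContDiff ℝ ∞ Φ ∧ (∀ x, Φ (x, 0) = x) ∧
      ∀ x t, HasDerivAt (fun s => Φ (x, s)) (f (Φ (x, t))) t := by
  obtain ⟨K, hK⟩ := hf.lipschitzWith_of_hasCompactSupport hsupp (by simp)
  obtain ⟨C, hC⟩ := hsupp.exists_bound_of_continuous hf.continuous
  choose φ hφ0 hφ using exists_global_integralCurve hK hC
  have huniq : ∀ c d : ℝ → E, (∀ t, HasDerivAt c (f (c t)) t) → (∀ t, HasDerivAt d (f (d t)) t) →
      c 0 = d 0 → c = d := fun c d hc hd h =>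
    ODE_solution_unique_univ (v := fun _ => f) (s := fun _ => univ) (K := K) (t₀ := 0)
      (fun _ => hK.lipschitzOnWith) (fun t => ⟨hc t, mem_univ _⟩) (fun t => ⟨hd t, mem_univ _⟩) h
  have hgroup : ∀ x s t, φ (φ x s) t = φ x (t + s) := by
    intro x s t
    refine congrFun (huniq (φ (φ x s)) (fun t => φ x (t + s)) (hφ _) (fun t => ?_) ?_) t
    · exact (hφ x (t + s)).comp_add_const t s
    · simp [hφ0]
  set Φ : E × ℝ → E := fun q => φ q.1 q.2 with hΦ
  have hlocal : ∀ x₀, ∀ᶠ q in 𝓝 (x₀, (0 : ℝ)), ContDiffAt ℝ ∞ Φ q := by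
    intro x₀
    obtain ⟨ψ, hψs, hψ⟩ := exists_smooth_solution hf x₀
    -- The rescaled orbit r ↦ φ x (t r) solves the equation with field t f, so its value at r = 1 is
    -- the time-t map.
    have hEq : ∀ᶠ q in 𝓝 (x₀, (0 : ℝ)), Φ q = ψ q ⟨1, by simp⟩ := by
      filter_upwards [hψ] with q hq
      set β : ℝ → E := fun r => q.1 + q.2 • ∫ s in (0 : ℝ)..r, f (IccExtend zero_le_one (ψ q) s)
      have hcontI : Continuous fun s => f (IccExtend zero_le_one (ψ q) s) :=
        hf.continuous.comp ((ψ q).continuous.Icc_extend')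
      have hβ : ∀ r, HasDerivAt β (q.2 • f (IccExtend zero_le_one (ψ q) r)) r := fun r =>
        ((hcontI.integral_hasStrictDerivAt 0 r).hasDerivAt.const_smul q.2).const_add q.1
      have hβψ : ∀ r (hr : r ∈ Icc (0 : ℝ) 1), IccExtend zero_le_one (ψ q) r = β r := by
        intro r hr
        rw [IccExtend_of_mem _ _ hr]
        exact hq ⟨r, hr⟩
      have hscale : ∀ r, HasDerivAt (fun r => φ q.1 (q.2 * r)) (q.2 • f (φ q.1 (q.2 * r))) r := by
        intro r
        have h1 : HasDerivAt (fun r => q.2 * r) q.2 r := by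
          simpa using (hasDerivAt_id r).const_mul q.2
        exact (hφ q.1 (q.2 * r)).scomp r h1
      have := ODE_solution_unique (v := fun _ y => q.2 • f y) (K := ‖q.2‖₊ * K) (a := 0) (b := 1)
        (f := fun r => φ q.1 (q.2 * r)) (g := β)
        (fun _ => (lipschitzWith_smul q.2).comp hK)
        (fun r _ => (hscale r).continuousAt.continuousWithinAt)
        (fun r _ => (hscale r).hasDerivWithinAt)
        (fun r _ => (hβ r).continuousAt.continuousWithinAt)
        (fun r hr => by
          have := hβ r
          rw [hβψ r (Ico_subset_Icc_self hr)] at this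
          exact this.hasDerivWithinAt)
        (by simp [β, hφ0])
      have h1 := this (show (1 : ℝ) ∈ Icc (0 : ℝ) 1 by simp)
      simp only [mul_one] at h1
      rw [hΦ]
      exact h1.trans (hq ⟨1, by simp⟩).symm
    filter_upwards [hψs, hEq.eventually_nhds] with q hq hqe
    refine ContDiffAt.congr_of_eventuallyEq ?_ hqe
    exact (ContinuousMap.evalCLM ℝ (⟨1, by simp⟩ : Icc (0 : ℝ) 1)).contDiff.contDiffAt.comp q hq
  -- By the group law, Φ(x, t) = Φ(Φ(x, t₁), t - t₁), and Φ is smooth near time 0; smoothness at t₁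
  -- therefore passes to t when both are close to t₀.
  have hstep : ∀ x₀ t₀, ∀ᶠ t₁ in 𝓝 t₀, ∀ᶠ t in 𝓝 t₀,
      ContDiffAt ℝ ∞ Φ (x₀, t₁) → ContDiffAt ℝ ∞ Φ (x₀, t) := by
    intro x₀ t₀
    have hcont : Filter.Tendsto (fun p : ℝ × ℝ => (φ x₀ p.1, p.2 - p.1)) (𝓝 (t₀, t₀))
        (𝓝 (φ x₀ t₀, 0)) := by
      have hc : Continuous (φ x₀) := continuous_iff_continuousAt.2 fun t => (hφ x₀ t).continuousAt
      have : Continuous fun p : ℝ × ℝ => (φ x₀ p.1, p.2 - p.1) := by fun_prop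
      simpa using this.tendsto (t₀, t₀)
    have hev := hcont.eventually (hlocal (φ x₀ t₀))
    rw [nhds_prod_eq] at hev
    filter_upwards [hev.curry] with t₁ h
    filter_upwards [h] with t ht hsm
    have hcomp : Φ = fun q => Φ (Φ (q.1, t₁), q.2 - t₁) := by
      funext q
      simp [hΦ, hgroup]
    rw [hcomp]
    have hin : ContDiffAt ℝ ∞ (fun q : E × ℝ => (Φ (q.1, t₁), q.2 - t₁)) (x₀, t) :=
      (ContDiffAt.comp (x₀, t) (g := Φ) (f := fun q : E × ℝ => (q.1, t₁)) hsm
        (contDiffAt_fst.prodMk contDiffAt_const)).prodMk (contDiffAt_snd.sub contDiffAt_const)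
    exact ContDiffAt.comp (x₀, t) (g := Φ) ht hin
  refine ⟨Φ, contDiff_iff_contDiffAt.2 fun ⟨x₀, t⟩ => ?_, hφ0, hφ⟩
  -- Taking t = t₀ in `hstep` shows that the set is closed, and t₁ = t₀ shows that it is open.
  have hclopen : IsClopen {t | ContDiffAt ℝ ∞ Φ (x₀, t)} := by
    constructor
    · rw [← isOpen_compl_iff, isOpen_iff_mem_nhds]
      intro t₀ ht₀
      filter_upwards [hstep x₀ t₀] with t₁ h ht₁
      exact ht₀ (h.self_of_nhds ht₁)
    · rw [isOpen_iff_mem_nhds]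
      intro t₀ ht₀
      filter_upwards [(hstep x₀ t₀).self_of_nhds] with t h using h ht₀
  have huniv := hclopen.eq_univ ⟨0, (hlocal x₀).self_of_nhds⟩
  exact (huniv ▸ mem_univ t : t ∈ {t | ContDiffAt ℝ ∞ Φ (x₀, t)})

end GlobalFlow

/-! ### Uniqueness, time changes, cut-offs and flows near an orbit segment. -/

section OdeTools

/-- The derivative has limits at the end points, so the one-sided derivatives exist there. This is
needed because `SewingOrbit` and `IsTransition` impose the equation only on open intervals. -/
theorem hasDerivWithinAt_Icc_of_hasDerivAt_Ioo {E : Type*} [NormedAddCommGroup E]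
    [NormedSpace ℝ E] {c w : ℝ → E} {a b : ℝ} (hab : a < b) (hc : ContinuousOn c (Icc a b))
    (hw : ContinuousOn w (Icc a b)) (h : ∀ t ∈ Ioo a b, HasDerivAt c (w t) t) :
    ∀ t ∈ Icc a b, HasDerivWithinAt c (w t) (Icc a b) t := by
  have hdiff : DifferentiableOn ℝ c (Ioo a b) := fun t ht =>
    (h t ht).differentiableAt.differentiableWithinAt
  intro t ht
  rcases eq_or_lt_of_le ht.1 with rfl | hat
  · refine (hasDerivWithinAt_Ici_of_tendsto_deriv (s := Ioo a b) hdiff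
      ((hc a ht).mono Ioo_subset_Icc_self) (Ioo_mem_nhdsGT hab) ?_).mono Icc_subset_Ici_self
    have h1 : Filter.Tendsto w (𝓝[>] a) (𝓝 (w a)) :=
      ((hw a ht).mono Ioo_subset_Icc_self).tendsto.mono_left
        (nhdsWithin_le_of_mem (Ioo_mem_nhdsGT hab))
    refine h1.congr' ?_
    filter_upwards [Ioo_mem_nhdsGT hab] with s hs using (h s hs).deriv.symm
  rcases eq_or_lt_of_le ht.2 with rfl | htb
  · refine (hasDerivWithinAt_Iic_of_tendsto_deriv (s := Ioo a t) hdiff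
      ((hc t ht).mono Ioo_subset_Icc_self) (Ioo_mem_nhdsLT hab) ?_).mono Icc_subset_Iic_self
    have h1 : Filter.Tendsto w (𝓝[<] t) (𝓝 (w t)) :=
      ((hw t ht).mono Ioo_subset_Icc_self).tendsto.mono_left
        (nhdsWithin_le_of_mem (Ioo_mem_nhdsLT hab))
    refine h1.congr' ?_
    filter_upwards [Ioo_mem_nhdsLT hab] with s hs using (h s hs).deriv.symm
  · exact (h t ⟨hat, htb⟩).hasDerivWithinAt

/-- Uniqueness of integral curves of a vector field which is `C¹` along one of them. -/
theorem eqOn_of_integralCurve {E : Type*} [NormedAddCommGroup E] [NormedSpace ℝ E] {V : E → E}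
    {c d : ℝ → E} {a b : ℝ} (hV : ∀ t ∈ Icc a b, ContDiffAt ℝ 1 V (c t))
    (hc : ∀ t ∈ Icc a b, HasDerivWithinAt c (V (c t)) (Icc a b) t)
    (hd : ∀ t ∈ Icc a b, HasDerivWithinAt d (V (d t)) (Icc a b) t) (h0 : c a = d a) :
    EqOn c d (Icc a b) := by
  rcases lt_or_ge b a with hba | hab
  · simp [Icc_eq_empty (not_le.2 hba)]
  have hcc : ContinuousOn c (Icc a b) := fun t ht => (hc t ht).continuousWithinAt
  have hdc : ContinuousOn d (Icc a b) := fun t ht => (hd t ht).continuousWithinAt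
  have hclosed : IsClosed ({t | c t = d t} ∩ Icc a b) := by
    have := isClosed_Icc.isClosed_eq hcc hdc
    rwa [inter_comm]
  -- The coincidence set is closed, and it is open to the right: both curves stay for a while in a
  -- neighbourhood of their common value on which V is Lipschitz.
  refine hclosed.Icc_subset_of_forall_mem_nhdsWithin h0 ?_
  rintro t ⟨ht, htab⟩
  obtain ⟨K, s, hs, hKs⟩ := (hV t (Ico_subset_Icc_self htab)).exists_lipschitzOnWith
  have hIcc : Icc a b ∈ 𝓝[≥] t := Icc_mem_nhdsGE_of_mem htab
  have hcs : ∀ᶠ r in 𝓝[≥] t, c r ∈ s :=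
    ((hcc t (Ico_subset_Icc_self htab)).mono_of_mem_nhdsWithin hIcc) hs
  have hds : ∀ᶠ r in 𝓝[≥] t, d r ∈ s :=
    ((hdc t (Ico_subset_Icc_self htab)).mono_of_mem_nhdsWithin hIcc)
      (by rw [← (ht : c t = d t)]; exact hs)
  obtain ⟨u, htu, hu⟩ := mem_nhdsGE_iff_exists_Ico_subset.1 ((hcs.and hds).and hIcc)
  obtain ⟨u', htu', hu'⟩ := exists_between (mem_Ioi.1 htu)
  have hsub : Icc t u' ⊆ Icc a b := fun r hr => (hu ⟨hr.1, hr.2.trans_lt hu'⟩).2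
  have hmono : ∀ r ∈ Ico t u', Icc a b ∈ 𝓝[≥] r := fun r hr =>
    Icc_mem_nhdsGE_of_mem ⟨(hsub (Ico_subset_Icc_self hr)).1,
      hr.2.trans_le (hsub ⟨htu'.le, le_rfl⟩).2⟩
  have := ODE_solution_unique_of_mem_Icc_right (v := fun _ => V) (s := fun _ => s) (K := K)
    (a := t) (b := u') (f := c) (g := d) (fun _ _ => hKs) (hcc.mono hsub)
    (fun r hr => (hc r (hsub (Ico_subset_Icc_self hr))).mono_of_mem_nhdsWithin (hmono r hr))
    (fun r hr => (hu ⟨hr.1, hr.2.trans hu'⟩).1.1) (hdc.mono hsub)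
    (fun r hr => (hd r (hsub (Ico_subset_Icc_self hr))).mono_of_mem_nhdsWithin (hmono r hr))
    (fun r hr => (hu ⟨hr.1, hr.2.trans hu'⟩).1.2) ht
  exact Filter.mem_of_superset (Ioo_mem_nhdsGT htu') fun r hr => this (Ioo_subset_Icc_self hr)

/-- A curve which is an integral curve of `V` up to a positive time change can be
reparametrized to an integral curve. -/
theorem exists_timeChange {E : Type*} [NormedAddCommGroup E] [NormedSpace ℝ E] {V : E → E}
    {β : ℝ → E} {w : ℝ → ℝ} {l : ℝ} (hl : 0 < l) (hw : ContinuousOn w (Icc 0 l))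
    (hpos : ∀ r ∈ Icc 0 l, 0 < w r)
    (hβ : ∀ r ∈ Icc 0 l, HasDerivAt β (w r • V (β r)) r) :
    ∃ T > 0, ∃ c : ℝ → E, c 0 = β 0 ∧ c T = β l ∧
      (∀ t ∈ Icc 0 T, HasDerivWithinAt c (V (c t)) (Icc 0 T) t ∧ ∃ r ∈ Icc 0 l, c t = β r) ∧
      ∀ t ∈ Ioo 0 T, ∃ r ∈ Ioo 0 l, c t = β r := by
  -- Extending w by constants keeps its positive lower bound δ on the whole line, so the primitive S
  -- is an increasing bijection of ℝ whose inverse is the required time change.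
  set W : ℝ → ℝ := IccExtend hl.le (domRestrict (Icc 0 l) w) with hWdef
  have hWc : Continuous W := (continuousOn_iff_continuous_domRestrict.1 hw).Icc_extend'
  have hWe : ∀ r ∈ Icc 0 l, W r = w r := fun r hr => IccExtend_of_mem _ _ hr
  obtain ⟨r₀, hr₀, hmin⟩ := isCompact_Icc.exists_isMinOn (nonempty_Icc.2 hl.le) hw
  set δ := w r₀ with hδdef
  have hδ : 0 < δ := hpos r₀ hr₀
  have hWδ : ∀ r, δ ≤ W r := fun r => hmin (projIcc 0 l hl.le r).2
  set S : ℝ → ℝ := fun r => ∫ s in (0 : ℝ)..r, W s with hS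
  have hSd : ∀ r, HasDerivAt S (W r) r := fun r => (hWc.integral_hasStrictDerivAt 0 r).hasDerivAt
  have hS0 : S 0 = 0 := by simp [hS]
  have hSmono : StrictMono S := strictMono_of_deriv_pos fun r => by
    rw [(hSd r).deriv]; exact hδ.trans_le (hWδ r)
  have hScont : Continuous S := continuous_iff_continuousAt.2 fun r => (hSd r).continuousAt
  have hgrow : Monotone fun r => S r - δ * r := by
    refine monotone_of_deriv_nonneg (fun r => ((hSd r).sub
      ((hasDerivAt_id r).const_mul δ)).differentiableAt) fun r => ?_
    have := ((hSd r).sub ((hasDerivAt_id r).const_mul δ)).deriv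
    simp only [id_eq, mul_one] at this
    change 0 ≤ deriv (S - fun r => δ * r) r
    rw [this]
    linarith [hWδ r]
  have hSsurj : Function.Surjective S := by
    refine hScont.surjective ?_ ?_
    · refine Filter.tendsto_atTop_mono' _ ?_ (Filter.tendsto_id.const_mul_atTop hδ)
      filter_upwards [Filter.eventually_ge_atTop 0] with r hr
      have := hgrow hr
      simp only [hS0, mul_zero, sub_zero] at this
      simpa using this
    · refine Filter.tendsto_atBot_mono' _ ?_ (Filter.tendsto_id.const_mul_atBot hδ)
      filter_upwards [Filter.eventually_le_atBot 0] with r hr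
      have := hgrow hr
      simp only [hS0, mul_zero, sub_zero] at this
      simpa using this
  set e := hSmono.orderIsoOfSurjective S hSsurj
  have heS : ∀ r, e r = S r := fun r => rfl
  have hesymm : ∀ t, S (e.symm t) = t := fun t => e.apply_symm_apply t
  have he0 : e.symm 0 = 0 := by rw [OrderIso.symm_apply_eq, heS, hS0]
  have hel : e.symm (S l) = l := by rw [OrderIso.symm_apply_eq, heS]
  have hsymmd : ∀ t, HasDerivAt e.symm (W (e.symm t))⁻¹ t := fun t =>
    HasDerivAt.of_local_left_inverse (e.toHomeomorph.symm.continuous.continuousAt) (hSd _)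
      (hδ.trans_le (hWδ _)).ne' (Filter.Eventually.of_forall hesymm)
  have hmem : ∀ t ∈ Icc 0 (S l), e.symm t ∈ Icc 0 l := fun t ht =>
    ⟨by rw [← he0]; exact e.symm.monotone ht.1, by rw [← hel]; exact e.symm.monotone ht.2⟩
  refine ⟨S l, by rw [← hS0]; exact hSmono hl, fun t => β (e.symm t), ?_, ?_, fun t ht => ⟨?_, ?_⟩, ?_⟩
  · simp [he0]
  · simp [hel]
  · have h1 := (hβ _ (hmem t ht)).scomp t (hsymmd t)
    rw [smul_smul, hWe _ (hmem t ht), inv_mul_cancel₀ (hpos _ (hmem t ht)).ne', one_smul] at h1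
    exact h1.hasDerivWithinAt
  · exact ⟨_, hmem t ht, rfl⟩
  · exact fun t ht => ⟨_, ⟨by rw [← he0]; exact e.symm.strictMono ht.1,
      by rw [← hel]; exact e.symm.strictMono ht.2⟩, rfl⟩

/-- A function which is smooth near a compact set agrees near this set with a smooth compactly
supported function. -/
theorem exists_compactSupport_eq {E F : Type*} [NormedAddCommGroup E] [NormedSpace ℝ E]
    [FiniteDimensional ℝ E] [NormedAddCommGroup F] [NormedSpace ℝ F] {f : E → F} {Ω K : Set E}
    (hΩ : IsOpen Ω) (hf : ContDiffOn ℝ ∞ f Ω) (hK : IsCompact K) (hKΩ : K ⊆ Ω) :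
    ∃ g : E → F, ContDiff ℝ ∞ g ∧ HasCompactSupport g ∧ ∃ O, IsOpen O ∧ K ⊆ O ∧ O ⊆ Ω ∧
      EqOn g f O := by
  have : ProperSpace E := FiniteDimensional.proper ℝ E
  obtain ⟨K₁, hK₁, hKK₁, hK₁Ω⟩ := exists_compact_between hK hΩ hKΩ
  obtain ⟨χ, hχ1, hχ0, -⟩ := exists_contMDiffMap_one_nhds_of_subset_interior (n := (⊤ : ℕ∞))
    (modelWithCornersSelf ℝ E) hK.isClosed hKK₁
  have hχs : ContDiff ℝ ∞ χ := χ.contMDiff.contDiff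
  have hsupp : Function.support (fun x => χ x • f x) ⊆ K₁ := by
    intro x hx
    by_contra hxK
    exact hx (by simp [hχ0 x hxK])
  refine ⟨fun x => χ x • f x, contDiff_iff_contDiffAt.2 fun x => ?_,
    HasCompactSupport.of_support_subset_isCompact hK₁ hsupp, ?_⟩
  · by_cases hx : x ∈ Ω
    · exact hχs.contDiffAt.smul (hf.contDiffAt (hΩ.mem_nhds hx))
    · have hx' : x ∉ K₁ := fun h => hx (hK₁Ω h)
      refine contDiffAt_const (c := (0 : F)) |>.congr_of_eventuallyEq ?_
      filter_upwards [hK₁.isClosed.isOpen_compl.mem_nhds hx'] with y hy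
      simp [hχ0 y hy]
  · obtain ⟨O, hO, hKO, hOχ⟩ := eventually_nhdsSet_iff_exists.1 hχ1
    exact ⟨O ∩ Ω, hO.inter hΩ, subset_inter hKO hKΩ, inter_subset_right, fun x hx => by
      simp [hOχ x hx.1]⟩

/-- The tube lemma, with a margin δ past both ends: the hitting time of a nearby orbit may exceed
that of the central one. -/
theorem eventually_forall_Icc_of_continuous {A B : Type*} [TopologicalSpace A]
    [TopologicalSpace B] {Φ : A × ℝ → B} (hΦ : Continuous Φ) {a : A} {s t : ℝ} {O : Set B}
    (hO : IsOpen O) (h : ∀ r ∈ Icc s t, Φ (a, r) ∈ O) :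
    ∃ δ > 0, ∀ᶠ x in 𝓝 a, ∀ r ∈ Icc (s - δ) (t + δ), Φ (x, r) ∈ O := by
  rcases lt_or_ge t s with hts | hst
  · refine ⟨(s - t) / 4, by linarith, Filter.Eventually.of_forall fun x r hr => ?_⟩
    exfalso
    have := hr.1.trans hr.2
    linarith
  have hev : ∀ r ∈ Icc s t, ∀ᶠ q in 𝓝 (a, r), Φ q ∈ O := fun r hr =>
    hΦ.continuousAt.eventually (hO.mem_nhds (h r hr))
  have hs := hev s ⟨le_rfl, hst⟩
  have ht := hev t ⟨hst, le_rfl⟩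
  rw [nhds_prod_eq, Filter.eventually_prod_iff] at hs ht
  obtain ⟨p, hp, q, hq, hpq⟩ := hs
  obtain ⟨p', hp', q', hq', hpq'⟩ := ht
  obtain ⟨δ, hδ, hδq⟩ := Metric.eventually_nhds_iff.1 hq
  obtain ⟨δ', hδ', hδq'⟩ := Metric.eventually_nhds_iff.1 hq'
  have hmid := isCompact_Icc.eventually_forall_of_forall_eventually
    (P := fun x r => Φ (x, r) ∈ O) hev
  refine ⟨min δ δ' / 2, by positivity, ?_⟩
  filter_upwards [hmid, hp, hp'] with x hx hxp hxp' r hr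
  rcases lt_or_ge r s with hrs | hrs
  · refine hpq hxp (hδq ?_)
    rw [Real.dist_eq, abs_sub_lt_iff]
    constructor <;> linarith [hr.1, min_le_left δ δ']
  rcases lt_or_ge t r with hrt | hrt
  · refine hpq' hxp' (hδq' ?_)
    rw [Real.dist_eq, abs_sub_lt_iff]
    constructor <;> linarith [hr.2, min_le_right δ δ']
  · exact hx r ⟨hrs, hrt⟩

/-- Smooth dependence on initial conditions near an orbit segment. -/
theorem exists_flow_near_orbit {E : Type*} [NormedAddCommGroup E] [NormedSpace ℝ E]
    [FiniteDimensional ℝ E] {f : E → E} {Ω : Set E} (hΩ : IsOpen Ω) (hf : ContDiffOn ℝ ∞ f Ω)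
    {α : ℝ → E} {T : ℝ}
    (hα : ∀ t ∈ Icc 0 T, α t ∈ Ω ∧ HasDerivWithinAt α (f (α t)) (Icc 0 T) t) :
    ∃ Φ : E × ℝ → E, ContDiff ℝ ∞ Φ ∧ (∀ x, Φ (x, 0) = x) ∧
      (∀ t ∈ Icc 0 T, Φ (α 0, t) = α t) ∧ ∃ δ > 0, ∀ᶠ x in 𝓝 (α 0), ∀ t ∈ Icc (-δ) (T + δ),
        HasDerivAt (fun s => Φ (x, s)) (f (Φ (x, t))) t ∧ Φ (x, t) ∈ Ω := by
  have : CompleteSpace E := FiniteDimensional.complete ℝ E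
  have hαc : ContinuousOn α (Icc 0 T) := fun t ht => (hα t ht).2.continuousWithinAt
  -- Cutting f off outside a neighbourhood of the segment gives a global flow, and nearby orbits do
  -- not see the cut-off.
  obtain ⟨g, hg, hgs, O, hO, hKO, hOΩ, hgO⟩ := exists_compactSupport_eq hΩ hf
    (isCompact_Icc.image_of_continuousOn hαc) (image_subset_iff.2 fun t ht => (hα t ht).1)
  obtain ⟨Φ, hΦ, hΦ0, hΦd⟩ := exists_smooth_flow hg hgs
  have hEq : EqOn (fun t => Φ (α 0, t)) α (Icc 0 T) := by
    refine eqOn_of_integralCurve (V := g) (fun t _ => (hg.of_le (by simp)).contDiffAt)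
      (fun t _ => (hΦd _ t).hasDerivWithinAt) (fun t ht => ?_) (hΦ0 _)
    rw [hgO (hKO (mem_image_of_mem α ht))]
    exact (hα t ht).2
  refine ⟨Φ, hΦ, hΦ0, hEq, ?_⟩
  obtain ⟨δ, hδ, h⟩ := eventually_forall_Icc_of_continuous hΦ.continuous (a := α 0) (s := 0)
    (t := T) hO (fun r hr => by
      have := hEq hr
      simp only at this
      rw [this]
      exact hKO (mem_image_of_mem α hr))
  refine ⟨δ, hδ, ?_⟩
  filter_upwards [h] with x hx t ht
  have hxt := hx t ⟨by linarith [ht.1], ht.2⟩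
  refine ⟨?_, hOΩ hxt⟩
  rw [← hgO hxt]
  exact hΦd x t

end OdeTools

/-! ### The regularized field near Σ as a smooth function of (x, φ(x)/ε, ε). -/

section LayerField

/-- Integrals of smooth functions, with compact support in the integration variable, depend
smoothly on parameters. -/
theorem contDiffOn_parametric_integral {P G F : Type*} [NormedAddCommGroup P] [NormedSpace ℝ P]
    [NormedAddCommGroup G] [NormedSpace ℝ G] [MeasurableSpace G] [BorelSpace G]
    [NormedAddCommGroup F] [NormedSpace ℝ F] {μ : Measure G} {f : G → ℝ}
    (hf : LocallyIntegrable f μ) {g : P × G → F} (hg : ContDiff ℝ ∞ g) {s : Set P} (hs : IsOpen s)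
    {k : Set G} (hk : IsCompact k) (hgk : ∀ p ∈ s, ∀ u ∉ k, g (p, u) = 0) :
    ContDiffOn ℝ ∞ (fun p => ∫ u, f u • g (p, u) ∂μ) s := by
  -- The integral is a parametric convolution evaluated at the point 0, whence the reflections `-u`
  -- and `-k`.
  have h := contDiffOn_convolution_right_with_param_comp (μ := μ) (n := ⊤)
    (ContinuousLinearMap.lsmul ℝ ℝ) (s := s) (v := fun _ => (0 : G)) contDiffOn_const (f := f)
    (g := fun p u => g (p, -u)) (k := -k) hs hk.neg
    (fun p u hp hu => hgk p hp (-u) (by simpa using hu)) hf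
    ((hg.comp (contDiff_fst.prodMk contDiff_snd.neg)).contDiffOn)
  refine h.congr fun p _ => ?_
  simp [convolution_def]

variable {n : ℕ} {m : Eu n → ℝ} {h : Eu n → ℝ} {L : Eu n →L[ℝ] ℝ} {v : Eu n} {Z : Eu n → Eu n}

/-- The convolution `m_ε ∗ Y`, in a form which makes sense for all real `ε`. -/
noncomputable def mollified (m : Eu n → ℝ) (Y : Eu n → Eu n) (q : Eu n × ℝ) : Eu n :=
  ∫ u, m u • Y (q.1 - q.2 • u)

theorem contDiff_mollified (hm : IsMollifier m) (hZ : ContDiff ℝ ∞ Z) :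
    ContDiff ℝ ∞ (mollified m Z) := by
  rw [← contDiffOn_univ]
  have hg : ContDiff ℝ ∞ (fun p : (Eu n × ℝ) × Eu n => m p.2 • Z (p.1.1 - p.1.2 • p.2)) :=
    (hm.smooth.comp contDiff_snd).smul (hZ.comp (by fun_prop))
  refine (contDiffOn_parametric_integral (f := fun _ => (1 : ℝ)) (μ := volume)
    (locallyIntegrable_const 1) hg isOpen_univ (k := tsupport m) hm.compact_support ?_).congr ?_
  · intro p _ u hu
    simp [image_eq_zero_of_notMem_tsupport hu]
  · intro p _
    simp [mollified]

theorem mollified_zero (hm : IsMollifier m) (x : Eu n) : mollified m Z (x, 0) = Z x := by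
  simp [mollified, integral_smul_const, hm.integral_eq_one]

/-- The average slope of `h` between `x - ε w` and `x`, divided by `ε`; for `q = (x, w, ε)`. -/
noncomputable def slopeAvg (h : Eu n → ℝ) (q : Eu n × Eu n × ℝ) : ℝ :=
  ∫ r in Icc (0 : ℝ) 1, fderiv ℝ h (q.1 - (r * q.2.2) • q.2.1) q.2.1

theorem contDiff_slopeAvg (hh : ContDiff ℝ ∞ h) : ContDiff ℝ ∞ (slopeAvg h) := by
  -- The indicator of [0, 1] goes into the locally integrable weight; χ = 1 on [0, 1] only makes the
  -- smooth factor compactly supported.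
  obtain ⟨χ, hχ, hχs, O, -, hO, -, hχO⟩ := exists_compactSupport_eq (E := ℝ) (F := ℝ)
    (f := fun _ => 1) isOpen_univ contDiffOn_const (isCompact_Icc (a := (0 : ℝ)) (b := 1))
    (subset_univ _)
  rw [← contDiffOn_univ]
  have hh' : ContDiff ℝ ∞ (fderiv ℝ h) := (contDiff_infty_iff_fderiv.1 hh).2
  have hg : ContDiff ℝ ∞ (fun p : (Eu n × Eu n × ℝ) × ℝ =>
      χ p.2 • fderiv ℝ h (p.1.1 - (p.2 * p.1.2.2) • p.1.2.1) p.1.2.1) :=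
    (hχ.comp contDiff_snd).smul ((hh'.comp (by fun_prop)).clm_apply (by fun_prop))
  refine (contDiffOn_parametric_integral (f := (Icc (0 : ℝ) 1).indicator fun _ => (1 : ℝ))
    (μ := volume) ((locallyIntegrable_const 1).indicator measurableSet_Icc) hg isOpen_univ
    (k := tsupport χ) hχs ?_).congr ?_
  · intro p _ u hu
    simp [image_eq_zero_of_notMem_tsupport hu]
  · intro p _
    rw [slopeAvg, ← integral_indicator measurableSet_Icc]
    congr 1
    funext r
    by_cases hr : r ∈ Icc (0 : ℝ) 1
    · simp [indicator_of_mem hr, hχO (hO hr)]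
    · simp [indicator_of_notMem hr]

/-- Hadamard's lemma: it gives the difference quotient of h a form that remains smooth at ε = 0. -/
theorem mul_slopeAvg (hh : ContDiff ℝ ∞ h) (x w : Eu n) (ε : ℝ) :
    ε * slopeAvg h (x, w, ε) = h x - h (x - ε • w) := by
  have hcont : Continuous fun r : ℝ => fderiv ℝ h (x - (r * ε) • w) w := by
    have := (contDiff_infty_iff_fderiv.1 hh).2.continuous
    fun_prop
  have hd : ∀ r ∈ uIcc (0 : ℝ) 1, HasDerivAt (fun r : ℝ => h (x - (r * ε) • w))
      (-(ε * fderiv ℝ h (x - (r * ε) • w) w)) r := by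
    intro r _
    have h1 : HasDerivAt (fun r : ℝ => x - (r * ε) • w) (-(ε • w)) r := by
      simpa using (((hasDerivAt_id r).mul_const ε).smul_const w).const_sub x
    have h2 := (((hh.differentiable (by simp)).differentiableAt
      (x := x - (r * ε) • w)).hasFDerivAt).comp_hasDerivAt r h1
    simp only [map_neg, map_smul, smul_eq_mul] at h2
    exact h2
  have := intervalIntegral.integral_eq_sub_of_hasDerivAt hd
    ((continuous_const.mul hcont).neg.intervalIntegrable _ _)
  rw [intervalIntegral.integral_neg, intervalIntegral.integral_const_mul,
    intervalIntegral.integral_of_le zero_le_one, ← integral_Icc_eq_integral_Ioc] at this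
  simp only [zero_mul, zero_smul, sub_zero, one_mul] at this
  rw [slopeAvg]
  linarith

theorem fderiv_apply_of_invariant (hh : ContDiff ℝ ∞ h) (hinv : ∀ x (r : ℝ), h (x + r • v) = h x)
    (x : Eu n) : fderiv ℝ h x v = 0 := by
  have h1 : HasDerivAt (fun r : ℝ => x + r • v) v 0 := by
    simpa using ((hasDerivAt_id (0 : ℝ)).smul_const v).const_add x
  have h2 : HasFDerivAt h (fderiv ℝ h x) (x + (0 : ℝ) • v) := by
    simpa using (hh.differentiable (by simp)).differentiableAt.hasFDerivAt
  have h3 := h2.comp_hasDerivAt (0 : ℝ) h1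
  have h4 : h ∘ (fun r : ℝ => x + r • v) = fun _ => h x := funext fun r => hinv x r
  rw [h4] at h3
  exact h3.unique (hasDerivAt_const _ _)

/-- This invariance is what makes `shear` a shear: the displacement of u along v depends only on the
class of u modulo v, so the inverse is explicit and volume is preserved. -/
theorem slopeAvg_add_smul (hh : ContDiff ℝ ∞ h) (hinv : ∀ x (r : ℝ), h (x + r • v) = h x)
    (x w : Eu n) (ε r : ℝ) : slopeAvg h (x, w + r • v, ε) = slopeAvg h (x, w, ε) := by
  have htrans : ∀ y (t : ℝ), fderiv ℝ h (y + t • v) = fderiv ℝ h y := by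
    intro y t
    have := fderiv_comp_add_right (𝕜 := ℝ) (f := h) (x := y) (t • v)
    rw [← this]
    congr 1
    funext z
    exact hinv z t
  simp only [slopeAvg]
  congr 1
  funext t
  have : x - (t * ε) • (w + r • v) = (x - (t * ε) • w) + (-(t * ε * r)) • v := by
    rw [smul_add, smul_smul, neg_smul]; abel
  rw [this, htrans, map_add, map_smul, fderiv_apply_of_invariant hh hinv]
  simp

/-- The shear which straightens the discontinuity locus; for `q = (x, s, ε)`. -/
noncomputable def shear (h : Eu n → ℝ) (v : Eu n) (q : Eu n × ℝ × ℝ) (u : Eu n) : Eu n :=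
  u + (q.2.1 + slopeAvg h (q.1, u, q.2.2)) • v

theorem shear_sub (hh : ContDiff ℝ ∞ h) (hinv : ∀ x (r : ℝ), h (x + r • v) = h x)
    (q : Eu n × ℝ × ℝ) (u : Eu n) :
    shear h v q u - (q.2.1 + slopeAvg h (q.1, shear h v q u, q.2.2)) • v = u := by
  rw [shear, slopeAvg_add_smul hh hinv]
  simp

/-- The predicate `R` is a parameter because two cases are needed: the negative side, over which the
jump is integrated, and the zero set, which has measure zero. -/
theorem shear_image (hh : ContDiff ℝ ∞ h) (hinv : ∀ x (r : ℝ), h (x + r • v) = h x)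
    (hL : L v = 1) (q : Eu n × ℝ × ℝ) (R : ℝ → Prop) :
    shear h v q '' {u | R (L u)} =
      {w | R (L w - slopeAvg h (q.1, w, q.2.2) - q.2.1)} := by
  ext w
  constructor
  · rintro ⟨u, hu, rfl⟩
    simp only [mem_ofPred_eq] at hu ⊢
    convert hu using 1
    rw [shear, slopeAvg_add_smul hh hinv, map_add, map_smul, hL, smul_eq_mul]
    ring
  · intro hw
    simp only [mem_ofPred_eq] at hw
    refine ⟨w - (q.2.1 + slopeAvg h (q.1, w, q.2.2)) • v, ?_, ?_⟩
    · simp only [mem_ofPred_eq, map_sub, map_smul, hL, smul_eq_mul]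
      convert hw using 1
      ring
    · have := slopeAvg_add_smul hh hinv q.1 w q.2.2 (-(q.2.1 + slopeAvg h (q.1, w, q.2.2)))
      rw [neg_smul, ← sub_eq_add_neg] at this
      rw [shear, this]
      simp

theorem contDiff_shear (hh : ContDiff ℝ ∞ h) :
    ContDiff ℝ ∞ fun p : (Eu n × ℝ × ℝ) × Eu n => shear h v p.1 p.2 := by
  have h1 : ContDiff ℝ ∞ fun p : (Eu n × ℝ × ℝ) × Eu n => slopeAvg h (p.1.1, p.2, p.1.2.2) :=
    (contDiff_slopeAvg hh).comp (by fun_prop)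
  unfold shear
  fun_prop

/-- The displacement is k(u) v with k constant along v, so the derivative is a transvection whose
linear form kills v. -/
theorem hasFDerivAt_shear (hh : ContDiff ℝ ∞ h) (hinv : ∀ x (r : ℝ), h (x + r • v) = h x)
    (q : Eu n × ℝ × ℝ) (u : Eu n) :
    ∃ A : Eu n →L[ℝ] Eu n, HasFDerivAt (shear h v q) A u ∧ A.det = 1 := by
  set k : Eu n → ℝ := fun u => q.2.1 + slopeAvg h (q.1, u, q.2.2)
  have hk : ContDiff ℝ ∞ k := by
    have h1 : ContDiff ℝ ∞ fun u : Eu n => slopeAvg h (q.1, u, q.2.2) :=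
      (contDiff_slopeAvg hh).comp (by fun_prop)
    exact contDiff_const.add h1
  have hkinv : ∀ x (r : ℝ), k (x + r • v) = k x := fun x r => by
    simp only [k, slopeAvg_add_smul hh hinv]
  have hd : HasFDerivAt (id + fun u => k u • v) (.id ℝ (Eu n) + (fderiv ℝ k u).smulRight v) u :=
    (hasFDerivAt_id u).add
      (((hk.differentiable (by simp)).differentiableAt).hasFDerivAt.smul_const v)
  refine ⟨_, hd, ?_⟩
  have : ((.id ℝ _ + (fderiv ℝ k u).smulRight v : Eu n →L[ℝ] Eu n) : Eu n →ₗ[ℝ] Eu n) =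
      LinearMap.transvection (fderiv ℝ k u : Eu n →ₗ[ℝ] ℝ) v := by
    ext; simp [LinearMap.transvection]
  rw [ContinuousLinearMap.det, this, LinearMap.transvection.det]
  simp [fderiv_apply_of_invariant hk hkinv]

theorem integral_shear_image (hh : ContDiff ℝ ∞ h) (hinv : ∀ x (r : ℝ), h (x + r • v) = h x)
    {F : Type*} [NormedAddCommGroup F] [NormedSpace ℝ F] (q : Eu n × ℝ × ℝ) {A : Set (Eu n)}
    (hA : MeasurableSet A) (g : Eu n → F) :
    ∫ w in shear h v q '' A, g w = ∫ u in A, g (shear h v q u) := by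
  choose T' hT' hdet using hasFDerivAt_shear hh hinv q
  rw [integral_image_eq_integral_abs_det_fderiv_smul volume hA
    (fun u _ => (hT' u).hasFDerivWithinAt)]
  · simp [hdet]
  · intro a _ b _ hab
    rw [← shear_sub hh hinv q a, hab, shear_sub hh hinv q b]

/-- The set is the image of a hyperplane under a differentiable map. As it is null, the values of X
on Σ do not affect the convolution. -/
theorem volume_discontinuity (hh : ContDiff ℝ ∞ h) (hinv : ∀ x (r : ℝ), h (x + r • v) = h x)
    (hL : L v = 1) (q : Eu n × ℝ × ℝ) :
    volume {w | L w - slopeAvg h (q.1, w, q.2.2) - q.2.1 = 0} = 0 := by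
  rw [← shear_image hh hinv hL q (fun t => t = 0)]
  refine addHaar_image_eq_zero_of_differentiableOn_of_addHaar_eq_zero volume ?_ ?_
  · intro u _
    obtain ⟨A, hA, -⟩ := hasFDerivAt_shear hh hinv q u
    exact hA.differentiableAt.differentiableWithinAt
  · refine Measure.addHaar_submodule volume (LinearMap.ker (L : Eu n →ₗ[ℝ] ℝ)) ?_
    intro htop
    have : v ∈ LinearMap.ker (L : Eu n →ₗ[ℝ] ℝ) := htop ▸ Submodule.mem_top
    rw [LinearMap.mem_ker] at this
    exact one_ne_zero (hL.symm.trans this)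

/-- The contribution of the jump `Z` of a piecewise smooth field to its regularization, in
coordinates `q = (x, s, ε)` with `L x - h x = ε s`. -/
noncomputable def layerJump (m : Eu n → ℝ) (Z : Eu n → Eu n) (L : Eu n →L[ℝ] ℝ) (v : Eu n)
    (h : Eu n → ℝ) (q : Eu n × ℝ × ℝ) : Eu n :=
  ∫ u in {u | L u < 0}, m (shear h v q u) • Z (q.1 - q.2.2 • shear h v q u)

/-- The domain of integration is a fixed half-space, so the parameters enter only through a smooth
integrand. -/
theorem contDiff_layerJump (hm : IsMollifier m) (hh : ContDiff ℝ ∞ h)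
    (hinv : ∀ x (r : ℝ), h (x + r • v) = h x) (hZ : ContDiff ℝ ∞ Z) :
    ContDiff ℝ ∞ (layerJump m Z L v h) := by
  have hmeas : MeasurableSet {u : Eu n | L u < 0} :=
    measurableSet_lt L.continuous.measurable measurable_const
  have hg : ContDiff ℝ ∞ (fun p : (Eu n × ℝ × ℝ) × Eu n =>
      m (shear h v p.1 p.2) • Z (p.1.1 - p.1.2.2 • shear h v p.1 p.2)) := by
    have hs := contDiff_shear (v := v) hh
    exact (hm.smooth.comp hs).smul (hZ.comp (by fun_prop))
  refine contDiff_iff_contDiffAt.2 fun q₀ => ?_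
  -- The support of the integrand moves with q. Over a ball around q₀ it stays in k, the union of
  -- the inverse shears of the support of m.
  set k : Set (Eu n) := (fun p : (Eu n × ℝ × ℝ) × Eu n =>
    p.2 - (p.1.2.1 + slopeAvg h (p.1.1, p.2, p.1.2.2)) • v) ''
      (Metric.closedBall q₀ 1 ×ˢ tsupport m) with hkdef
  have hcont : Continuous (fun p : (Eu n × ℝ × ℝ) × Eu n =>
      p.2 - (p.1.2.1 + slopeAvg h (p.1.1, p.2, p.1.2.2)) • v) := by
    have := (contDiff_slopeAvg hh).continuous
    fun_prop
  have hk : IsCompact k :=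
    ((isCompact_closedBall q₀ 1).prod hm.compact_support).image hcont
  refine ((contDiffOn_parametric_integral
    (f := {u : Eu n | L u < 0}.indicator fun _ => (1 : ℝ)) (μ := volume)
    ((locallyIntegrable_const 1).indicator hmeas) hg (Metric.isOpen_ball (x := q₀) (ε := 1)) hk
    ?_).congr ?_).contDiffAt (Metric.ball_mem_nhds q₀ one_pos)
  · intro q hq u hu
    have : shear h v q u ∉ tsupport m := fun hmem =>
      hu ⟨(q, shear h v q u), ⟨Metric.ball_subset_closedBall hq, hmem⟩, shear_sub hh hinv q u⟩
    simp [image_eq_zero_of_notMem_tsupport this]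
  · intro q _
    rw [layerJump, ← integral_indicator hmeas]
    congr 1
    funext u
    by_cases hu : u ∈ {u : Eu n | L u < 0}
    · simp only [indicator_of_mem hu, one_smul]
    · simp only [indicator_of_notMem hu, zero_smul]

/-- Undoing the shear. For ε > 0 and s = φ(x)/ε the new domain consists of the w for which x - εw
lies above the graph. -/
theorem layerJump_eq (hh : ContDiff ℝ ∞ h) (hinv : ∀ x (r : ℝ), h (x + r • v) = h x)
    (hL : L v = 1) (q : Eu n × ℝ × ℝ) :
    layerJump m Z L v h q =
      ∫ w in {w | L w - slopeAvg h (q.1, w, q.2.2) - q.2.1 < 0}, m w • Z (q.1 - q.2.2 • w) := by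
  rw [← shear_image hh hinv hL q (fun t => t < 0), integral_shear_image hh hinv q
    (measurableSet_lt L.continuous.measurable measurable_const)]
  rfl

theorem measurableSet_layer (hh : ContDiff ℝ ∞ h) (q : Eu n × ℝ × ℝ) :
    MeasurableSet {w | L w - slopeAvg h (q.1, w, q.2.2) - q.2.1 < 0} := by
  have := (contDiff_slopeAvg hh).continuous
  exact measurableSet_lt (Continuous.measurable (by fun_prop)) measurable_const

/-- The regularization of a piecewise smooth field given by `Ym` on `L x < h x` and by `Yp` on
`h x < L x`, in coordinates `q = (x, s, ε)` with `L x - h x = ε s`. -/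
noncomputable def layerField (m : Eu n → ℝ) (Ym Yp : Eu n → Eu n) (L : Eu n →L[ℝ] ℝ) (v : Eu n)
    (h : Eu n → ℝ) (q : Eu n × ℝ × ℝ) : Eu n :=
  mollified m Ym (q.1, q.2.2) + layerJump m (fun x => Yp x - Ym x) L v h q

variable {Ym Yp : Eu n → Eu n}

theorem contDiff_layerField (hm : IsMollifier m) (hh : ContDiff ℝ ∞ h)
    (hinv : ∀ x (r : ℝ), h (x + r • v) = h x) (hYm : ContDiff ℝ ∞ Ym) (hYp : ContDiff ℝ ∞ Yp) :
    ContDiff ℝ ∞ (layerField m Ym Yp L v h) :=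
  ((contDiff_mollified hm hYm).comp (by fun_prop)).add
    (contDiff_layerJump hm hh hinv (hYp.sub hYm))

/-- For `ε = 0` the field in the layer is a convex combination of the two fields. -/
theorem layerField_zero_pos (hm : IsMollifier m) (hh : ContDiff ℝ ∞ h)
    (hinv : ∀ x (r : ℝ), h (x + r • v) = h x) (hL : L v = 1) (x : Eu n) (s : ℝ)
    (l : Eu n →L[ℝ] ℝ) (hlm : 0 < l (Ym x)) (hlp : 0 < l (Yp x)) :
    0 < l (layerField m Ym Yp L v h (x, s, 0)) := by
  have hint : Integrable m :=
    hm.smooth.continuous.integrable_of_hasCompactSupport hm.compact_support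
  rw [layerField, layerJump_eq hh hinv hL, mollified_zero hm]
  simp only [zero_smul, sub_zero]
  rw [integral_smul_const]
  -- θ is the mass that m gives to the upper side; the field equals (1 - θ) Ym + θ Yp at x.
  set θ := ∫ w in {w | L w - slopeAvg h (x, w, 0) - s < 0}, m w
  have hθ0 : 0 ≤ θ := integral_nonneg hm.nonneg
  have hθ1 : θ ≤ 1 := by
    rw [← hm.integral_eq_one]
    exact setIntegral_le_integral hint (Filter.Eventually.of_forall hm.nonneg)
  rw [map_add, map_smul, map_sub, smul_eq_mul]
  rcases eq_or_lt_of_le hθ0 with h0 | h0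
  · rw [← h0]; linarith
  · nlinarith [mul_pos h0 hlp, mul_nonneg (sub_nonneg.2 hθ1) hlm.le]

theorem smoothedField_eq_integral (X : Eu n → Eu n) {ε : ℝ} (hε : 0 < ε) (x : Eu n) :
    smoothedField m X ε x = ∫ u, m u • X (x - ε • u) := by
  rw [smoothedField, convolution_lsmul]
  have h1 := Measure.integral_comp_smul (volume : Measure (Eu n))
    (fun u => m u • X (x - ε • u)) ε⁻¹
  simp only [smul_inv_smul₀ hε.ne', finrank_euclideanSpace, Fintype.card_fin] at h1
  simp only [rescaledMollifier, mul_smul]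
  rw [integral_smul, h1, smul_smul, inv_pow, inv_inv, abs_of_pos (pow_pos hε n),
    inv_mul_cancel₀ (pow_pos hε n).ne', one_smul]

theorem smoothedField_eq_mollified {X Y : Eu n → Eu n} {ε : ℝ} (hε : 0 < ε) {x : Eu n}
    (hXY : ∀ u ∈ tsupport m, X (x - ε • u) = Y (x - ε • u)) :
    smoothedField m X ε x = mollified m Y (x, ε) := by
  rw [smoothedField_eq_integral X hε, mollified]
  congr 1
  funext u
  by_cases hu : u ∈ tsupport m
  · rw [hXY u hu]
  · simp [image_eq_zero_of_notMem_tsupport hu]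

/-- Almost everywhere X is Ym plus the jump Yp - Ym restricted to the upper side, and the two
summands of `layerField` integrate these two terms. -/
theorem smoothedField_eq_layerField (hm : IsMollifier m) (hh : ContDiff ℝ ∞ h)
    (hinv : ∀ x (r : ℝ), h (x + r • v) = h x) (hL : L v = 1) (hYm : ContDiff ℝ ∞ Ym)
    (hYp : ContDiff ℝ ∞ Yp) {X : Eu n → Eu n} {ε : ℝ} (hε : 0 < ε) {x : Eu n}
    (hXm : ∀ u ∈ tsupport m, L (x - ε • u) - h (x - ε • u) < 0 → X (x - ε • u) = Ym (x - ε • u))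
    (hXp : ∀ u ∈ tsupport m, 0 < L (x - ε • u) - h (x - ε • u) → X (x - ε • u) = Yp (x - ε • u)) :
    smoothedField m X ε x = layerField m Ym Yp L v h (x, (L x - h x) / ε, ε) := by
  set q : Eu n × ℝ × ℝ := (x, (L x - h x) / ε, ε)
  -- The minus sign exchanges the sides: the upper side of the graph is the negative side in the
  -- variable u.
  have hkey : ∀ u, L (x - ε • u) - h (x - ε • u) =
      -(ε * (L u - slopeAvg h (q.1, u, q.2.2) - q.2.1)) := by
    intro u
    have h1 := mul_slopeAvg hh x u ε
    have h2 : ε * ((L x - h x) / ε) = L x - h x := by field_simp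
    simp only [q, map_sub, map_smul, smul_eq_mul]
    linarith
  have hae : ∀ᵐ u : Eu n, L u - slopeAvg h (q.1, u, q.2.2) - q.2.1 ≠ 0 := by
    rw [ae_iff]
    simpa using volume_discontinuity hh hinv hL q
  have hcm : ∀ {Y : Eu n → Eu n}, ContDiff ℝ ∞ Y → Integrable fun u => m u • Y (x - ε • u) := by
    intro Y hY
    have hc := hY.continuous
    refine Continuous.integrable_of_hasCompactSupport ?_ hm.compact_support.smul_right
    exact hm.smooth.continuous.smul (by fun_prop)
  rw [smoothedField_eq_integral X hε, layerField, layerJump_eq hh hinv hL, mollified,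
    ← integral_indicator (measurableSet_layer hh q),
    ← integral_add (hcm hYm) ((hcm (hYp.sub hYm)).indicator (measurableSet_layer hh q))]
  refine integral_congr_ae ?_
  filter_upwards [hae] with u hu
  by_cases hum : u ∈ tsupport m
  · rcases lt_or_gt_of_ne hu with hlt | hgt
    · rw [indicator_of_mem (by exact hlt), hXp u hum (by rw [hkey]; nlinarith)]
      simp [smul_sub]
    · rw [indicator_of_notMem (by simpa using hgt.le), hXm u hum (by rw [hkey]; nlinarith)]
      simp
  · have h0 : m u = 0 := image_eq_zero_of_notMem_tsupport hum
    by_cases hu' : u ∈ {w | L w - slopeAvg h (q.1, w, q.2.2) - q.2.1 < 0}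
    · rw [indicator_of_mem hu']; simp [h0]
    · rw [indicator_of_notMem hu']; simp [h0]

end LayerField

/-! ### Passage through a layer and passage between two layers. -/

section Transitions

theorem eq_add_mul_of_hasDerivAt {E : Type*} [NormedAddCommGroup E] [NormedSpace ℝ E]
    {g : ℝ → E} {k : E} {T : ℝ} (hg : ∀ t ∈ Icc 0 T, HasDerivAt g k t) :
    ∀ t ∈ Icc 0 T, g t = g 0 + t • k := by
  intro t ht
  have hd : ∀ t ∈ Icc 0 T, HasDerivAt (fun t => g t - t • k) 0 t := fun t ht => by
    have := (hg t ht).fun_sub ((hasDerivAt_id t).smul_const k)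
    simpa using this
  have h := constant_of_has_deriv_right_zero (f := fun t => g t - t • k) (a := 0) (b := T)
    (fun t ht => (hd t ht).continuousAt.continuousWithinAt)
    (fun t ht => (hd t (Ico_subset_Icc_self ht)).hasDerivWithinAt) t ht
  simp only [zero_smul, sub_zero] at h
  rw [← h]
  abel

theorem HasDerivAt.fst_apply {E F : Type*} [NormedAddCommGroup E] [NormedSpace ℝ E]
    [NormedAddCommGroup F] [NormedSpace ℝ F] {g : ℝ → E × F} {g' : E × F} {t : ℝ}
    (hg : HasDerivAt g g' t) : HasDerivAt (fun s => (g s).1) g'.1 t :=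
  (ContinuousLinearMap.fst ℝ E F).hasFDerivAt.comp_hasDerivAt t hg

theorem HasDerivAt.snd_apply {E F : Type*} [NormedAddCommGroup E] [NormedSpace ℝ E]
    [NormedAddCommGroup F] [NormedSpace ℝ F] {g : ℝ → E × F} {g' : E × F} {t : ℝ}
    (hg : HasDerivAt g g' t) : HasDerivAt (fun s => (g s).2) g'.2 t :=
  (ContinuousLinearMap.snd ℝ E F).hasFDerivAt.comp_hasDerivAt t hg

theorem strictMonoOn_comp_of_fderiv_pos {E : Type*} [NormedAddCommGroup E] [NormedSpace ℝ E]
    {φ : E → ℝ} (hφ : Differentiable ℝ φ) {c w : ℝ → E} {a b : ℝ}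
    (hc : ∀ t ∈ Icc a b, HasDerivAt c (w t) t) (hpos : ∀ t ∈ Icc a b, 0 < fderiv ℝ φ (c t) (w t)) :
    StrictMonoOn (fun t => φ (c t)) (Icc a b) := by
  have hd : ∀ t ∈ Icc a b, HasDerivAt (fun t => φ (c t)) (fderiv ℝ φ (c t) (w t)) t :=
    fun t ht => (hφ (c t)).hasFDerivAt.comp_hasDerivAt t (hc t ht)
  refine strictMonoOn_of_deriv_pos (convex_Icc a b)
    (fun t ht => (hd t ht).continuousAt.continuousWithinAt) fun t ht => ?_
  rw [(hd t (interior_subset ht)).deriv]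
  exact hpos t (interior_subset ht)

theorem eventually_closedBall_subset {E : Type*} [NormedAddCommGroup E] {S : Set E} {x : E}
    (hS : S ∈ 𝓝 x) (r : ℝ) :
    ∀ᶠ q in 𝓝 (x, (0 : ℝ)), Metric.closedBall q.1 (q.2 * r) ⊆ S := by
  obtain ⟨ρ, hρ, hρS⟩ := Metric.mem_nhds_iff.1 hS
  have h1 : ∀ᶠ q in 𝓝 (x, (0 : ℝ)), dist q.1 x < ρ / 2 :=
    (continuous_fst.tendsto (x, (0 : ℝ))).eventually (Metric.ball_mem_nhds x (by positivity))
  have h2 : ∀ᶠ q in 𝓝 (x, (0 : ℝ)), q.2 * r < ρ / 2 := by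
    have hc : Continuous fun q : E × ℝ => q.2 * r := by fun_prop
    exact (hc.tendsto (x, (0 : ℝ))).eventually (gt_mem_nhds (by simpa using by positivity))
  filter_upwards [h1, h2] with q hq1 hq2 y hy
  refine hρS ?_
  rw [Metric.mem_ball]
  calc dist y x ≤ dist y q.1 + dist q.1 x := dist_triangle _ _ _
    _ < ρ := by linarith [Metric.mem_closedBall.1 hy]

variable {n : ℕ}

/-- The transition through the regularized layer, from `φ = ε a` to `φ = ε b`. -/
theorem exists_layer_transition {G : Eu n × ℝ × ℝ → Eu n} (hG : ContDiff ℝ ∞ G) {φ : Eu n → ℝ}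
    (hφ : ContDiff ℝ ∞ φ) {p : Eu n} {a b : ℝ} (hab : a < b)
    (hpos : ∀ s, 0 < fderiv ℝ φ p (G (p, s, 0))) {V : ℝ → Eu n → Eu n} {N : Set (Eu n)}
    (hN : N ∈ 𝓝 p) (hV : ∀ᶠ ε in 𝓝[>] (0 : ℝ), ∀ x ∈ N, V ε x = G (x, φ x / ε, ε)) :
    ∃ K : Eu n × ℝ → Eu n, ContDiff ℝ ∞ K ∧ (∀ᶠ x in 𝓝 p, K (x, 0) = x) ∧
      ∀ B ∈ 𝓝 p, ∀ᶠ q in 𝓝 (p, (0 : ℝ)), 0 < q.2 → φ q.1 = q.2 * a →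
        φ (K q) = q.2 * b ∧ ∃ T > 0, ∃ c : ℝ → Eu n, c 0 = q.1 ∧ c T = K q ∧
          (∀ t ∈ Icc 0 T, c t ∈ B ∧ HasDerivWithinAt c (V q.2 (c t)) (Icc 0 T) t) ∧
          ∀ t ∈ Ioo 0 T, q.2 * a < φ (c t) ∧ φ (c t) < q.2 * b := by
  have hφ' : ContDiff ℝ ∞ (fderiv ℝ φ) := (contDiff_infty_iff_fderiv.1 hφ).2
  set D : Eu n × ℝ × ℝ → ℝ := fun y => fderiv ℝ φ y.1 (G y) with hD
  have hDs : ContDiff ℝ ∞ D := (hφ'.comp contDiff_fst).clm_apply hG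
  set Ω : Set (Eu n × ℝ × ℝ) := {y | 0 < D y}
  have hΩ : IsOpen Ω := isOpen_lt continuous_const hDs.continuous
  -- In the variables (x, s, ε) the field is (G, D/ε, 0). Multiplication by ε/D makes s the time and
  -- removes the singularity at ε = 0, where x then stands still.
  set f : Eu n × ℝ × ℝ → Eu n × ℝ × ℝ := fun y => ((y.2.2 * (D y)⁻¹) • G y, 1, 0) with hf
  have hfs : ContDiffOn ℝ ∞ f Ω := by
    have hinv : ContDiffOn ℝ ∞ (fun y => (D y)⁻¹) Ω :=
      hDs.contDiffOn.inv fun y hy => ne_of_gt hy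
    exact (((contDiff_snd.comp contDiff_snd).contDiffOn.mul hinv).smul hG.contDiffOn).prodMk
      contDiffOn_const
  set α : ℝ → Eu n × ℝ × ℝ := fun t => (p, a + t, 0) with hα
  obtain ⟨Φ, hΦ, hΦ0, -, δ, hδ, hΦd⟩ := exists_flow_near_orbit (f := f) hΩ hfs (α := α)
    (T := b - a) (fun t _ => ⟨hpos _, by
      have h1 : HasDerivAt α (0, 1, 0) t :=
        (hasDerivAt_const t p).prodMk (((hasDerivAt_id t).const_add a).prodMk
          (hasDerivAt_const t (0 : ℝ)))
      simpa [hf, hα] using h1.hasDerivWithinAt⟩)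
  have hι : Continuous fun q : Eu n × ℝ => ((q.1, a, q.2) : Eu n × ℝ × ℝ) := by fun_prop
  have hιt : Filter.Tendsto (fun q : Eu n × ℝ => ((q.1, a, q.2) : Eu n × ℝ × ℝ)) (𝓝 (p, 0))
      (𝓝 (α 0)) := by
    simpa [hα] using hι.tendsto (p, (0 : ℝ))
  have hflow : ∀ᶠ q in 𝓝 (p, (0 : ℝ)), ∀ t ∈ Icc 0 (b - a),
      HasDerivAt (fun s => Φ ((q.1, a, q.2), s)) (f (Φ ((q.1, a, q.2), t))) t ∧
      0 < D (Φ ((q.1, a, q.2), t)) ∧ (Φ ((q.1, a, q.2), t)).2 = (a + t, q.2) := by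
    filter_upwards [hιt.eventually hΦd] with q hq
    have hq' : ∀ t ∈ Icc 0 (b - a), _ := fun t ht =>
      hq t ⟨by linarith [ht.1], by linarith [ht.2]⟩
    have hsnd := eq_add_mul_of_hasDerivAt (g := fun s => (Φ ((q.1, a, q.2), s)).2)
      (k := ((1 : ℝ), (0 : ℝ))) (T := b - a)
      (fun t ht => HasDerivAt.snd_apply (hq' t ht).1)
    refine fun t ht => ⟨(hq' t ht).1, (hq' t ht).2, ?_⟩
    rw [hsnd t ht, hΦ0]
    simp
  refine ⟨fun q => (Φ ((q.1, a, q.2), b - a)).1, ?_, ?_, ?_⟩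
  · exact contDiff_fst.comp (hΦ.comp (by fun_prop))
  · have hx : Filter.Tendsto (fun x : Eu n => (x, (0 : ℝ))) (𝓝 p) (𝓝 (p, 0)) :=
      (Continuous.tendsto (by fun_prop) p)
    filter_upwards [hx.eventually hflow] with x hx
    have := eq_add_mul_of_hasDerivAt (g := fun s => (Φ ((x, a, (0 : ℝ)), s)).1) (k := 0)
      (T := b - a) (fun t ht => by
        have h1 := HasDerivAt.fst_apply (hx t ht).1
        have h2 : (Φ ((x, a, (0 : ℝ)), t)).2.2 = 0 := by rw [(hx t ht).2.2]
        simpa [hf, h2] using h1) (b - a) ⟨by linarith, le_rfl⟩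
    rw [this, hΦ0]
    simp
  · intro B hB
    have hO : IsOpen {y : Eu n × ℝ × ℝ | y.1 ∈ interior (B ∩ N)} :=
      isOpen_interior.preimage continuous_fst
    have hpO : p ∈ interior (B ∩ N) := mem_interior_iff_mem_nhds.2 (Filter.inter_mem hB hN)
    have hΦp : ∀ t ∈ Icc 0 (b - a), Φ (α 0, t) ∈ {y : Eu n × ℝ × ℝ | y.1 ∈ interior (B ∩ N)} := by
      intro t ht
      have h0 := hflow.self_of_nhds
      have := eq_add_mul_of_hasDerivAt (g := fun s => (Φ ((p, a, (0 : ℝ)), s)).1) (k := 0)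
        (T := b - a) (fun t ht => by
          have h1 := HasDerivAt.fst_apply (h0 t ht).1
          have h2 : (Φ ((p, a, (0 : ℝ)), t)).2.2 = 0 := by rw [(h0 t ht).2.2]
          simpa [hf, h2] using h1) t ht
      rw [hΦ0] at this
      simp only [hα, add_zero, mem_ofPred_eq]
      rw [this]
      simpa using hpO
    obtain ⟨δ', hδ', hstay⟩ := eventually_forall_Icc_of_continuous hΦ.continuous (a := α 0) hO hΦp
    have hVq : ∀ᶠ q in 𝓝 (p, (0 : ℝ)), 0 < q.2 → ∀ x ∈ N, V q.2 x = G (x, φ x / q.2, q.2) :=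
      (continuous_snd.tendsto (p, (0 : ℝ))).eventually (eventually_nhdsWithin_iff.1 hV)
    filter_upwards [hflow, hιt.eventually hstay, hVq] with q hq hqs hqV hε hφq
    set y : ℝ → Eu n × ℝ × ℝ := fun t => Φ ((q.1, a, q.2), t) with hy
    have hyB : ∀ t ∈ Icc 0 (b - a), (y t).1 ∈ B ∩ N := fun t ht =>
      interior_subset (hqs t ⟨by linarith [ht.1], by linarith [ht.2]⟩)
    have hx : ∀ t ∈ Icc 0 (b - a), HasDerivAt (fun t => (y t).1)
        ((q.2 * (D (y t))⁻¹) • G (y t)) t := by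
      intro t ht
      have h1 := HasDerivAt.fst_apply (hq t ht).1
      have h2 : (y t).2.2 = q.2 := by simp only [hy]; rw [(hq t ht).2.2]
      simp only [hf] at h1
      rw [← h2]
      exact h1
    -- φ grows at the rate ε and s at the rate 1, so the constraint φ = ε s persists from the start.
    -- Only under this constraint is G the given field V.
    have hφy : ∀ t ∈ Icc 0 (b - a), φ (y t).1 = q.2 * (a + t) := by
      intro t ht
      have := eq_add_mul_of_hasDerivAt (g := fun t => φ (y t).1) (k := q.2) (T := b - a)
        (fun t ht => by
          have h1 := (hφ.differentiable (by simp)).differentiableAt.hasFDerivAt.comp_hasDerivAt t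
            (hx t ht)
          rw [map_smul, smul_eq_mul] at h1
          have h2 : fderiv ℝ φ (y t).1 (G (y t)) = D (y t) := rfl
          rw [h2, mul_assoc, inv_mul_cancel₀ (hq t ht).2.1.ne', mul_one] at h1
          exact h1) t ht
      rw [this]
      simp only [hy, hΦ0, hφq, smul_eq_mul]
      ring
    have hlast : b - a ∈ Icc 0 (b - a) := ⟨by linarith, le_rfl⟩
    have hVy : ∀ t ∈ Icc 0 (b - a), V q.2 (y t).1 = G (y t) := by
      intro t ht
      rw [hqV hε _ (hyB t ht).2, hφy t ht, mul_div_cancel_left₀ _ hε.ne']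
      congr 1
      refine Prod.ext rfl ?_
      exact (hq t ht).2.2.symm
    have hDcont : ContinuousOn (fun t => q.2 * (D (y t))⁻¹) (Icc 0 (b - a)) := by
      intro t ht
      have hyc : ContinuousAt y t := (hq t ht).1.continuousAt
      exact (continuousAt_const.mul ((hDs.continuous.continuousAt.comp hyc).inv₀
        (hq t ht).2.1.ne')).continuousWithinAt
    -- For ε > 0 the factor ε/D is positive, so the curve can be reparametrized to an orbit of V.
    obtain ⟨T, hT, c, hc0, hcT, hcd, hci⟩ := exists_timeChange (V := V q.2)
      (β := fun t => (y t).1) (w := fun t => q.2 * (D (y t))⁻¹) (l := b - a) (by linarith) hDcont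
      (fun t ht => mul_pos hε (inv_pos.2 (hq t ht).2.1))
      (fun t ht => by
        rw [hVy t ht]
        exact hx t ht)
    refine ⟨?_, T, hT, c, ?_, hcT, fun t ht => ⟨?_, (hcd t ht).1⟩, fun t ht => ?_⟩
    · have := hφy _ hlast
      rw [add_sub_cancel] at this
      exact this
    · rw [hc0]
      simp [hy, hΦ0]
    · obtain ⟨r, hr, hcr⟩ := (hcd t ht).2
      rw [hcr]
      exact (hyB r hr).1
    · obtain ⟨r, hr, hcr⟩ := hci t ht
      rw [hcr, hφy r (Ioo_subset_Icc_self hr)]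
      exact ⟨mul_lt_mul_of_pos_left (by linarith [hr.1]) hε,
        mul_lt_mul_of_pos_left (by linarith [hr.2]) hε⟩

/-- The transition outside of the regularized layers, from `φ₀ = ε R₀` to `φ₁ = - ε R₁`. -/
theorem exists_outer_transition {A : Eu n × ℝ → Eu n} (hA : ContDiff ℝ ∞ A) {φ₀ φ₁ : Eu n → ℝ}
    (hφ₀ : ContDiff ℝ ∞ φ₀) (hφ₁ : ContDiff ℝ ∞ φ₁) {γ : ℝ → Eu n} {T : ℝ} (hT : 0 < T)
    (hγ : ∀ t ∈ Icc 0 T, HasDerivWithinAt γ (A (γ t, 0)) (Icc 0 T) t) {S : Set (Eu n)}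
    (hS : IsOpen S) (hγS : ∀ t ∈ Ioo 0 T, γ t ∈ S) {N₀ N₁ : Set (Eu n)} (hN₀ : N₀ ∈ 𝓝 (γ 0))
    (hN₁ : N₁ ∈ 𝓝 (γ T)) (hNS₀ : ∀ x ∈ N₀, 0 < φ₀ x → x ∈ S) (hNS₁ : ∀ x ∈ N₁, φ₁ x < 0 → x ∈ S)
    (hp₁ : φ₁ (γ T) = 0) (hd₀ : 0 < fderiv ℝ φ₀ (γ 0) (A (γ 0, 0)))
    (hd₁ : 0 < fderiv ℝ φ₁ (γ T) (A (γ T, 0))) {r : ℝ} (hr : 0 < r) {K₀ K₁ : NNReal}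
    (hK₀ : LipschitzOnWith K₀ φ₀ N₀) (hK₁ : LipschitzOnWith K₁ φ₁ N₁) {R₀ R₁ : ℝ}
    (hR₀ : K₀ * r < R₀) (hR₁ : K₁ * r < R₁) :
    ∃ Q : Eu n × ℝ → Eu n, (∀ᶠ q in 𝓝 (γ 0, (0 : ℝ)), ContDiffAt ℝ ∞ Q q) ∧ Q (γ 0, 0) = γ T ∧
      ∀ᶠ q in 𝓝 (γ 0, (0 : ℝ)), 0 ≤ q.2 → φ₀ q.1 = q.2 * R₀ →
        φ₁ (Q q) = q.2 * -R₁ ∧ ∃ T' > 0, ∃ c : ℝ → Eu n, c 0 = q.1 ∧ c T' = Q q ∧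
          ∀ t ∈ Icc 0 T', HasDerivWithinAt c (A (c t, q.2)) (Icc 0 T') t ∧
            (t ∈ Ioo 0 T' ∨ 0 < q.2 → Metric.closedBall (c t) (q.2 * r) ⊆ S) := by
  -- ε is carried along as a constant coordinate, so that smooth dependence on it becomes dependence
  -- on initial conditions.
  set f : Eu n × ℝ → Eu n × ℝ := fun q => (A q, 0) with hf
  have hfs : ContDiffOn ℝ ∞ f univ := (hA.prodMk contDiff_const).contDiffOn
  have hγc : ContinuousOn γ (Icc 0 T) := fun t ht => (hγ t ht).continuousWithinAt
  obtain ⟨Φ, hΦ, hΦ0, hΦγ, δ, hδ, hΦd⟩ := exists_flow_near_orbit (f := f) isOpen_univ hfs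
    (α := fun t => (γ t, (0 : ℝ))) (T := T) (fun t ht => ⟨mem_univ _,
      (hγ t ht).prodMk (hasDerivWithinAt_const t _ (0 : ℝ))⟩)
  have hTmem : T ∈ Icc 0 T := ⟨hT.le, le_rfl⟩
  -- the hitting time
  set H : (Eu n × ℝ) × ℝ → ℝ := fun w => φ₁ (Φ w).1 + w.1.2 * R₁ with hH
  have hHs : ContDiff ℝ ∞ H :=
    (hφ₁.comp (contDiff_fst.comp hΦ)).add
      ((contDiff_snd.comp contDiff_fst).mul contDiff_const)
  have hH0 : H ((γ 0, 0), T) = 0 := by simp [hH, hΦγ T hTmem, hp₁]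
  have hHinv : (fderiv ℝ H ((γ 0, 0), T) ∘L .inr ℝ (Eu n × ℝ) ℝ).IsInvertible := by
    have h1 : HasFDerivAt (fun t => H ((γ 0, 0), t))
        (fderiv ℝ H ((γ 0, 0), T) ∘L .inr ℝ (Eu n × ℝ) ℝ) T :=
      ((hHs.differentiable (by simp)).differentiableAt.hasFDerivAt).comp T
        (hasFDerivAt_prodMk_right (γ 0, (0 : ℝ)) T)
    have h2 := HasDerivAt.fst_apply (hΦd.self_of_nhds T ⟨by linarith, by linarith⟩).1
    simp only [hΦγ T hTmem, hf] at h2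
    have h3 : HasFDerivAt φ₁ (fderiv ℝ φ₁ (γ T)) ((fun s => (Φ ((γ 0, 0), s)).1) T) := by
      simp only [hΦγ T hTmem]
      exact (hφ₁.differentiable (by simp)).differentiableAt.hasFDerivAt
    have h4 : HasDerivAt (fun t => H ((γ 0, 0), t)) (fderiv ℝ φ₁ (γ T) (A (γ T, 0))) T :=
      (h3.comp_hasDerivAt T h2).add_const ((0 : ℝ) * R₁)
    refine ⟨ContinuousLinearEquiv.unitsEquivAut ℝ (Units.mk0 _ hd₁.ne'), ?_⟩
    rw [h1.unique h4.hasFDerivAt]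
    ext
    simp
  obtain ⟨τ, hτ0, hτs, hτH, -⟩ := exists_implicitFunction (f := H) (u := ((γ 0, 0), T))
    (Filter.Eventually.of_forall fun _ => hHs.contDiffAt) hHinv
  rw [hH0] at hτH
  simp only at hτ0 hτs hτH
  refine ⟨fun q => (Φ (q, τ q)).1, ?_, ?_, ?_⟩
  · filter_upwards [hτs] with q hq
    exact (contDiff_fst.comp hΦ).contDiffAt.comp q (contDiffAt_id.prodMk hq)
  · simp [hτ0, hΦγ T hTmem]
  -- confinement
  have hgood : ∀ {φ : Eu n → ℝ} {N : Set (Eu n)} {x : Eu n}, ContDiff ℝ ∞ φ → N ∈ 𝓝 x →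
      0 < fderiv ℝ φ x (A (x, 0)) → ∃ O : Set (Eu n × ℝ), IsOpen O ∧ (x, (0 : ℝ)) ∈ O ∧
        ∀ q ∈ O, Metric.closedBall q.1 (q.2 * r) ⊆ N ∧ 0 < fderiv ℝ φ q.1 (A q) := by
    intro φ N x hφ hN hpos
    have hc : Continuous fun q : Eu n × ℝ => fderiv ℝ φ q.1 (A q) :=
      ((contDiff_infty_iff_fderiv.1 hφ).2.continuous.comp continuous_fst).clm_apply hA.continuous
    obtain ⟨O, hO, hOo, hxO⟩ := mem_nhds_iff.1 ((eventually_closedBall_subset hN r).and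
      ((hc.tendsto (x, (0 : ℝ))).eventually (lt_mem_nhds hpos)))
    exact ⟨O, hOo, hxO, fun q hq => hO hq⟩
  obtain ⟨O₀, hO₀, hpO₀, hO₀p⟩ := hgood hφ₀ hN₀ hd₀
  obtain ⟨O₁, hO₁, hpO₁, hO₁p⟩ := hgood hφ₁ hN₁ hd₁
  -- At ε = 0 the ball is a point. As S is open, every (x, 0) with x ∈ S is therefore interior.
  set Om : Set (Eu n × ℝ) := interior {q | Metric.closedBall q.1 (q.2 * r) ⊆ S} with hOm
  have hOmS : ∀ x ∈ S, (x, (0 : ℝ)) ∈ Om := fun x hx =>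
    mem_interior_iff_mem_nhds.2 (eventually_closedBall_subset (hS.mem_nhds hx) r)
  have hγ0c : ContinuousOn (fun t => (γ t, (0 : ℝ))) (Icc 0 T) := hγc.prodMk continuousOn_const
  have hstart : ∀ᶠ t in 𝓝[≥] (0 : ℝ), (γ t, (0 : ℝ)) ∈ O₀ :=
    ((hγ0c 0 ⟨le_rfl, hT.le⟩).mono_of_mem_nhdsWithin (Icc_mem_nhdsGE hT)) (hO₀.mem_nhds hpO₀)
  have hend : ∀ᶠ t in 𝓝[≤] T, (γ t, (0 : ℝ)) ∈ O₁ :=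
    ((hγ0c T hTmem).mono_of_mem_nhdsWithin (Icc_mem_nhdsLE hT)) (hO₁.mem_nhds hpO₁)
  obtain ⟨a, ha0, ha⟩ := mem_nhdsGE_iff_exists_Icc_subset.1 hstart
  obtain ⟨b, hbT, hb⟩ := mem_nhdsLE_iff_exists_Icc_subset.1 hend
  set a' := min a (T / 3)
  set b' := max b (2 * T / 3)
  have ha'0 : 0 < a' := lt_min ha0 (by linarith)
  have hb'T : b' < T := max_lt hbT (by linarith)
  have ha'3 : a' ≤ T / 3 := min_le_right _ _
  have hb'3 : 2 * T / 3 ≤ b' := le_max_right _ _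
  have hsub : ∀ t ∈ Icc 0 T, Φ ((γ 0, 0), t) = (γ t, 0) := hΦγ
  obtain ⟨δ₀, hδ₀, htube₀⟩ := eventually_forall_Icc_of_continuous hΦ.continuous
    (a := (γ 0, (0 : ℝ))) (s := 0) (t := a') hO₀ (fun t ht => by
      rw [hsub t ⟨ht.1, by linarith [ht.2]⟩]
      exact ha ⟨ht.1, ht.2.trans (min_le_left _ _)⟩)
  obtain ⟨δm, hδm, htubem⟩ := eventually_forall_Icc_of_continuous hΦ.continuous
    (a := (γ 0, (0 : ℝ))) (s := a') (t := b') (O := Om) isOpen_interior (fun t ht => by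
      rw [hsub t ⟨by linarith [ht.1], by linarith [ht.2]⟩]
      exact hOmS _ (hγS t ⟨by linarith [ht.1], by linarith [ht.2]⟩))
  obtain ⟨δ₁, hδ₁, htube₁⟩ := eventually_forall_Icc_of_continuous hΦ.continuous
    (a := (γ 0, (0 : ℝ))) (s := b') (t := T) hO₁ (fun t ht => by
      rw [hsub t ⟨by linarith [ht.1], ht.2⟩]
      exact hb ⟨(le_max_left _ _).trans ht.1, ht.2⟩)
  have hτc : Filter.Tendsto τ (𝓝 (γ 0, 0)) (𝓝 T) := by
    have := hτs.self_of_nhds.continuousAt.tendsto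
    rwa [hτ0] at this
  have hτlt : ∀ᶠ q in 𝓝 (γ 0, (0 : ℝ)), τ q < T + min δ δ₁ :=
    hτc.eventually (gt_mem_nhds (by linarith [lt_min hδ hδ₁]))
  have hτgt : ∀ᶠ q in 𝓝 (γ 0, (0 : ℝ)), b' < τ q := hτc.eventually (lt_mem_nhds hb'T)
  filter_upwards [hΦd, hτH, htube₀, htubem, htube₁, hτlt, hτgt] with q hqd hqH hq₀ hqm hq₁ hq2 hq3
    hε hφq
  have hτδ : τ q < T + δ := hq2.trans_le (by linarith [min_le_left δ δ₁])
  have hτδ₁ : τ q < T + δ₁ := hq2.trans_le (by linarith [min_le_right δ δ₁])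
  have hτpos : 0 < τ q := by linarith
  set c : ℝ → Eu n := fun t => (Φ (q, t)).1 with hc
  have hsnd : ∀ t ∈ Icc 0 (T + δ), (Φ (q, t)).2 = q.2 := by
    intro t ht
    have := eq_add_mul_of_hasDerivAt (g := fun s => (Φ (q, s)).2) (k := 0) (T := T + δ)
      (fun t ht => HasDerivAt.snd_apply (hqd t ⟨by linarith [ht.1], ht.2⟩).1) t ht
    rw [this, hΦ0]
    simp
  have hpair : ∀ t ∈ Icc 0 (T + δ), Φ (q, t) = (c t, q.2) := fun t ht =>
    Prod.ext rfl (hsnd t ht)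
  have hcd : ∀ t ∈ Icc 0 (T + δ), HasDerivAt c (A (c t, q.2)) t := by
    intro t ht
    have := HasDerivAt.fst_apply (hqd t ⟨by linarith [ht.1], ht.2⟩).1
    rw [← hpair t ht]
    exact this
  have hc0 : c 0 = q.1 := by simp [hc, hΦ0]
  have hend : φ₁ (c (τ q)) = q.2 * -R₁ := by
    have : φ₁ (c (τ q)) + q.2 * R₁ = 0 := hqH
    linarith
  refine ⟨hend, τ q, hτpos, c, hc0, rfl, fun t ht => ⟨(hcd t ⟨ht.1, by linarith [ht.2]⟩).hasDerivWithinAt,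
    fun hside => ?_⟩⟩
  have hball : c t ∈ Metric.closedBall (c t) (q.2 * r) :=
    Metric.mem_closedBall_self (mul_nonneg hε hr.le)
  rcases le_or_gt t a' with hta | hta
  · have hin : ∀ s ∈ Icc 0 a', (c s, q.2) ∈ O₀ := fun s hs => by
      rw [← hpair s ⟨hs.1, by linarith [hs.2]⟩]
      exact hq₀ s ⟨by linarith [hs.1], by linarith [hs.2]⟩
    have hmono := strictMonoOn_comp_of_fderiv_pos (φ := φ₀) (hφ₀.differentiable (by simp))
      (c := c) (w := fun s => A (c s, q.2)) (a := 0) (b := a')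
      (fun s hs => hcd s ⟨hs.1, by linarith [hs.2]⟩) (fun s hs => (hO₀p _ (hin s hs)).2)
    -- φ₀ increases along the curve from the value εR₀, while on a ball of radius εr it varies by at
    -- most εK₀r. As K₀r < R₀, the ball stays where φ₀ > 0.
    have hlow : q.2 * R₀ ≤ φ₀ (c t) := by
      have := hmono.monotoneOn ⟨le_rfl, ha'0.le⟩ ⟨ht.1, hta⟩ ht.1
      simp only [hc0] at this
      linarith
    -- The strict inequality comes from K₀r < R₀ if ε > 0; for ε = 0 it must come from t > 0.
    have hlow' : 0 < q.2 ∨ q.2 * R₀ < φ₀ (c t) := by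
      rcases hside with h | h
      · right
        have := hmono ⟨le_rfl, ha'0.le⟩ ⟨ht.1, hta⟩ h.1
        simp only [hc0] at this
        linarith
      · exact Or.inl h
    have hN := (hO₀p _ (hin t ⟨ht.1, hta⟩)).1
    intro y hy
    refine hNS₀ y (hN hy) ?_
    have h1 : |φ₀ y - φ₀ (c t)| ≤ K₀ * (q.2 * r) := by
      rw [← Real.dist_eq]
      exact (hK₀.dist_le_mul y (hN hy) (c t) (hN hball)).trans
        (mul_le_mul_of_nonneg_left hy K₀.2)
    have h2 := (abs_le.1 h1).1
    have h3 : q.2 * (K₀ * r) ≤ q.2 * R₀ := mul_le_mul_of_nonneg_left hR₀.le hε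
    rcases hlow' with h | h
    · have h4 : q.2 * (K₀ * r) < q.2 * R₀ := mul_lt_mul_of_pos_left hR₀ h
      linarith
    · linarith
  rcases le_or_gt t b' with htb | htb
  · have := hqm t ⟨by linarith, by linarith⟩
    rw [hpair t ⟨ht.1, by linarith [ht.2]⟩] at this
    exact interior_subset this
  · have hin : ∀ s ∈ Icc b' (τ q), (c s, q.2) ∈ O₁ := fun s hs => by
      rw [← hpair s ⟨by linarith [hs.1], by linarith [hs.2]⟩]
      exact hq₁ s ⟨by linarith [hs.1], by linarith [hs.2]⟩
    have hmono := strictMonoOn_comp_of_fderiv_pos (φ := φ₁) (hφ₁.differentiable (by simp))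
      (c := c) (w := fun s => A (c s, q.2)) (a := b') (b := τ q)
      (fun s hs => hcd s ⟨by linarith [hs.1], by linarith [hs.2]⟩)
      (fun s hs => (hO₁p _ (hin s hs)).2)
    have hup : φ₁ (c t) ≤ q.2 * -R₁ := by
      rw [← hend]
      exact hmono.monotoneOn ⟨htb.le, ht.2⟩ ⟨hq3.le, le_rfl⟩ ht.2
    have hup' : 0 < q.2 ∨ φ₁ (c t) < q.2 * -R₁ := by
      rcases hside with h | h
      · right
        rw [← hend]
        exact hmono ⟨htb.le, ht.2⟩ ⟨hq3.le, le_rfl⟩ h.2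
      · exact Or.inl h
    have hN := (hO₁p _ (hin t ⟨htb.le, ht.2⟩)).1
    intro y hy
    refine hNS₁ y (hN hy) ?_
    have h1 : |φ₁ y - φ₁ (c t)| ≤ K₁ * (q.2 * r) := by
      rw [← Real.dist_eq]
      exact (hK₁.dist_le_mul y (hN hy) (c t) (hN hball)).trans
        (mul_le_mul_of_nonneg_left hy K₁.2)
    have h2 := (abs_le.1 h1).2
    have h3 : q.2 * (K₁ * r) ≤ q.2 * R₁ := mul_le_mul_of_nonneg_left hR₁.le hε
    rcases hup' with h | h
    · have h4 : q.2 * (K₁ * r) < q.2 * R₁ := mul_lt_mul_of_pos_left hR₁ h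
      linarith
    · linarith

end Transitions

/-! ### Transversality in charts, and Σ as a graph. -/

section CrossingGeometry

variable {n : ℕ} {M Sig : Set (Eu n)} {p : Eu n}

theorem IsAdaptedChart.mem_iff_zero {e : OpenPartialHomeomorph (Eu n) (Eu n)}
    (he : IsAdaptedChart M Sig 1 p e) {x : Eu n} (hx : x ∈ e.source) :
    x ∈ Sig ↔ e x ⟨0, he.le_dim⟩ = 0 := by
  rw [he.mem_iff x hx]
  constructor
  · rintro ⟨j, hj, hj0⟩
    have : j = ⟨0, he.le_dim⟩ := Fin.ext (by simpa using hj)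
    rwa [← this]
  · exact fun h => ⟨⟨0, he.le_dim⟩, by simp, h⟩

theorem IsAdaptedChart.contDiffAt {c : ℕ} {e : OpenPartialHomeomorph (Eu n) (Eu n)}
    (he : IsAdaptedChart M Sig c p e) {x : Eu n} (hx : x ∈ e.source) : ContDiffAt ℝ ∞ e x :=
  he.smooth.contDiffAt (e.open_source.mem_nhds hx)

theorem IsAdaptedChart.zero_mem_target {c : ℕ} {e : OpenPartialHomeomorph (Eu n) (Eu n)}
    (he : IsAdaptedChart M Sig c p e) : (0 : Eu n) ∈ e.target := by
  rw [← he.map_base]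
  exact e.map_source he.mem_source

theorem IsAdaptedChart.symm_zero {c : ℕ} {e : OpenPartialHomeomorph (Eu n) (Eu n)}
    (he : IsAdaptedChart M Sig c p e) : e.symm 0 = p := by
  rw [← he.map_base, e.left_inv he.mem_source]

/-- Tangency to a smooth hypersurface does not depend on the chart. -/
theorem IsAdaptedChart.fderiv_eq_zero {e e' : OpenPartialHomeomorph (Eu n) (Eu n)}
    (he : IsAdaptedChart M Sig 1 p e) (he' : IsAdaptedChart M Sig 1 p e') {w : Eu n}
    (hw : fderiv ℝ e p w ⟨0, he.le_dim⟩ = 0) : fderiv ℝ e' p w ⟨0, he'.le_dim⟩ = 0 := by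
  set u := fderiv ℝ e p w
  have hsd : HasFDerivAt e.symm (fderiv ℝ e.symm 0) 0 :=
    ((he.smooth_symm.contDiffAt (e.open_target.mem_nhds he.zero_mem_target)).differentiableAt
      (by simp)).hasFDerivAt
  have hed : HasFDerivAt e (fderiv ℝ e p) p :=
    ((he.contDiffAt he.mem_source).differentiableAt (by simp)).hasFDerivAt
  have hed' : HasFDerivAt e' (fderiv ℝ e' p) p :=
    ((he'.contDiffAt he'.mem_source).differentiableAt (by simp)).hasFDerivAt
  have hsu : fderiv ℝ e.symm 0 u = w := by
    have h1 : HasFDerivAt (e.symm ∘ e) ((fderiv ℝ e.symm 0).comp (fderiv ℝ e p)) p := by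
      refine HasFDerivAt.comp p ?_ hed
      rwa [he.map_base]
    have h2 : HasFDerivAt (e.symm ∘ e) (.id ℝ (Eu n)) p := by
      refine (hasFDerivAt_id p).congr_of_eventuallyEq ?_
      filter_upwards [e.open_source.mem_nhds he.mem_source] with x hx
      exact e.left_inv hx
    have := congrArg (fun A : Eu n →L[ℝ] Eu n => A w) (h1.unique h2)
    simpa using this
  have hlin : HasDerivAt (fun t : ℝ => t • u) u 0 := by
    simpa using (hasDerivAt_id (0 : ℝ)).smul_const u
  -- This curve lies in Σ, since the first coordinate of u vanishes, and has velocity w at p; hence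
  -- the first coordinate of e' vanishes along it.
  have hc : HasDerivAt (fun t : ℝ => e.symm (t • u)) w 0 := by
    rw [← hsu]
    refine HasFDerivAt.comp_hasDerivAt (0 : ℝ) ?_ hlin
    rwa [zero_smul]
  have hc0 : e.symm ((0 : ℝ) • u) = p := by rw [zero_smul, he.symm_zero]
  have hec : HasDerivAt (fun t : ℝ => e' (e.symm (t • u))) (fderiv ℝ e' p w) 0 := by
    refine HasFDerivAt.comp_hasDerivAt (0 : ℝ) ?_ hc
    rwa [hc0]
  have hcoord : HasDerivAt (fun t : ℝ => e' (e.symm (t • u)) ⟨0, he'.le_dim⟩)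
      (fderiv ℝ e' p w ⟨0, he'.le_dim⟩) 0 :=
    (EuclideanSpace.proj (𝕜 := ℝ) (⟨0, he'.le_dim⟩ : Fin n)).hasFDerivAt.comp_hasDerivAt (0 : ℝ) hec
  have hzero : (fun t : ℝ => e' (e.symm (t • u)) ⟨0, he'.le_dim⟩) =ᶠ[𝓝 0] fun _ => 0 := by
    have ht : ∀ᶠ t in 𝓝 (0 : ℝ), t • u ∈ e.target := by
      refine hlin.continuousAt.eventually (e.open_target.mem_nhds ?_)
      simpa using he.zero_mem_target
    have hs : ∀ᶠ t in 𝓝 (0 : ℝ), e.symm (t • u) ∈ e'.source := by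
      refine hc.continuousAt.eventually (e'.open_source.mem_nhds ?_)
      change e.symm ((0 : ℝ) • u) ∈ e'.source
      rw [hc0]
      exact he'.mem_source
    filter_upwards [ht, hs] with t ht hs
    rw [← he'.mem_iff_zero hs, he.mem_iff_zero (e.map_target ht), e.right_inv ht]
    simp only [PiLp.smul_apply, smul_eq_mul, u, hw, mul_zero]
  exact hcoord.unique ((hasDerivAt_const (0 : ℝ) (0 : ℝ)).congr_of_eventuallyEq hzero)

theorem IsTransverseAt.fderiv_ne_zero {w : Eu n} (h : IsTransverseAt M Sig p w)
    {e : OpenPartialHomeomorph (Eu n) (Eu n)} (he : IsAdaptedChart M Sig 1 p e) :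
    fderiv ℝ e p w ⟨0, he.le_dim⟩ ≠ 0 := by
  obtain ⟨e', he', hw⟩ := h
  exact fun h0 => hw ⟨0, he'.le_dim⟩ (by simp) (he.fderiv_eq_zero he' h0)

/-- Transversality at points of `Sig` close to `p` can be read off in a chart at `p`. -/
theorem IsAdaptedChart.isTransverseAt {e : OpenPartialHomeomorph (Eu n) (Eu n)}
    (he : IsAdaptedChart M Sig 1 p e) {x : Eu n} (hx : x ∈ e.source) (hxS : x ∈ Sig) {w : Eu n}
    (hw : fderiv ℝ e x w ⟨0, he.le_dim⟩ ≠ 0) : IsTransverseAt M Sig x w := by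
  -- A chart centred at x is the chart at p followed by a translation. The first coordinate is
  -- unchanged because it vanishes at x.
  set e' := e.trans (Homeomorph.addRight (-(e x))).toOpenPartialHomeomorph
  have hsource : e'.source = e.source := by simp [e']
  have hcoe : ∀ y, e' y = e y - e x := fun y => by simp [e', sub_eq_add_neg]
  have hsymm : ∀ y, e'.symm y = e.symm (y + e x) := fun y => by
    change e.symm (y + -(-(e x))) = _
    rw [neg_neg]
  have htarget : ∀ y, y ∈ e'.target ↔ y + e x ∈ e.target := fun y => by
    have : y ∈ e'.target ↔ y + -(-(e x)) ∈ e.target := by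
      simp only [e', OpenPartialHomeomorph.trans_target, mem_inter_iff, mem_preimage]
      exact and_iff_right (mem_univ _)
    rwa [neg_neg] at this
  have he'x : IsAdaptedChart M Sig 1 x e' :=
    { mem_source := hsource ▸ hx
      source_subset := hsource ▸ he.source_subset
      map_base := by simp [hcoe]
      smooth := by
        rw [hsource]
        exact (he.smooth.sub contDiffOn_const).congr fun y _ => hcoe y
      smooth_symm := by
        refine ContDiffOn.congr (f := fun y => e.symm (y + e x)) ?_ fun y _ => hsymm y
        exact he.smooth_symm.comp (by fun_prop) fun y hy => (htarget y).1 hy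
      le_dim := he.le_dim
      mem_iff := fun y hy => by
        rw [hsource] at hy
        rw [he.mem_iff_zero hy]
        have hx0 := (he.mem_iff_zero hx).1 hxS
        constructor
        · intro h0
          exact ⟨⟨0, he.le_dim⟩, by simp, by simp [hcoe, h0, hx0]⟩
        · rintro ⟨j, hj, hj0⟩
          have : j = ⟨0, he.le_dim⟩ := Fin.ext (by simpa using hj)
          rw [this, hcoe] at hj0
          simpa [hx0] using hj0 }
  refine ⟨e', he'x, fun j hj => ?_⟩
  have : j = ⟨0, he.le_dim⟩ := Fin.ext (by simpa using hj)
  have hfun : (e' : Eu n → Eu n) = fun y => e y - e x := funext hcoe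
  rw [this, hfun, fderiv_sub_const]
  exact hw

/-- A smooth function with non-zero derivative can be replaced by a function of graph type, with
the same sign. -/
theorem exists_graph_function {g : Eu n → ℝ} (hg : ContDiff ℝ ∞ g) (hgp : g p = 0) {v : Eu n}
    (hv : fderiv ℝ g p v = 1) :
    ∃ h : Eu n → ℝ, ContDiff ℝ ∞ h ∧ (∀ x (r : ℝ), h (x + r • v) = h x) ∧
      HasFDerivAt (fun x => fderiv ℝ g p x - h x) (fderiv ℝ g p) p ∧
      ∀ᶠ x in 𝓝 p, (g x = 0 ↔ fderiv ℝ g p x - h x = 0) ∧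
        (g x < 0 ↔ fderiv ℝ g p x - h x < 0) ∧ (0 < g x ↔ 0 < fderiv ℝ g p x - h x) := by
  set L := fderiv ℝ g p with hLdef
  have hgd : Differentiable ℝ g := hg.differentiable (by simp)
  -- F(x, t) is the value of g after sliding x along v to height L = t, so the zero in t is the
  -- height of the hypersurface over x.
  set F : Eu n × ℝ → ℝ := fun q => g (q.1 - (L q.1 - q.2) • v) with hF
  have hFs : ContDiff ℝ ∞ F := hg.comp (by fun_prop)
  have hF0 : F (p, L p) = 0 := by simp [hF, hgp]
  have hinv : (fderiv ℝ F (p, L p) ∘L .inr ℝ (Eu n) ℝ).IsInvertible := by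
    have h1 : HasFDerivAt (fun t => F (p, t)) (fderiv ℝ F (p, L p) ∘L .inr ℝ (Eu n) ℝ) (L p) :=
      ((hFs.differentiable (by simp)).differentiableAt.hasFDerivAt).comp (L p)
        (hasFDerivAt_prodMk_right p (L p))
    have h2 : HasDerivAt (fun t : ℝ => p - (L p - t) • v) v (L p) := by
      simpa using (((hasDerivAt_id (L p)).const_sub (L p)).smul_const v).const_sub p
    have h3 : HasFDerivAt g L (p - (L p - L p) • v) := by
      simpa using (hgd p).hasFDerivAt
    have h4 : HasDerivAt (fun t => F (p, t)) (L v) (L p) := h3.comp_hasDerivAt (L p) h2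
    rw [hv] at h4
    refine ⟨ContinuousLinearEquiv.refl ℝ ℝ, ?_⟩
    rw [h1.unique h4.hasFDerivAt]
    ext
    simp
  obtain ⟨ψ, hψ0, hψs, -, hψF⟩ := exists_implicitFunction (f := F) (u := (p, L p))
    (Filter.Eventually.of_forall fun _ => hFs.contDiffAt) hinv
  rw [hF0] at hψF
  simp only at hψ0 hψs
  obtain ⟨U, hUψ, hU, hpU⟩ := mem_nhds_iff.1 hψs
  obtain ⟨k, hk, -, O, hO, hpO, -, hkO⟩ := exists_compactSupport_eq (f := ψ) hU
    (fun x hx => ContDiffAt.contDiffWithinAt (hUψ hx)) isCompact_singleton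
    (singleton_subset_iff.2 hpU)
  rw [singleton_subset_iff] at hpO
  -- Projection along v to the hyperplane L = L p. Composing with it makes h invariant along v on
  -- the whole space, whatever the cut-off k does far away.
  set Pr : Eu n → Eu n := fun x => x - (L x - L p) • v with hPr
  have hPrs : ContDiff ℝ ∞ Pr := by
    have := L.contDiff (n := ∞)
    fun_prop
  have hPrp : Pr p = p := by simp [hPr]
  set h : Eu n → ℝ := fun x => k (Pr x) with hh
  have hhs : ContDiff ℝ ∞ h := hk.comp hPrs
  have hhinv : ∀ x (r : ℝ), h (x + r • v) = h x := by
    intro x r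
    simp only [hh]
    congr 1
    simp only [hPr, map_add, map_smul, hv, smul_eq_mul, mul_one]
    module
  have hhp : h p = L p := by simp [hh, hPrp, hkO hpO, hψ0]
  set φ : Eu n → ℝ := fun x => L x - h x with hφ
  have hφs : ContDiff ℝ ∞ φ := L.contDiff.sub hhs
  have hφp : φ p = 0 := by simp [hφ, hhp]
  have hPrt : Filter.Tendsto (fun x => (Pr x, h x)) (𝓝 p) (𝓝 (p, L p)) := by
    have : Continuous fun x => (Pr x, h x) := hPrs.continuous.prodMk hhs.continuous
    have := this.tendsto p
    rwa [hPrp, hhp] at this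
  -- x - φ(x) v is the point at height h x on the line through x along v.
  have hFh : ∀ x, F (Pr x, h x) = g (x - φ x • v) := by
    intro x
    simp only [hF, hφ, hPr, map_sub, map_smul, smul_eq_mul, hv]
    congr 1
    module
  have hzero : ∀ᶠ x in 𝓝 p, g (x - φ x • v) = 0 := by
    have hPrO : ∀ᶠ x in 𝓝 p, Pr x ∈ O := hPrs.continuous.continuousAt.eventually
      (hO.mem_nhds (by rwa [hPrp]))
    filter_upwards [hPrt.eventually hψF, hPrO] with x hx hxO
    rw [← hFh, hx, ← hkO hxO]
  have hdφ : HasFDerivAt φ (fderiv ℝ φ p) p := (hφs.differentiable (by simp) p).hasFDerivAt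
  -- Differentiating g(x - φ(x) v) = 0 at p gives L - dφ = 0, because L v = 1.
  have hdφL : fderiv ℝ φ p = L := by
    have h1 : HasFDerivAt (fun x => x - φ x • v)
        (.id ℝ (Eu n) - (fderiv ℝ φ p).smulRight v) p :=
      HasFDerivAt.fun_sub (f := fun x => x) (hasFDerivAt_id p) (hdφ.smul_const v)
    have h2 : HasFDerivAt g L (p - φ p • v) := by
      rw [hφp, zero_smul, sub_zero]
      exact (hgd p).hasFDerivAt
    have h3 := h2.comp p h1
    have h4 := h3.unique ((hasFDerivAt_const (0 : ℝ) p).congr_of_eventuallyEq hzero)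
    ext w
    have := congrArg (fun A : Eu n →L[ℝ] ℝ => A w) h4
    simp [hv] at this
    linarith
  refine ⟨h, hhs, hhinv, by rw [hdφL] at hdφ; exact hdφ, ?_⟩
  have hpos : ∀ᶠ x in 𝓝 p, 0 < fderiv ℝ g x v := by
    have hc : Continuous fun x => fderiv ℝ g x v :=
      (contDiff_infty_iff_fderiv.1 hg).2.continuous.clm_apply continuous_const
    exact (hc.tendsto p).eventually (lt_mem_nhds (by rw [← hLdef, hv]; exact one_pos))
  obtain ⟨ρ, hρ, hball⟩ := Metric.eventually_nhds_iff_ball.1 hpos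
  have hx1 : ∀ᶠ x in 𝓝 p, x ∈ Metric.ball p ρ := Metric.ball_mem_nhds p hρ
  have hx2 : ∀ᶠ x in 𝓝 p, x - φ x • v ∈ Metric.ball p ρ := by
    have hc : Continuous fun x => x - φ x • v := by
      have := hφs.continuous
      fun_prop
    refine (hc.tendsto p).eventually (Metric.isOpen_ball.mem_nhds ?_)
    rw [hφp, zero_smul, sub_zero]
    exact Metric.mem_ball_self hρ
  -- g increases along v in the ball and vanishes at x - φ(x) v, so g(x) and φ(x) have the same
  -- sign.
  have hmono : ∀ x ∈ Metric.ball p ρ, ∀ s : ℝ, 0 < s → x + s • v ∈ Metric.ball p ρ →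
      g x < g (x + s • v) := by
    intro x hx s hs hxs
    have hseg : ∀ t ∈ Icc 0 s, x + t • v ∈ Metric.ball p ρ := by
      intro t ht
      have := (convex_ball p ρ).add_smul_sub_mem hx hxs
        (t := t / s) ⟨div_nonneg ht.1 hs.le, (div_le_one hs).2 ht.2⟩
      rwa [add_sub_cancel_left, smul_smul, div_mul_cancel₀ _ hs.ne'] at this
    have := strictMonoOn_comp_of_fderiv_pos hgd (c := fun t : ℝ => x + t • v) (w := fun _ => v)
      (a := 0) (b := s)
      (fun t _ => by simpa using ((hasDerivAt_id t).smul_const v).const_add x)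
      (fun t ht => hball _ (hseg t ht)) ⟨le_rfl, hs.le⟩ ⟨hs.le, le_rfl⟩ hs
    simpa using this
  filter_upwards [hzero, hx1, hx2] with x h0 h1 h2
  change (g x = 0 ↔ φ x = 0) ∧ (g x < 0 ↔ φ x < 0) ∧ (0 < g x ↔ 0 < φ x)
  rcases lt_trichotomy (φ x) 0 with hneg | hz | hpos
  · have := hmono x h1 (-φ x) (by linarith) (by rwa [neg_smul, ← sub_eq_add_neg])
    rw [neg_smul, ← sub_eq_add_neg, h0] at this
    refine ⟨?_, ?_, ?_⟩ <;> constructor <;> intro h <;> linarith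
  · rw [hz, zero_smul, sub_zero] at h0
    refine ⟨?_, ?_, ?_⟩ <;> constructor <;> intro h <;> linarith
  · have := hmono _ h2 (φ x) hpos (by rwa [sub_add_cancel])
    rw [sub_add_cancel, h0] at this
    refine ⟨?_, ?_, ?_⟩ <;> constructor <;> intro h <;> linarith

end CrossingGeometry

/-! ### Normal form of X at a crossing point. -/

section Crossings

variable {n : ℕ} {M Sig : Set (Eu n)} {X : Eu n → Eu n}

/-- Normal form of a piecewise smooth field near a point `p` where its orbits cross `Sig`
transversely from `Wm` to `Wp`: near `p`, `Sig` is the graph `L x = h x`, and the field is `Ym`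
below and `Yp` above the graph. -/
structure Crossing (M Sig : Set (Eu n)) (X : Eu n → Eu n) (Wm Wp : Set (Eu n))
    (Ym Yp : Eu n → Eu n) (p : Eu n) where
  /-- the height -/
  L : Eu n →L[ℝ] ℝ
  /-- the vertical direction -/
  v : Eu n
  /-- the function of which `Sig` is the graph -/
  h : Eu n → ℝ
  /-- the neighbourhood of `p` on which the normal form is valid -/
  N : Set (Eu n)
  /-- a Lipschitz constant -/
  K : NNReal
  /-- a chart at `p` -/
  e : OpenPartialHomeomorph (Eu n) (Eu n)
  L_v : L v = 1
  h_smooth : ContDiff ℝ ∞ h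
  h_inv : ∀ x (r : ℝ), h (x + r • v) = h x
  N_mem : N ∈ 𝓝 p
  N_sub : N ⊆ M
  mem_iff : ∀ x ∈ N, x ∈ Sig ↔ L x - h x = 0
  neg : ∀ x ∈ N, L x - h x < 0 → x ∈ Wm ∧ X x = Ym x
  pos : ∀ x ∈ N, 0 < L x - h x → x ∈ Wp ∧ X x = Yp x
  lipschitz : LipschitzOnWith K (fun x => L x - h x) N
  base_mem : p ∈ Sig
  deriv_m : 0 < fderiv ℝ (fun x => L x - h x) p (Ym p)
  deriv_p : 0 < fderiv ℝ (fun x => L x - h x) p (Yp p)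
  chart : IsAdaptedChart M Sig 1 p e
  chart_deriv : ∀ w, 0 < fderiv ℝ (fun x => L x - h x) p w →
    fderiv ℝ e p w ⟨0, chart.le_dim⟩ ≠ 0

/-- The function `L x - h x`, which vanishes on `Sig`. -/
def Crossing.φ {Wm Wp : Set (Eu n)} {Ym Yp : Eu n → Eu n} {p : Eu n}
    (C : Crossing M Sig X Wm Wp Ym Yp p) (x : Eu n) : ℝ := C.L x - C.h x

theorem exists_hasDerivWithinAt_left {α : ℝ → Eu n} {a b : ℝ} (hab : a < b)
    (hα : ContinuousOn α (Icc a b)) {W O : Set (Eu n)} (hO : O ∈ 𝓝 (α b)) {Y : Eu n → Eu n}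
    (hY : Continuous Y) (hXY : ∀ x ∈ W ∩ O, X x = Y x) (hαW : ∀ t ∈ Ioo a b, α t ∈ W)
    (hαd : ∀ t ∈ Ioo a b, HasDerivAt α (X (α t)) t) :
    HasDerivWithinAt α (Y (α b)) (Iic b) b := by
  have hev : ∀ᶠ t in 𝓝[≤] b, α t ∈ O :=
    ((hα b ⟨hab.le, le_rfl⟩).mono_of_mem_nhdsWithin (Icc_mem_nhdsLE hab)) hO
  obtain ⟨a', ha', hsub⟩ := mem_nhdsLE_iff_exists_Icc_subset.1 hev
  set a'' := max a a'
  have hab' : a'' < b := max_lt hab ha'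
  refine (hasDerivWithinAt_Icc_of_hasDerivAt_Ioo (w := fun t => Y (α t)) hab'
    (hα.mono (Icc_subset_Icc_left (le_max_left _ _)))
    (hY.comp_continuousOn (hα.mono (Icc_subset_Icc_left (le_max_left _ _)))) (fun t ht => ?_) b
    ⟨hab'.le, le_rfl⟩).mono_of_mem_nhdsWithin (Icc_mem_nhdsLE hab')
  have ht' : t ∈ Ioo a b := ⟨(le_max_left _ _).trans_lt ht.1, ht.2⟩
  rw [← hXY _ ⟨hαW t ht', hsub ⟨(le_max_right _ _).trans ht.1.le, ht.2.le⟩⟩]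
  exact hαd t ht'

theorem exists_hasDerivWithinAt_right {α : ℝ → Eu n} {a b : ℝ} (hab : a < b)
    (hα : ContinuousOn α (Icc a b)) {W O : Set (Eu n)} (hO : O ∈ 𝓝 (α a)) {Y : Eu n → Eu n}
    (hY : Continuous Y) (hXY : ∀ x ∈ W ∩ O, X x = Y x) (hαW : ∀ t ∈ Ioo a b, α t ∈ W)
    (hαd : ∀ t ∈ Ioo a b, HasDerivAt α (X (α t)) t) :
    HasDerivWithinAt α (Y (α a)) (Ici a) a := by
  have hev : ∀ᶠ t in 𝓝[≥] a, α t ∈ O :=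
    ((hα a ⟨le_rfl, hab.le⟩).mono_of_mem_nhdsWithin (Icc_mem_nhdsGE hab)) hO
  obtain ⟨b', hb', hsub⟩ := mem_nhdsGE_iff_exists_Icc_subset.1 hev
  set b'' := min b b'
  have hab' : a < b'' := lt_min hab hb'
  refine (hasDerivWithinAt_Icc_of_hasDerivAt_Ioo (w := fun t => Y (α t)) hab'
    (hα.mono (Icc_subset_Icc_right (min_le_left _ _)))
    (hY.comp_continuousOn (hα.mono (Icc_subset_Icc_right (min_le_left _ _)))) (fun t ht => ?_) a
    ⟨le_rfl, hab'.le⟩).mono_of_mem_nhdsWithin (Icc_mem_nhdsGE hab')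
  have ht' : t ∈ Ioo a b := ⟨ht.1, ht.2.trans_le (min_le_left _ _)⟩
  rw [← hXY _ ⟨hαW t ht', hsub ⟨ht.1.le, ht.2.le.trans (min_le_right _ _)⟩⟩]
  exact hαd t ht'

theorem eventually_neg_of_deriv_pos_left {f : ℝ → ℝ} {f' b : ℝ} (hf : HasDerivWithinAt f f' (Iic b) b)
    (hf' : 0 < f') (hb : f b = 0) : ∀ᶠ t in 𝓝[<] b, f t < 0 := by
  have h := (hasDerivWithinAt_iff_tendsto_slope.1 hf).eventually (lt_mem_nhds hf')
  have hs : Iic b \ {b} = Iio b := by ext; simp [lt_iff_le_and_ne]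
  rw [hs] at h
  filter_upwards [h, self_mem_nhdsWithin] with t ht htb
  rw [slope_def_field, hb, sub_zero] at ht
  have : t - b < 0 := sub_neg.2 htb
  by_contra hc
  exact absurd ht (not_lt.2 (div_nonpos_of_nonneg_of_nonpos (not_lt.1 hc) this.le))

theorem eventually_pos_of_deriv_pos_right {f : ℝ → ℝ} {f' a : ℝ}
    (hf : HasDerivWithinAt f f' (Ici a) a) (hf' : 0 < f') (ha : f a = 0) :
    ∀ᶠ t in 𝓝[>] a, 0 < f t := by
  have h := (hasDerivWithinAt_iff_tendsto_slope.1 hf).eventually (lt_mem_nhds hf')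
  have hs : Ici a \ {a} = Ioi a := by ext; simp [lt_iff_le_and_ne]
  rw [hs] at h
  filter_upwards [h, self_mem_nhdsWithin] with t ht hta
  rw [slope_def_field, ha, sub_zero] at ht
  have : 0 < t - a := sub_pos.2 hta
  by_contra hc
  exact absurd ht (not_lt.2 (div_nonpos_of_nonpos_of_nonneg (not_lt.1 hc) this.le))

/-- The two sides of `Sig` in a small neighbourhood of a smooth point are connected. -/
theorem IsAdaptedChart.exists_sides {p : Eu n} {e : OpenPartialHomeomorph (Eu n) (Eu n)}
    (he : IsAdaptedChart M Sig 1 p e) {R : Set (Eu n)} (hR : R ∈ 𝓝 p) :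
    ∃ N ∈ 𝓝 p, N ⊆ R ∧ N ⊆ e.source ∧
      IsPreconnected {x ∈ N | e x ⟨0, he.le_dim⟩ < 0} ∧
      IsPreconnected {x ∈ N | 0 < e x ⟨0, he.le_dim⟩} := by
  have hsc : ContinuousAt e.symm 0 := e.continuousAt_symm he.zero_mem_target
  have hev : ∀ᶠ y in 𝓝 (0 : Eu n), y ∈ e.target ∧ e.symm y ∈ R :=
    (e.open_target.eventually_mem he.zero_mem_target).and
      (hsc.eventually (by rw [he.symm_zero]; exact hR))
  obtain ⟨r, hr, hball⟩ := Metric.eventually_nhds_iff_ball.1 hev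
  set N := e.source ∩ e ⁻¹' Metric.ball 0 r with hN
  have hNmem : N ∈ 𝓝 p := by
    refine Filter.inter_mem (e.open_source.mem_nhds he.mem_source)
      ((e.continuousAt he.mem_source).preimage_mem_nhds ?_)
    rw [he.map_base]
    exact Metric.ball_mem_nhds 0 hr
  have hside : ∀ P : ℝ → Prop, Convex ℝ {y : Eu n | P (y ⟨0, he.le_dim⟩)} →
      IsPreconnected {x ∈ N | P (e x ⟨0, he.le_dim⟩)} := by
    intro P hP
    have himage : {x ∈ N | P (e x ⟨0, he.le_dim⟩)} =
        e.symm '' (Metric.ball 0 r ∩ {y : Eu n | P (y ⟨0, he.le_dim⟩)}) := by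
      ext x
      constructor
      · rintro ⟨⟨hxs, hxb⟩, hxP⟩
        exact ⟨e x, ⟨hxb, hxP⟩, e.left_inv hxs⟩
      · rintro ⟨y, ⟨hyb, hyP⟩, rfl⟩
        have hyt := (hball y hyb).1
        refine ⟨⟨e.map_target hyt, ?_⟩, ?_⟩
        · rw [mem_preimage, e.right_inv hyt]
          exact hyb
        · rw [e.right_inv hyt]
          exact hyP
    rw [himage]
    refine ((convex_ball (0 : Eu n) r).inter hP).isPreconnected.image _ ?_
    exact e.continuousOn_symm.mono fun y hy => (hball y hy.1).1
  have hlin : IsLinearMap ℝ fun y : Eu n => y ⟨0, he.le_dim⟩ :=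
    ⟨fun _ _ => rfl, fun _ _ => rfl⟩
  refine ⟨N, hNmem, ?_, inter_subset_left, hside (· < 0) (convex_halfSpace_lt hlin 0),
    hside (0 < ·) (convex_halfSpace_gt hlin 0)⟩
  rintro x ⟨hxs, hxb⟩
  have := (hball _ hxb).2
  rwa [e.left_inv hxs] at this

theorem subset_of_component {W S : Set (Eu n)} {A : Set (Eu n)}
    (hW : ∃ x ∈ A, W = connectedComponentIn A x) (hS : IsPreconnected S)
    (hSA : S ⊆ A) {y : Eu n} (hyS : y ∈ S) (hyW : y ∈ W) : S ⊆ W := by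
  obtain ⟨x, -, rfl⟩ := hW
  rw [connectedComponentIn_eq hyW]
  exact hS.subset_connectedComponentIn hyS hSA

/-- The sides of Σ near p are connected, so each lies in a single component of the complement as
soon as it meets it. The incoming curve puts the negative side in `Wm`. The point to prove is that
the outgoing curve leaves on the other side. -/
theorem exists_crossing {Wm Wp : Set (Eu n)}
    (hWm : ∃ x ∈ M \ Sig, Wm = connectedComponentIn (M \ Sig) x)
    (hWp : ∃ x ∈ M \ Sig, Wp = connectedComponentIn (M \ Sig) x) {Ym Yp : Eu n → Eu n}
    (hYm : ContDiff ℝ ∞ Ym) (hYp : ContDiff ℝ ∞ Yp) {p : Eu n} {Om Op : Set (Eu n)}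
    (hOm : Om ∈ 𝓝 p) (hOp : Op ∈ 𝓝 p) (hXm : ∀ x ∈ Wm ∩ Om, X x = Ym x)
    (hXp : ∀ x ∈ Wp ∩ Op, X x = Yp x) (hTm : IsTransverseAt M Sig p (Ym p))
    (hTp : IsTransverseAt M Sig p (Yp p)) {α β : ℝ → Eu n} {a b c d : ℝ} (hab : a < b)
    (hcd : c < d) (hα : ContinuousOn α (Icc a b)) (hαb : α b = p)
    (hαW : ∀ t ∈ Ioo a b, α t ∈ Wm) (hαd : ∀ t ∈ Ioo a b, HasDerivAt α (X (α t)) t)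
    (hβ : ContinuousOn β (Icc c d)) (hβc : β c = p) (hβW : ∀ t ∈ Ioo c d, β t ∈ Wp)
    (hβd : ∀ t ∈ Ioo c d, HasDerivAt β (X (β t)) t) :
    Nonempty (Crossing M Sig X Wm Wp Ym Yp p) := by
  obtain ⟨e, he, -⟩ := id hTm
  set j : Fin n := ⟨0, he.le_dim⟩ with hj
  have hdm : fderiv ℝ e p (Ym p) j ≠ 0 := hTm.fderiv_ne_zero he
  have hdp : fderiv ℝ e p (Yp p) j ≠ 0 := hTp.fderiv_ne_zero he
  -- an oriented defining function
  set lam : ℝ := (fderiv ℝ e p (Ym p) j)⁻¹ with hlam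
  have hlam0 : lam ≠ 0 := inv_ne_zero hdm
  obtain ⟨g, hg, -, O, hO, hpO, hOe, hgO⟩ := exists_compactSupport_eq
    (f := fun x => lam * e x j) e.open_source (contDiffOn_const.mul
      ((EuclideanSpace.proj (𝕜 := ℝ) j).contDiff.comp_contDiffOn he.smooth))
    isCompact_singleton (singleton_subset_iff.2 he.mem_source)
  rw [singleton_subset_iff] at hpO
  have hgp : g p = 0 := by rw [hgO hpO]; simp [he.map_base]
  have hgd : Differentiable ℝ g := hg.differentiable (by simp)
  have hgderiv : ∀ w, fderiv ℝ g p w = lam * fderiv ℝ e p w j := by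
    intro w
    have h1 : HasFDerivAt e (fderiv ℝ e p) p :=
      ((he.contDiffAt he.mem_source).differentiableAt (by simp)).hasFDerivAt
    have h2 : HasFDerivAt (fun x => e x j) ((EuclideanSpace.proj (𝕜 := ℝ) j).comp (fderiv ℝ e p)) p :=
      (EuclideanSpace.proj (𝕜 := ℝ) j).hasFDerivAt.comp p h1
    have h3 : HasFDerivAt g (lam • (EuclideanSpace.proj (𝕜 := ℝ) j).comp (fderiv ℝ e p)) p :=
      (h2.const_mul lam).congr_of_eventuallyEq
        (Filter.eventually_of_mem (hO.mem_nhds hpO) fun x hx => hgO hx)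
    rw [h3.fderiv]
    simp
  have hLm : fderiv ℝ g p (Ym p) = 1 := by rw [hgderiv]; exact inv_mul_cancel₀ hdm
  obtain ⟨h, hh, hhinv, hφd, hsign⟩ := exists_graph_function hg hgp hLm
  set L := fderiv ℝ g p
  have hφs : ContDiff ℝ ∞ fun x => L x - h x := L.contDiff.sub hh
  obtain ⟨K, NK, hNK, hKlip⟩ :=
    ((hφs.of_le (by simp : (1 : WithTop ℕ∞) ≤ ∞)).contDiffAt (x := p)).exists_lipschitzOnWith
  obtain ⟨N, hN, hNR, hNe, hneg, hpos⟩ := he.exists_sides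
    (R := O ∩ Om ∩ Op ∩ NK ∩ {x | (g x = 0 ↔ L x - h x = 0) ∧ (g x < 0 ↔ L x - h x < 0) ∧
      (0 < g x ↔ 0 < L x - h x)})
    (Filter.inter_mem (Filter.inter_mem (Filter.inter_mem (Filter.inter_mem (hO.mem_nhds hpO) hOm)
      hOp) hNK) hsign)
  have hNM : N ⊆ M := hNe.trans he.source_subset
  have hgN : ∀ x ∈ N, g x = lam * e x j := fun x hx => hgO (hNR hx).1.1.1.1
  -- sides, in terms of `g`
  have hsides : IsPreconnected {x ∈ N | g x < 0} ∧ IsPreconnected {x ∈ N | 0 < g x} := by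
    rcases lt_or_gt_of_ne hlam0 with hl | hl
    · have h1 : {x ∈ N | g x < 0} = {x ∈ N | 0 < e x j} := by
        ext x
        refine and_congr_right fun hx => ?_
        rw [hgN x hx]
        constructor <;> intro h <;> nlinarith
      have h2 : {x ∈ N | 0 < g x} = {x ∈ N | e x j < 0} := by
        ext x
        refine and_congr_right fun hx => ?_
        rw [hgN x hx]
        constructor <;> intro h <;> nlinarith
      exact ⟨h1 ▸ hpos, h2 ▸ hneg⟩
    · have h1 : {x ∈ N | g x < 0} = {x ∈ N | e x j < 0} := by
        ext x
        refine and_congr_right fun hx => ?_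
        rw [hgN x hx]
        constructor <;> intro h <;> nlinarith
      have h2 : {x ∈ N | 0 < g x} = {x ∈ N | 0 < e x j} := by
        ext x
        refine and_congr_right fun hx => ?_
        rw [hgN x hx]
        constructor <;> intro h <;> nlinarith
      exact ⟨h1 ▸ hneg, h2 ▸ hpos⟩
  have hSig : ∀ x ∈ N, x ∈ Sig ↔ g x = 0 := by
    intro x hx
    rw [he.mem_iff_zero (hNe hx), hgN x hx, mul_eq_zero, or_iff_right hlam0]
  have hnegA : {x ∈ N | g x < 0} ⊆ M \ Sig := fun x hx =>
    ⟨hNM hx.1, fun hxS => hx.2.ne ((hSig x hx.1).1 hxS)⟩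
  have hposA : {x ∈ N | 0 < g x} ⊆ M \ Sig := fun x hx =>
    ⟨hNM hx.1, fun hxS => hx.2.ne' ((hSig x hx.1).1 hxS)⟩
  -- the incoming curve
  have hαder : HasDerivWithinAt (fun t => g (α t)) 1 (Iic b) b := by
    have h1 := exists_hasDerivWithinAt_left (X := X) hab hα (by rwa [hαb]) hYm.continuous hXm hαW hαd
    rw [hαb] at h1
    have h2 : HasFDerivAt g L (α b) := by rw [hαb]; exact (hgd p).hasFDerivAt
    rw [← hLm]
    exact h2.comp_hasDerivWithinAt b h1
  have hαneg : ∀ᶠ t in 𝓝[<] b, g (α t) < 0 :=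
    eventually_neg_of_deriv_pos_left hαder one_pos (by simp only [hαb, hgp])
  have hαt : Filter.Tendsto α (𝓝[<] b) (𝓝 p) := by
    have := (hα b ⟨hab.le, le_rfl⟩).mono_of_mem_nhdsWithin (Icc_mem_nhdsLE hab)
    rw [← hαb]
    exact this.mono_left (nhdsWithin_mono _ Iio_subset_Iic_self)
  have hαside : ∀ᶠ t in 𝓝[<] b, α t ∈ {x ∈ N | g x < 0} ∧ α t ∈ Wm := by
    filter_upwards [hαneg, hαt hN, Ioo_mem_nhdsLT hab] with t h1 h2 h3
    exact ⟨⟨h2, h1⟩, hαW t h3⟩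
  have hnegWm : {x ∈ N | g x < 0} ⊆ Wm := by
    obtain ⟨t, ht, htW⟩ := hαside.exists
    exact subset_of_component hWm hsides.1 hnegA ht htW
  -- the outgoing curve
  have hβder : HasDerivWithinAt (fun t => g (β t)) (L (Yp p)) (Ici c) c := by
    have h1 := exists_hasDerivWithinAt_right (X := X) hcd hβ (by rwa [hβc]) hYp.continuous hXp hβW hβd
    rw [hβc] at h1
    have h2 : HasFDerivAt g L (β c) := by rw [hβc]; exact (hgd p).hasFDerivAt
    exact h2.comp_hasDerivWithinAt c h1
  have hβt : Filter.Tendsto β (𝓝[>] c) (𝓝 p) := by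
    have := (hβ c ⟨le_rfl, hcd.le⟩).mono_of_mem_nhdsWithin (Icc_mem_nhdsGE hcd)
    rw [← hβc]
    exact this.mono_left (nhdsWithin_mono _ Ioi_subset_Ici_self)
  -- If the orbit turned back, the negative side would lie in both `Wm` and `Wp`. Then Ym = Yp there
  -- and, by continuity, at p, so L (Yp p) = L (Ym p) = 1, a contradiction.
  have hLp : 0 < L (Yp p) := by
    by_contra hcon
    have hlt : L (Yp p) < 0 := lt_of_le_of_ne (not_lt.1 hcon) (by
      rw [hgderiv]
      exact mul_ne_zero hlam0 hdp)
    have hβneg : ∀ᶠ t in 𝓝[>] c, 0 < -g (β t) :=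
      eventually_pos_of_deriv_pos_right hβder.neg (by linarith) (by simp [hβc, hgp])
    have hβside : ∀ᶠ t in 𝓝[>] c, β t ∈ {x ∈ N | g x < 0} ∧ β t ∈ Wp := by
      filter_upwards [hβneg, hβt hN, Ioo_mem_nhdsGT hcd] with t h1 h2 h3
      exact ⟨⟨h2, by linarith⟩, hβW t h3⟩
    obtain ⟨t, ht, htW⟩ := hβside.exists
    have hnegWp := subset_of_component hWp hsides.1 hnegA ht htW
    have hEq : ∀ᶠ t in 𝓝[<] b, Ym (α t) = Yp (α t) := by
      filter_upwards [hαside] with t ht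
      have hR := hNR ht.1.1
      rw [← hXm _ ⟨ht.2, hR.1.1.1.2⟩, ← hXp _ ⟨hnegWp ht.1, hR.1.1.2⟩]
    have hYeq : Ym p = Yp p := tendsto_nhds_unique_of_eventuallyEq
      ((hYm.continuous.tendsto p).comp hαt) ((hYp.continuous.tendsto p).comp hαt) hEq
    rw [← hYeq, hLm] at hlt
    linarith
  have hβpos : ∀ᶠ t in 𝓝[>] c, 0 < g (β t) :=
    eventually_pos_of_deriv_pos_right hβder hLp (by simp only [hβc, hgp])
  have hposWp : {x ∈ N | 0 < g x} ⊆ Wp := by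
    have hβside : ∀ᶠ t in 𝓝[>] c, β t ∈ {x ∈ N | 0 < g x} ∧ β t ∈ Wp := by
      filter_upwards [hβpos, hβt hN, Ioo_mem_nhdsGT hcd] with t h1 h2 h3
      exact ⟨⟨h2, h1⟩, hβW t h3⟩
    obtain ⟨t, ht, htW⟩ := hβside.exists
    exact subset_of_component hWp hsides.2 hposA ht htW
  exact ⟨
    { L := L, v := Ym p, h := h, N := N, K := K, e := e
      L_v := hLm
      h_smooth := hh
      h_inv := hhinv
      N_mem := hN
      N_sub := hNM
      mem_iff := fun x hx => (hSig x hx).trans (hNR hx).2.1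
      neg := fun x hx hlt => by
        have hW := hnegWm ⟨hx, (hNR hx).2.2.1.2 hlt⟩
        exact ⟨hW, hXm x ⟨hW, (hNR hx).1.1.1.2⟩⟩
      pos := fun x hx hlt => by
        have hW := hposWp ⟨hx, (hNR hx).2.2.2.2 hlt⟩
        exact ⟨hW, hXp x ⟨hW, (hNR hx).1.1.2⟩⟩
      lipschitz := hKlip.mono fun x hx => (hNR hx).1.2
      base_mem := (hSig p (mem_of_mem_nhds hN)).2 hgp
      deriv_m := by rw [hφd.fderiv, hLm]; exact one_pos
      deriv_p := by rw [hφd.fderiv]; exact hLp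
      chart := he
      chart_deriv := fun w hw h0 => by
        rw [hφd.fderiv, hgderiv] at hw
        rw [h0, mul_zero] at hw
        exact lt_irrefl _ hw }⟩

end Crossings

/-! ### Concatenation of orbit arcs, and uniqueness of returns and transitions. -/

section Arcs

variable {n : ℕ} {D A B : Set (Eu n)} {V : Eu n → Eu n} {x y z : Eu n}

/-- An orbit arc of `V` in `D` from `x` to `y`, of positive duration, the interior of which
lies in `A`. -/
def IsArc (D : Set (Eu n)) (V : Eu n → Eu n) (A : Set (Eu n)) (x y : Eu n) : Prop :=
  ∃ T > 0, ∃ c : ℝ → Eu n, c 0 = x ∧ c T = y ∧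
    (∀ t ∈ Icc 0 T, c t ∈ D ∧ HasDerivWithinAt c (V (c t)) (Icc 0 T) t) ∧ ∀ t ∈ Ioo 0 T, c t ∈ A

theorem IsArc.mono {D' : Set (Eu n)} (h : IsArc D V A x y) (hD : D ⊆ D') (hAB : A ⊆ B) :
    IsArc D' V B x y := by
  obtain ⟨T, hT, c, h0, h1, hc, hcA⟩ := h
  exact ⟨T, hT, c, h0, h1, fun t ht => ⟨hD (hc t ht).1, (hc t ht).2⟩, fun t ht => hAB (hcA t ht)⟩

theorem IsArc.trans (h : IsArc D V A x y) (h' : IsArc D V A y z) (hy : y ∈ A) :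
    IsArc D V A x z := by
  obtain ⟨T, hT, c, h0, h1, hc, hcA⟩ := h
  obtain ⟨T', hT', c', h0', h1', hc', hcA'⟩ := h'
  set d : ℝ → Eu n := fun t => if t ≤ T then c t else c' (t - T) with hd
  have hdl : EqOn d c (Icc 0 T) := fun t ht => if_pos ht.2
  have hdr : EqOn d (fun t => c' (t - T)) (Icc T (T + T')) := by
    intro t ht
    rcases eq_or_lt_of_le ht.1 with rfl | hlt
    · simp [hd, h1, h0']
    · exact if_neg (not_le.2 hlt)
  have hderl : ∀ t ∈ Icc 0 T, HasDerivWithinAt d (V (d t)) (Icc 0 T) t := fun t ht => by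
    rw [hdl ht]
    exact (hc t ht).2.congr hdl (hdl ht)
  have hderr : ∀ t ∈ Icc T (T + T'), HasDerivWithinAt d (V (d t)) (Icc T (T + T')) t := by
    intro t ht
    have ht' : t - T ∈ Icc 0 T' := ⟨by linarith [ht.1], by linarith [ht.2]⟩
    rw [hdr ht]
    refine HasDerivWithinAt.congr ?_ hdr (hdr ht)
    have h2 : HasDerivWithinAt (fun s : ℝ => s - T) 1 (Icc T (T + T')) t :=
      ((hasDerivAt_id t).sub_const T).hasDerivWithinAt
    have hmaps : MapsTo (fun s : ℝ => s - T) (Icc T (T + T')) (Icc 0 T') := fun s hs =>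
      ⟨by linarith [hs.1], by linarith [hs.2]⟩
    have := (hc' _ ht').2.scomp t h2 hmaps
    rw [one_smul] at this
    exact this
  have hunion : Icc 0 (T + T') = Icc 0 T ∪ Icc T (T + T') :=
    (Icc_union_Icc_eq_Icc hT.le (by linarith)).symm
  have hleft : ∀ t < T, Icc 0 T ∈ 𝓝[Icc 0 (T + T')] t := fun t ht =>
    mem_nhdsWithin.2 ⟨Iio T, isOpen_Iio, ht, fun s hs => ⟨hs.2.1, le_of_lt hs.1⟩⟩
  have hright : ∀ t, T < t → Icc T (T + T') ∈ 𝓝[Icc 0 (T + T')] t := fun t ht =>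
    mem_nhdsWithin.2 ⟨Ioi T, isOpen_Ioi, ht, fun s hs => ⟨le_of_lt hs.1, hs.2.2⟩⟩
  refine ⟨T + T', by linarith, d, ?_, ?_, fun t ht => ⟨?_, ?_⟩, fun t ht => ?_⟩
  · rw [hdl ⟨le_rfl, hT.le⟩, h0]
  · rw [hdr ⟨by linarith, le_rfl⟩, ← h1']
    simp
  · rcases le_total t T with h | h
    · rw [hdl ⟨ht.1, h⟩]
      exact (hc t ⟨ht.1, h⟩).1
    · rw [hdr ⟨h, ht.2⟩]
      exact (hc' _ ⟨by linarith, by linarith [ht.2]⟩).1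
  · rcases lt_trichotomy t T with h | rfl | h
    · exact (hderl t ⟨ht.1, h.le⟩).mono_of_mem_nhdsWithin (hleft t h)
    · rw [hunion]
      exact (hderl t ⟨ht.1, le_rfl⟩).union (hderr t ⟨le_rfl, ht.2⟩)
    · exact (hderr t ⟨h.le, ht.2⟩).mono_of_mem_nhdsWithin (hright t h)
  · rcases lt_trichotomy t T with h | rfl | h
    · rw [hdl ⟨ht.1.le, h.le⟩]
      exact hcA t ⟨ht.1, h⟩
    · rw [hdl ⟨ht.1.le, le_rfl⟩, h1]
      exact hy
    · rw [hdr ⟨h.le, ht.2.le⟩]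
      exact hcA' _ ⟨by linarith, by linarith [ht.2]⟩

/-- The first return is unique, and it is given by any arc which avoids the section and along
which the field is regular. -/
theorem IsArc.isFirstReturn_iff {S D' : Set (Eu n)} (h : IsArc D V Sᶜ x y) (hy : y ∈ S)
    (hD : D ⊆ D') (hV : ∀ w ∈ D, ContDiffAt ℝ 1 V w) {w : Eu n} :
    IsFirstReturn D' V S x w ↔ w = y := by
  obtain ⟨T, hT, c, h0, h1, hc, hcA⟩ := h
  constructor
  · rintro ⟨hw, T', hT', c', h0', h1', hc', hcA'⟩
    -- Regularity of V along the known arc c suffices; nothing is assumed along the competing curve.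
    have hEq : EqOn c c' (Icc 0 (min T T')) := by
      refine eqOn_of_integralCurve (V := V) (fun t ht => hV _ (hc t ?_).1)
        (fun t ht => (hc t ?_).2.mono (Icc_subset_Icc_right (min_le_left _ _)))
        (fun t ht => (hc' t ?_).2.mono (Icc_subset_Icc_right (min_le_right _ _)))
        (h0.trans h0'.symm)
      exacts [⟨ht.1, ht.2.trans (min_le_left _ _)⟩, ⟨ht.1, ht.2.trans (min_le_left _ _)⟩,
        ⟨ht.1, ht.2.trans (min_le_right _ _)⟩]
    rcases lt_trichotomy T T' with hlt | rfl | hlt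
    · have := hEq (x := T) ⟨hT.le, by rw [min_eq_left hlt.le]⟩
      exact absurd (this ▸ h1.symm ▸ hy) (hcA' T ⟨hT, hlt⟩)
    · have := hEq (x := T) ⟨hT.le, by simp⟩
      rw [← h1', ← this, h1]
    · have := hEq (x := T') ⟨hT'.le, by rw [min_eq_right hlt.le]⟩
      refine absurd ?_ (hcA T' ⟨hT', hlt⟩)
      rw [this, h1']
      exact hw
  · rintro rfl
    exact ⟨hy, T, hT, c, h0, h1, fun t ht => ⟨hD (hc t ht).1, (hc t ht).2⟩, hcA⟩

/-- The transition through a component is unique. -/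
theorem IsTransition.unique {M Sig W : Set (Eu n)} {X Y : Eu n → Eu n} (hM : IsOpen M)
    (hSM : Sig ⊆ M) (hWM : W ⊆ M \ Sig) (hY : ContDiffOn ℝ ∞ Y M) (hXY : EqOn X Y W)
    (h : IsTransition Sig X W x y) (h' : IsTransition Sig X W x z) : y = z := by
  obtain ⟨hx, hy, T, hT, c, hc, h0, h1, hcW⟩ := h
  obtain ⟨-, hz, T', hT', c', hc', h0', h1', hcW'⟩ := h'
  have hmem : ∀ {T : ℝ} {c : ℝ → Eu n}, c 0 ∈ Sig → c T ∈ Sig →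
      (∀ t ∈ Ioo 0 T, c t ∈ W ∧ HasDerivAt c (X (c t)) t) → ∀ t ∈ Icc 0 T, c t ∈ M := by
    intro T c h0 h1 h t ht
    rcases eq_or_lt_of_le ht.1 with rfl | hlt
    · exact hSM h0
    rcases eq_or_lt_of_le ht.2 with rfl | hlt'
    · exact hSM h1
    exact (hWM (h t ⟨hlt, hlt'⟩).1).1
  have hder : ∀ {T : ℝ} {c : ℝ → Eu n}, 0 < T → ContinuousOn c (Icc 0 T) → c 0 ∈ Sig → c T ∈ Sig →
      (∀ t ∈ Ioo 0 T, c t ∈ W ∧ HasDerivAt c (X (c t)) t) →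
      ∀ t ∈ Icc 0 T, HasDerivWithinAt c (Y (c t)) (Icc 0 T) t := by
    intro T c hT hc h0 h1 h
    refine hasDerivWithinAt_Icc_of_hasDerivAt_Ioo (w := fun t => Y (c t)) hT hc
      (hY.continuousOn.comp hc (hmem h0 h1 h)) fun t ht => ?_
    rw [← hXY (h t ht).1]
    exact (h t ht).2
  have hc0 : c 0 ∈ Sig := h0 ▸ hx
  have hc1 : c T ∈ Sig := h1 ▸ hy
  have hc0' : c' 0 ∈ Sig := h0' ▸ hx
  have hc1' : c' T' ∈ Sig := h1' ▸ hz
  have hEq : EqOn c c' (Icc 0 (min T T')) := by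
    refine eqOn_of_integralCurve (V := Y) (fun t ht => ?_)
      (fun t ht => (hder hT hc hc0 hc1 hcW t ?_).mono (Icc_subset_Icc_right (min_le_left _ _)))
      (fun t ht => (hder hT' hc' hc0' hc1' hcW' t ?_).mono
        (Icc_subset_Icc_right (min_le_right _ _))) (h0.trans h0'.symm)
    · exact (hY.contDiffAt (hM.mem_nhds (hmem hc0 hc1 hcW t
        ⟨ht.1, ht.2.trans (min_le_left _ _)⟩))).of_le (by simp)
    · exact ⟨ht.1, ht.2.trans (min_le_left _ _)⟩
    · exact ⟨ht.1, ht.2.trans (min_le_right _ _)⟩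
  rcases lt_trichotomy T T' with hlt | rfl | hlt
  · have := hEq (x := T) ⟨hT.le, by rw [min_eq_left hlt.le]⟩
    exact absurd (this ▸ hc1) (hWM (hcW' T ⟨hT, hlt⟩).1).2
  · have := hEq (x := T) ⟨hT.le, by simp⟩
    rw [← h1', ← this, h1]
  · have := hEq (x := T') ⟨hT'.le, by rw [min_eq_right hlt.le]⟩
    exact absurd (this.symm ▸ hc1') (hWM (hcW T' ⟨hT', hlt⟩).1).2

end Arcs

/-! ### Where the regularized field is C¹, and its local expressions. -/

section Regular

variable {n : ℕ} {M Sig : Set (Eu n)} {m : Eu n → ℝ} {X Y : Eu n → Eu n} {r : ℝ}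

/-- The points of the domain of the regularization near which it is of class `C¹`. -/
def regularDomain (M : Set (Eu n)) (m : Eu n → ℝ) (X : Eu n → Eu n) (ε : ℝ) : Set (Eu n) :=
  {x ∈ smoothedDomain M m ε | ContDiffAt ℝ 1 (smoothedField m X ε) x}

theorem sub_smul_mem_closedBall (hr : tsupport m ⊆ Metric.closedBall 0 r) {ε : ℝ} (hε : 0 < ε)
    (x : Eu n) {u : Eu n} (hu : u ∈ tsupport m) : x - ε • u ∈ Metric.closedBall x (ε * r) := by
  have := hr hu
  rw [mem_closedBall_zero_iff] at this
  rw [mem_closedBall_iff_norm, sub_sub_cancel_left, norm_neg, norm_smul, Real.norm_of_nonneg hε.le]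
  gcongr

theorem mem_smoothedDomain (hr : tsupport m ⊆ Metric.closedBall 0 r) {ε : ℝ} (hε : 0 < ε)
    {x : Eu n} (hx : Metric.closedBall x (ε * r) ⊆ M) : x ∈ smoothedDomain M m ε := by
  intro u hu
  have hu' : ε⁻¹ • u ∈ tsupport m := by
    have hsub : tsupport (rescaledMollifier m ε) ⊆ (fun u => ε⁻¹ • u) ⁻¹' tsupport m := by
      refine closure_minimal (fun w hw => subset_tsupport m ?_)
        ((isClosed_tsupport m).preimage (continuous_const_smul _))
      intro h0
      exact hw (by simp [rescaledMollifier, h0])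
    exact hsub hu
  have := sub_smul_mem_closedBall hr hε x hu'
  rw [smul_inv_smul₀ hε.ne'] at this
  exact hx this

/-- Radius ε(r + 1) instead of εr leaves room to move x by ε. A formula for the convolution then
holds on a neighbourhood of x, which yields regularity as well as a value. -/
theorem closedBall_subset_of_mem_ball {S : Set (Eu n)} {ε : ℝ} {x y : Eu n}
    (hx : Metric.closedBall x (ε * (r + 1)) ⊆ S) (hy : y ∈ Metric.ball x ε) :
    Metric.closedBall y (ε * r) ⊆ S :=
  (Metric.closedBall_subset_closedBall' (by
    have := (Metric.mem_ball.1 hy).le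
    linarith)).trans hx

theorem mem_regularDomain_of_eq (hm : IsMollifier m) (hr : tsupport m ⊆ Metric.closedBall 0 r)
    (hY : ContDiff ℝ ∞ Y) {S : Set (Eu n)} (hS : S ⊆ M) (hXY : EqOn X Y S) {ε : ℝ} (hε : 0 < ε)
    {x : Eu n} (hx : Metric.closedBall x (ε * (r + 1)) ⊆ S) :
    x ∈ regularDomain M m X ε ∧ smoothedField m X ε x = mollified m Y (x, ε) := by
  have heq : ∀ y ∈ Metric.ball x ε, smoothedField m X ε y = mollified m Y (y, ε) := fun y hy =>
    smoothedField_eq_mollified hε fun u hu => hXY (closedBall_subset_of_mem_ball hx hy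
      (sub_smul_mem_closedBall hr hε y hu))
  have hxx := Metric.mem_ball_self (x := x) hε
  refine ⟨⟨mem_smoothedDomain hr hε ((closedBall_subset_of_mem_ball hx hxx).trans hS), ?_⟩,
    heq x hxx⟩
  have h1 : ContDiff ℝ ∞ fun y => mollified m Y (y, ε) :=
    (contDiff_mollified hm hY).comp (by fun_prop)
  exact ((h1.of_le (by simp)).contDiffAt).congr_of_eventuallyEq
    (Filter.eventually_of_mem (Metric.ball_mem_nhds x hε) heq)

variable {Wm Wp : Set (Eu n)} {Ym Yp : Eu n → Eu n} {p : Eu n}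

namespace Crossing

variable (C : Crossing M Sig X Wm Wp Ym Yp p)

/-- The regularized field near a crossing point, in the coordinates `(x, φ x / ε, ε)`. -/
noncomputable def field (m : Eu n → ℝ) (q : Eu n × ℝ × ℝ) : Eu n :=
  layerField m Ym Yp C.L C.v C.h q

theorem contDiff_φ : ContDiff ℝ ∞ C.φ := C.L.contDiff.sub C.h_smooth

theorem φ_base : C.φ p = 0 := (C.mem_iff p (mem_of_mem_nhds C.N_mem)).1 C.base_mem

theorem contDiff_field (hm : IsMollifier m) (hYm : ContDiff ℝ ∞ Ym) (hYp : ContDiff ℝ ∞ Yp) :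
    ContDiff ℝ ∞ (C.field m) := contDiff_layerField hm C.h_smooth C.h_inv hYm hYp

theorem field_pos (hm : IsMollifier m) (s : ℝ) : 0 < fderiv ℝ C.φ p (C.field m (p, s, 0)) :=
  layerField_zero_pos hm C.h_smooth C.h_inv C.L_v p s _ C.deriv_m C.deriv_p

theorem mem_regularDomain (hm : IsMollifier m) (hr : tsupport m ⊆ Metric.closedBall 0 r)
    (hYm : ContDiff ℝ ∞ Ym) (hYp : ContDiff ℝ ∞ Yp) {ε : ℝ} (hε : 0 < ε) {x : Eu n}
    (hx : Metric.closedBall x (ε * (r + 1)) ⊆ C.N) :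
    x ∈ regularDomain M m X ε ∧ smoothedField m X ε x = C.field m (x, C.φ x / ε, ε) := by
  have heq : ∀ y ∈ Metric.ball x ε,
      smoothedField m X ε y = C.field m (y, C.φ y / ε, ε) := fun y hy => by
    have hmem : ∀ u ∈ tsupport m, y - ε • u ∈ C.N := fun u hu =>
      closedBall_subset_of_mem_ball hx hy (sub_smul_mem_closedBall hr hε y hu)
    exact smoothedField_eq_layerField hm C.h_smooth C.h_inv C.L_v hYm hYp hε
      (fun u hu h => (C.neg _ (hmem u hu) h).2) (fun u hu h => (C.pos _ (hmem u hu) h).2)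
  have hxx := Metric.mem_ball_self (x := x) hε
  refine ⟨⟨mem_smoothedDomain hr hε ((closedBall_subset_of_mem_ball hx hxx).trans C.N_sub), ?_⟩,
    heq x hxx⟩
  have h1 : ContDiff ℝ ∞ fun y => C.field m (y, C.φ y / ε, ε) := by
    have := C.contDiff_φ
    exact (C.contDiff_field hm hYm hYp).comp (by fun_prop)
  exact ((h1.of_le (by simp)).contDiffAt).congr_of_eventuallyEq
    (Filter.eventually_of_mem (Metric.ball_mem_nhds x hε) heq)

theorem exists_layer_arc (hm : IsMollifier m) (hr : tsupport m ⊆ Metric.closedBall 0 r)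
    (hr0 : 0 ≤ r) (hYm : ContDiff ℝ ∞ Ym) (hYp : ContDiff ℝ ∞ Yp) {a b : ℝ} (hab : a < b) :
    ∃ K : Eu n × ℝ → Eu n, ContDiff ℝ ∞ K ∧ (∀ᶠ x in 𝓝 p, K (x, 0) = x) ∧
      ∀ᶠ q in 𝓝 (p, (0 : ℝ)), 0 < q.2 → C.φ q.1 = q.2 * a →
        C.φ (K q) = q.2 * b ∧ q.1 ∈ C.N ∧ K q ∈ C.N ∧
          IsArc (regularDomain M m X q.2) (smoothedField m X q.2)
            {x ∈ C.N | q.2 * a < C.φ x ∧ C.φ x < q.2 * b} q.1 (K q) := by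
  have hball := eventually_closedBall_subset C.N_mem (r + 1)
  -- The conditions on x and on ε are separated because the layer passage needs a neighbourhood of p
  -- that does not depend on ε.
  rw [nhds_prod_eq, Filter.eventually_prod_iff] at hball
  obtain ⟨P, hP, R, hR, hPR⟩ := hball
  have hreg : ∀ ε, 0 < ε → R ε → ∀ x, P x → x ∈ C.N ∧ x ∈ regularDomain M m X ε ∧
      smoothedField m X ε x = C.field m (x, C.φ x / ε, ε) := fun ε hε hRε x hx =>
    ⟨hPR hx hRε (Metric.mem_closedBall_self (by positivity)),
      C.mem_regularDomain hm hr hYm hYp hε (hPR hx hRε)⟩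
  obtain ⟨K, hK, hK0, hKarc⟩ := exists_layer_transition (C.contDiff_field hm hYm hYp) C.contDiff_φ
    (p := p) hab (C.field_pos hm) (V := smoothedField m X) (N := {x | P x}) hP (by
      filter_upwards [self_mem_nhdsWithin, nhdsWithin_le_nhds hR] with ε hε hRε x hx
      exact (hreg ε hε hRε x hx).2.2)
  refine ⟨K, hK, hK0, ?_⟩
  filter_upwards [hKarc {x | P x} hP, (continuous_snd.tendsto (p, (0 : ℝ))).eventually hR]
    with q hq hRq hε hqa
  obtain ⟨hφ, T, hT, c, h0, h1, hc, hcb⟩ := hq hε hqa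
  have hcP : ∀ t ∈ Icc 0 T, c t ∈ C.N ∧ c t ∈ regularDomain M m X q.2 := fun t ht =>
    ⟨(hreg _ hε hRq _ (hc t ht).1).1, (hreg _ hε hRq _ (hc t ht).1).2.1⟩
  refine ⟨hφ, h0 ▸ (hcP 0 ⟨le_rfl, hT.le⟩).1, h1 ▸ (hcP T ⟨hT.le, le_rfl⟩).1, T, hT, c, h0, h1,
    fun t ht => ⟨(hcP t ht).2, (hc t ht).2⟩, fun t ht => ⟨(hcP t (Ioo_subset_Icc_self ht)).1,
      hcb t ht⟩⟩

end Crossing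

end Regular

/-! ### The map along one segment, from Σ to Σ. -/

section Segments

variable {n : ℕ} {M Sig : Set (Eu n)} {m : Eu n → ℝ} {X : Eu n → Eu n} {r : ℝ}
  {Wm W Wp O : Set (Eu n)} {Ym Y Yp : Eu n → Eu n}

/-- The arcs of the regularized field along one segment of a sewing-type orbit, from `Sig` to
`Sig`, together with the limit `ε = 0`, depend smoothly on the initial point and on `ε`. -/
theorem exists_segment_map (hm : IsMollifier m) (hr : tsupport m ⊆ Metric.closedBall 0 r)
    (hr0 : 0 ≤ r) (hM : IsOpen M) (hSM : Sig ⊆ M) (hW : IsOpen W) (hWM : W ⊆ M \ Sig)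
    (hYm : ContDiff ℝ ∞ Ym) (hY : ContDiff ℝ ∞ Y) (hYp : ContDiff ℝ ∞ Yp) {Y₀ : Eu n → Eu n}
    (hY₀ : ContDiffOn ℝ ∞ Y₀ M) (hXY₀ : EqOn X Y₀ W) (hO : IsOpen O) (hXY : EqOn X Y (W ∩ O))
    {γ : ℝ → Eu n} {T : ℝ} (hT : 0 < T) (hγ : ∀ t ∈ Icc 0 T, HasDerivWithinAt γ (Y (γ t)) (Icc 0 T) t)
    (hγW : ∀ t ∈ Ioo 0 T, γ t ∈ W) (hγO : ∀ t ∈ Icc 0 T, γ t ∈ O)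
    (C₀ : Crossing M Sig X Wm W Ym Y (γ 0)) (C₁ : Crossing M Sig X W Wp Y Yp (γ T)) :
    ∃ F : Eu n × ℝ → Eu n, (∀ᶠ q in 𝓝 (γ 0, (0 : ℝ)), ContDiffAt ℝ ∞ F q) ∧ F (γ 0, 0) = γ T ∧
      ∀ᶠ q in 𝓝 (γ 0, (0 : ℝ)), q.1 ∈ Sig →
        (0 < q.2 → F q ∈ Sig ∧
          IsArc (regularDomain M m X q.2) (smoothedField m X q.2) Sigᶜ q.1 (F q)) ∧
        (q.2 = 0 → ∀ y, IsTransition Sig X W q.1 y ↔ y = F q) := by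
  have hr1 : 0 < r + 1 := by linarith
  have hmem0 : (0 : ℝ) ∈ Icc 0 T := ⟨le_rfl, hT.le⟩
  have hmemT : T ∈ Icc 0 T := ⟨hT.le, le_rfl⟩
  -- At height εR₀ a ball of radius ε(r + 1) no longer meets Σ near the crossing point, so there the
  -- regularization involves only one smooth field.
  set R₀ : ℝ := C₀.K * (r + 1) + 1 with hR₀
  set R₁ : ℝ := C₁.K * (r + 1) + 1 with hR₁
  have hR₀0 : 0 < R₀ := by positivity
  have hR₁0 : 0 < R₁ := by positivity
  have hO0 := hO.mem_nhds (hγO 0 hmem0)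
  have hO1 := hO.mem_nhds (hγO T hmemT)
  -- Since segments start and end on Σ, only half layers are crossed: s from 0 to R₀ at the start,
  -- and from -R₁ to 0 at the end.
  obtain ⟨K₀, hK₀, hK₀0, hK₀arc⟩ := C₀.exists_layer_arc hm hr hr0 hYm hY hR₀0
  obtain ⟨K₁, hK₁, hK₁0, hK₁arc⟩ := C₁.exists_layer_arc hm hr hr0 hY hYp (neg_lt_zero.2 hR₁0)
  obtain ⟨Q, hQ, hQ0, hQarc⟩ := exists_outer_transition (contDiff_mollified hm hY) C₀.contDiff_φ
    C₁.contDiff_φ hT (fun t ht => by rw [mollified_zero hm]; exact hγ t ht) (hW.inter hO)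
    (fun t ht => ⟨hγW t ht, hγO t (Ioo_subset_Icc_self ht)⟩) (Filter.inter_mem C₀.N_mem hO0)
    (Filter.inter_mem C₁.N_mem hO1) (fun x hx h => ⟨(C₀.pos x hx.1 h).1, hx.2⟩)
    (fun x hx h => ⟨(C₁.neg x hx.1 h).1, hx.2⟩) C₁.φ_base
    (by rw [mollified_zero hm]; exact C₀.deriv_p) (by rw [mollified_zero hm]; exact C₁.deriv_m) hr1
    (C₀.lipschitz.mono inter_subset_left) (C₁.lipschitz.mono inter_subset_left)
    (lt_add_one _) (lt_add_one _)
  -- the two intermediate points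
  set A : Eu n × ℝ → Eu n × ℝ := fun q => (K₀ q, q.2) with hA
  set B : Eu n × ℝ → Eu n × ℝ := fun q => (Q (A q), q.2) with hB
  have hAs : ContDiff ℝ ∞ A := hK₀.prodMk contDiff_snd
  have hA0 : A (γ 0, 0) = (γ 0, 0) := by simp [hA, hK₀0.self_of_nhds]
  have hAt : Filter.Tendsto A (𝓝 (γ 0, 0)) (𝓝 (γ 0, 0)) := by
    have := hAs.continuous.tendsto (γ 0, (0 : ℝ))
    rwa [hA0] at this
  have hBs : ∀ᶠ q in 𝓝 (γ 0, (0 : ℝ)), ContDiffAt ℝ ∞ B q := by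
    filter_upwards [hAt.eventually hQ] with q hq
    exact (hq.comp q hAs.contDiffAt).prodMk contDiffAt_snd
  have hB0 : B (γ 0, 0) = (γ T, 0) := by simp [hB, hA0, hQ0]
  have hBt : Filter.Tendsto B (𝓝 (γ 0, 0)) (𝓝 (γ T, 0)) := by
    have := hBs.self_of_nhds.continuousAt.tendsto
    rwa [hB0] at this
  have hfst : ∀ x : Eu n, Filter.Tendsto Prod.fst (𝓝 (x, (0 : ℝ))) (𝓝 x) := fun x =>
    continuous_fst.tendsto (x, (0 : ℝ))
  refine ⟨fun q => K₁ (B q), ?_, ?_, ?_⟩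
  · filter_upwards [hBs] with q hq
    exact hK₁.contDiffAt.comp q hq
  · simp only [hB0]
    exact hK₁0.self_of_nhds
  filter_upwards [hK₀arc, hAt.eventually hQarc, hBt.eventually hK₁arc,
    (hfst _).eventually C₀.N_mem, (hfst _).eventually hO0, (hfst _).eventually hK₀0,
    ((hfst _).comp hBt).eventually hK₁0, ((hfst _).comp hBt).eventually C₁.N_mem,
    ((hfst _).comp hBt).eventually hO1] with q h0 hq h1 hN₀ hqO hK₀q hK₁q hN₁ hqO₁ hqS
  have hφq : C₀.φ q.1 = 0 := (C₀.mem_iff _ hN₀).1 hqS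
  refine ⟨fun hε => ?_, fun hε => ?_⟩
  · obtain ⟨hφA, -, hAN, arc₀⟩ := h0 hε (by rw [hφq, mul_zero])
    obtain ⟨hφB, S, hS, c, hc0, hc1, hc⟩ := hq hε.le hφA
    obtain ⟨hφF, hBN, hFN, arc₁⟩ := h1 hε hφB
    have harc : IsArc (regularDomain M m X q.2) (smoothedField m X q.2) Sigᶜ (K₀ q) (Q (A q)) := by
      refine ⟨S, hS, c, hc0, hc1, fun t ht => ?_, fun t ht => ?_⟩
      · have := mem_regularDomain_of_eq hm hr hY (inter_subset_left.trans (hWM.trans sdiff_subset))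
          hXY hε ((hc t ht).2 (Or.inr hε))
        refine ⟨this.1, ?_⟩
        rw [this.2]
        exact (hc t ht).1
      · have := (hc t (Ioo_subset_Icc_self ht)).2 (Or.inl ht)
          (Metric.mem_closedBall_self (mul_nonneg hε.le hr1.le))
        exact (hWM this.1).2
    refine ⟨(C₁.mem_iff _ hFN).2 (hφF.trans (mul_zero _)), ?_⟩
    have hA1 : K₀ q ∈ Sigᶜ := fun hS => by
      have h1 : C₀.φ (K₀ q) = 0 := (C₀.mem_iff _ hAN).1 hS
      rw [hφA] at h1
      exact (mul_pos hε hR₀0).ne' h1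
    have hB1 : Q (A q) ∈ Sigᶜ := fun hS => by
      have h1 : C₁.φ (Q (A q)) = 0 := (C₁.mem_iff _ hBN).1 hS
      have h2 : C₁.φ (Q (A q)) = q.2 * -R₁ := hφB
      rw [h2] at h1
      exact (mul_neg_of_pos_of_neg hε (neg_lt_zero.2 hR₁0)).ne h1
    have hsub₀ : {x ∈ C₀.N | q.2 * 0 < C₀.φ x ∧ C₀.φ x < q.2 * R₀} ⊆ Sigᶜ := fun x hx hS => by
      have h1 : C₀.φ x = 0 := (C₀.mem_iff _ hx.1).1 hS
      have := hx.2.1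
      rw [h1, mul_zero] at this
      exact lt_irrefl _ this
    have hsub₁ : {x ∈ C₁.N | q.2 * -R₁ < C₁.φ x ∧ C₁.φ x < q.2 * 0} ⊆ Sigᶜ := fun x hx hS => by
      have h1 : C₁.φ x = 0 := (C₁.mem_iff _ hx.1).1 hS
      have := hx.2.2
      rw [h1, mul_zero] at this
      exact lt_irrefl _ this
    exact ((arc₀.mono subset_rfl hsub₀).trans harc hA1).trans (arc₁.mono subset_rfl hsub₁) hB1
  · obtain ⟨x, ε⟩ := q
    obtain rfl : ε = 0 := hε
    -- At ε = 0 both layer maps are the identity, so F reduces to the hitting map Q of the smooth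
    -- field.
    have hAq : A (x, 0) = (x, 0) := by simp only [hA]; rw [hK₀q]
    have hFq : K₁ (B (x, 0)) = Q (x, 0) := by
      have : B (x, 0) = (Q (x, 0), 0) := by simp only [hB, hAq]
      rw [this]
      have h2 := hK₁q
      simp only [Function.comp_apply, this] at h2
      exact h2
    simp only [hAq] at hq
    obtain ⟨hφB, S, hS, c, hc0, hc1, hc⟩ := hq le_rfl (by rw [hφq, zero_mul])
    simp only [Function.comp_apply, hB, hAq] at hN₁ hqO₁
    have htr : IsTransition Sig X W x (Q (x, 0)) := by
      refine ⟨hqS, (C₁.mem_iff _ hN₁).2 (hφB.trans (zero_mul _)), S, hS, c,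
        fun t ht => (hc t ht).1.continuousWithinAt, hc0, hc1, fun t ht => ?_⟩
      have h1 := hc t (Ioo_subset_Icc_self ht)
      have h2 : c t ∈ W ∩ O := h1.2 (Or.inl ht) (by simp)
      refine ⟨h2.1, ?_⟩
      have h3 := h1.1.hasDerivAt (Icc_mem_nhds ht.1 ht.2)
      rwa [mollified_zero hm, ← hXY h2] at h3
    intro y
    simp only [hFq]
    exact ⟨fun h => h.unique hM hSM hWM hY₀ hXY₀ htr, fun h => h ▸ htr⟩

end Segments

/-! ### The segment maps of a given sewing orbit, and its section. -/

section Orbits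

variable {n : ℕ} {M Sig : Set (Eu n)} {m : Eu n → ℝ} {X : Eu n → Eu n}

theorem IsNormalCrossings.subset (h : IsNormalCrossings M Sig) : Sig ⊆ M := by
  obtain ⟨N, S, hS, rfl⟩ := h.components
  exact iUnion_subset fun i => (hS i).subset

theorem IsNormalCrossings.isOpen_diff (h : IsNormalCrossings M Sig) (hM : IsOpen M) :
    IsOpen (M \ Sig) := by
  obtain ⟨N, S, hS, rfl⟩ := h.components
  have : M \ ⋃ i, S i = M \ ⋃ i, closure (S i) := by
    ext x
    simp only [mem_sdiff, mem_iUnion, not_exists]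
    exact and_congr_right fun hx => forall_congr' fun i =>
      ⟨fun hn hc => hn ((hS i).closed_in ⟨hc, hx⟩), fun hn hc => hn (subset_closure hc)⟩
  rw [this]
  exact hM.sdiff (isClosed_iUnion_of_finite fun i => isClosed_closure)

theorem IsTransverseAt.mem {p v : Eu n} (h : IsTransverseAt M Sig p v) : p ∈ M := by
  obtain ⟨e, he, -⟩ := h
  exact he.source_subset he.mem_source

namespace SewingOrbit

variable (O : SewingOrbit M Sig X)

theorem τ_lt (i : Fin O.k) : O.τ i.castSucc < O.τ i.succ := O.τ_strictMono i.castSucc_lt_succ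

theorem τ_nonneg (i : Fin (O.k + 1)) : 0 ≤ O.τ i :=
  O.τ_zero ▸ O.τ_strictMono.monotone (Fin.zero_le i)

theorem Icc_subset (i : Fin O.k) :
    Icc (O.τ i.castSucc) (O.τ i.succ) ⊆ Icc 0 (O.τ (Fin.last O.k)) :=
  Icc_subset_Icc (O.τ_nonneg _) (O.τ_strictMono.monotone (Fin.le_last _))

theorem continuousOn_segment (i : Fin O.k) :
    ContinuousOn O.γ (Icc (O.τ i.castSucc) (O.τ i.succ)) := O.continuousOn.mono (O.Icc_subset i)

theorem W_subset (i : Fin O.k) : O.W i ⊆ M \ Sig := by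
  obtain ⟨x, -, hx⟩ := O.W_component i
  rw [hx]
  exact connectedComponentIn_subset _ _

theorem isOpen_W (h : IsOpen (M \ Sig)) (i : Fin O.k) : IsOpen (O.W i) := by
  obtain ⟨x, -, hx⟩ := O.W_component i
  rw [hx]
  exact h.connectedComponentIn

theorem mem_of_mem_segment (i : Fin O.k) {t : ℝ} (ht : t ∈ Icc (O.τ i.castSucc) (O.τ i.succ)) :
    O.γ t ∈ M := by
  obtain ⟨Y, -, -, h0, h1⟩ := O.transverse i
  rcases eq_or_lt_of_le ht.1 with h | hlt
  · rw [← h]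
    exact h0.mem
  rcases eq_or_lt_of_le ht.2 with h | hlt'
  · rw [h]
    exact h1.mem
  exact (O.W_subset i (O.mem_W i t ⟨hlt, hlt'⟩)).1

/-- Near each segment, the field is the restriction of a globally defined smooth field. -/
theorem exists_extension (hM : IsOpen M) (i : Fin O.k) :
    ∃ (Y : Eu n → Eu n) (R : Set (Eu n)), ContDiff ℝ ∞ Y ∧ IsOpen R ∧
      (∀ t ∈ Icc (O.τ i.castSucc) (O.τ i.succ), O.γ t ∈ R) ∧ EqOn X Y (O.W i ∩ R) ∧
      IsTransverseAt M Sig (O.γ (O.τ i.castSucc)) (Y (O.γ (O.τ i.castSucc))) ∧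
      IsTransverseAt M Sig (O.γ (O.τ i.succ)) (Y (O.γ (O.τ i.succ))) := by
  obtain ⟨Y₀, hY₀, hXY₀, h0, h1⟩ := O.transverse i
  obtain ⟨Y, hY, -, R, hR, hγR, -, hYR⟩ := exists_compactSupport_eq hM hY₀
    (isCompact_Icc.image_of_continuousOn (O.continuousOn_segment i))
    (image_subset_iff.2 fun t ht => O.mem_of_mem_segment i ht)
  have hγR' : ∀ t ∈ Icc (O.τ i.castSucc) (O.τ i.succ), O.γ t ∈ R := fun t ht =>
    hγR (mem_image_of_mem _ ht)
  have hτ := (O.τ_lt i).le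
  refine ⟨Y, R, hY, hR, hγR', fun x hx => (hXY₀ hx.1).trans (hYR hx.2).symm, ?_, ?_⟩
  · rwa [hYR (hγR' _ ⟨le_rfl, hτ⟩)]
  · rwa [hYR (hγR' _ ⟨hτ, le_rfl⟩)]

/-- Crossing points are cyclically indexed, but τ distinguishes 0 and `Fin.last`; at the base point
the preceding segment is the last one, since γ is closed. -/
theorem exists_prev (i : Fin O.k) : ∃ j : Fin O.k, O.γ (O.τ j.succ) = O.γ (O.τ i.castSucc) := by
  obtain ⟨i, hi⟩ := i
  rcases i with _ | i
  · refine ⟨⟨O.k - 1, Nat.sub_lt O.k_pos one_pos⟩, ?_⟩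
    have h1 : Fin.succ (⟨O.k - 1, Nat.sub_lt O.k_pos one_pos⟩ : Fin O.k) = Fin.last O.k :=
      Fin.ext (Nat.sub_add_cancel O.k_pos)
    have h2 : Fin.castSucc (⟨0, hi⟩ : Fin O.k) = 0 := rfl
    rw [h1, h2, O.closed, O.τ_zero]
  · exact ⟨⟨i, by omega⟩, rfl⟩

theorem exists_next (i : Fin O.k) : ∃ j : Fin O.k, O.γ (O.τ i.succ) = O.γ (O.τ j.castSucc) := by
  by_cases hi : (i : ℕ) + 1 < O.k
  · exact ⟨⟨i + 1, hi⟩, rfl⟩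
  · refine ⟨⟨0, O.k_pos⟩, ?_⟩
    have h1 : i.succ = Fin.last O.k := Fin.ext (by simp; omega)
    have h2 : Fin.castSucc (⟨0, O.k_pos⟩ : Fin O.k) = 0 := rfl
    rw [h1, h2, O.closed, O.τ_zero]

/-- The regularized field along each segment of the orbit, as in `exists_segment_map`, and near the
base point. -/
theorem exists_segment_maps (hM : IsOpen M) (hSig : IsNormalCrossings M Sig) (hm : IsMollifier m) :
    (∃ F : Fin O.k → Eu n × ℝ → Eu n, ∀ i,
      (∀ᶠ q in 𝓝 (O.γ (O.τ i.castSucc), (0 : ℝ)), ContDiffAt ℝ ∞ (F i) q) ∧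
      F i (O.γ (O.τ i.castSucc), 0) = O.γ (O.τ i.succ) ∧
      ∀ᶠ q in 𝓝 (O.γ (O.τ i.castSucc), (0 : ℝ)), q.1 ∈ Sig →
        (0 < q.2 → F i q ∈ Sig ∧
          IsArc (regularDomain M m X q.2) (smoothedField m X q.2) Sigᶜ q.1 (F i q)) ∧
        (q.2 = 0 → ∀ y, IsTransition Sig X (O.W i) q.1 y ↔ y = F i q)) ∧
    ∀ᶠ q in 𝓝 (O.base, (0 : ℝ)), q.1 ∈ Sig → 0 < q.2 →
      IsTransverseAt M Sig q.1 (smoothedField m X q.2 q.1) := by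
  choose Y R hY hR hγR hXY hT₀ hT₁ using O.exists_extension hM
  have hcross : ∀ i j : Fin O.k, O.γ (O.τ j.succ) = O.γ (O.τ i.castSucc) →
      Nonempty (Crossing M Sig X (O.W j) (O.W i) (Y j) (Y i) (O.γ (O.τ i.castSucc))) := by
    intro i j hij
    exact exists_crossing (O.W_component j) (O.W_component i) (hY j) (hY i)
      ((hR j).mem_nhds (hij ▸ hγR j _ ⟨(O.τ_lt j).le, le_rfl⟩))
      ((hR i).mem_nhds (hγR i _ ⟨le_rfl, (O.τ_lt i).le⟩)) (hXY j) (hXY i) (hij ▸ hT₁ j) (hT₀ i)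
      (O.τ_lt j) (O.τ_lt i) (O.continuousOn_segment j) hij (O.mem_W j) (O.hasDerivAt j)
      (O.continuousOn_segment i) rfl (O.mem_W i) (O.hasDerivAt i)
  obtain ⟨r, hr0, hr⟩ : ∃ r : ℝ, 0 ≤ r ∧ tsupport m ⊆ Metric.closedBall 0 r := by
    obtain ⟨r, hr⟩ := (HasCompactSupport.isCompact hm.compact_support).isBounded.subset_closedBall 0
    exact ⟨max r 0, le_max_right _ _, hr.trans (Metric.closedBall_subset_closedBall (le_max_left _ _))⟩
  constructor
  · have hF : ∀ i, ∃ F : Eu n × ℝ → Eu n,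
        (∀ᶠ q in 𝓝 (O.γ (O.τ i.castSucc), (0 : ℝ)), ContDiffAt ℝ ∞ F q) ∧
        F (O.γ (O.τ i.castSucc), 0) = O.γ (O.τ i.succ) ∧
        ∀ᶠ q in 𝓝 (O.γ (O.τ i.castSucc), (0 : ℝ)), q.1 ∈ Sig →
          (0 < q.2 → F q ∈ Sig ∧
            IsArc (regularDomain M m X q.2) (smoothedField m X q.2) Sigᶜ q.1 (F q)) ∧
          (q.2 = 0 → ∀ y, IsTransition Sig X (O.W i) q.1 y ↔ y = F q) := by
      intro i
      obtain ⟨Y₀, hY₀, hXY₀, -, -⟩ := O.transverse i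
      obtain ⟨j₀, hj₀⟩ := O.exists_prev i
      obtain ⟨j₁, hj₁⟩ := O.exists_next i
      obtain ⟨C₀⟩ := hcross i j₀ hj₀
      obtain ⟨C₁⟩ := hcross j₁ i hj₁
      set a := O.τ i.castSucc
      set b := O.τ i.succ
      have hab : a < b := O.τ_lt i
      have hder := hasDerivWithinAt_Icc_of_hasDerivAt_Ioo (w := fun t => Y i (O.γ t)) hab
        (O.continuousOn_segment i) ((hY i).continuous.comp_continuousOn (O.continuousOn_segment i))
        fun t ht => by
          rw [← hXY i ⟨O.mem_W i t ht, hγR i t (Ioo_subset_Icc_self ht)⟩]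
          exact O.hasDerivAt i t ht
      have hγ : ∀ t ∈ Icc 0 (b - a), HasDerivWithinAt (fun t => O.γ (a + t)) (Y i (O.γ (a + t)))
          (Icc 0 (b - a)) t := by
        intro t ht
        have hmaps : MapsTo (fun s : ℝ => a + s) (Icc 0 (b - a)) (Icc a b) := fun s hs =>
          ⟨by linarith [hs.1], by linarith [hs.2]⟩
        have := (hder _ (hmaps ht)).scomp t ((hasDerivAt_id t).const_add a).hasDerivWithinAt hmaps
        rw [one_smul] at this
        exact this
      have h0 : O.γ a = O.γ (a + 0) := by rw [add_zero]
      have h1 : O.γ (O.τ j₁.castSucc) = O.γ (a + (b - a)) := by rw [add_sub_cancel, ← hj₁]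
      have hseg := exists_segment_map hm hr hr0 hM hSig.subset
        (O.isOpen_W (hSig.isOpen_diff hM) i) (O.W_subset i) (hY j₀) (hY i) (hY j₁) hY₀ hXY₀ (hR i)
        (hXY i) (γ := fun t => O.γ (a + t)) (T := b - a) (sub_pos.2 hab) hγ
        (fun t ht => O.mem_W i _ ⟨by linarith [ht.1], by linarith [ht.2]⟩)
        (fun t ht => hγR i _ ⟨by linarith [ht.1], by linarith [ht.2]⟩) (h0 ▸ C₀) (h1 ▸ C₁)
      simpa only [add_zero, add_sub_cancel] using hseg
    choose F hF using hF
    exact ⟨F, hF⟩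
  · set i₀ : Fin O.k := ⟨0, O.k_pos⟩
    have hbase : O.γ (O.τ i₀.castSucc) = O.base := congrArg O.γ O.τ_zero
    obtain ⟨j, hj⟩ := O.exists_prev i₀
    obtain ⟨C⟩ := hcross i₀ j hj
    rw [hbase] at C
    have hfst := continuous_fst.tendsto (O.base, (0 : ℝ))
    have hsrc := C.chart.contDiffAt C.chart.mem_source
    -- On Σ the layer coordinate s is 0, so the regularized field is G(x, 0, ε). Its transversality
    -- at (p, 0) persists nearby by continuity.
    have hcont : ContinuousAt (fun q : Eu n × ℝ =>
        fderiv ℝ C.e q.1 (C.field m (q.1, 0, q.2)) ⟨0, C.chart.le_dim⟩) (O.base, 0) := by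
      have h1 : ContinuousAt (fun q : Eu n × ℝ => fderiv ℝ C.e q.1) (O.base, 0) :=
        ContinuousAt.comp (f := Prod.fst) (g := fderiv ℝ C.e)
          ((hsrc.fderiv_right (m := 0) (by simp)).continuousAt) hfst
      have h2 : Continuous fun q : Eu n × ℝ => C.field m (q.1, 0, q.2) :=
        ((C.contDiff_field hm (hY j) (hY i₀)).continuous).comp (by fun_prop)
      exact (EuclideanSpace.proj (𝕜 := ℝ) (⟨0, C.chart.le_dim⟩ : Fin n)).continuous.continuousAt.comp
        (h1.clm_apply h2.continuousAt)
    have hne := hcont.eventually_ne (C.chart_deriv _ (C.field_pos hm 0))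
    filter_upwards [hne, eventually_closedBall_subset C.N_mem (r + 1),
      hfst.eventually (C.e.open_source.eventually_mem C.chart.mem_source)] with q hq hball hqe hqS hε
    have hqN : q.1 ∈ C.N := hball (Metric.mem_closedBall_self (by positivity))
    have hφ : C.φ q.1 = 0 := (C.mem_iff _ hqN).1 hqS
    refine C.chart.isTransverseAt hqe hqS ?_
    rw [(C.mem_regularDomain hm hr (hY j) (hY i₀) hε hball).2, hφ, zero_div]
    exact hq

/-- The points `γ (τ i)` with `0 < i < k` are different from the base point. -/
theorem exists_section (O : SewingOrbit M Sig X) :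
    ∃ V, IsOpen V ∧ O.base ∈ V ∧ ∀ i : Fin O.k, (i : ℕ) ≠ 0 →
      ∀ᶠ x in 𝓝 (O.γ (O.τ i.castSucc)), x ∉ V := by
  have h : ∀ i : Fin O.k, ∃ V, IsOpen V ∧ O.base ∈ V ∧ ((i : ℕ) ≠ 0 →
      ∀ᶠ x in 𝓝 (O.γ (O.τ i.castSucc)), x ∉ V) := by
    intro i
    by_cases hi : (i : ℕ) = 0
    · exact ⟨univ, isOpen_univ, mem_univ _, fun h => absurd hi h⟩
    have hpos : 0 < O.τ i.castSucc := by
      rw [← O.τ_zero]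
      exact O.τ_strictMono (Fin.pos_iff_ne_zero.2 fun h => hi (congrArg Fin.val h))
    have hlast : O.τ i.castSucc < O.τ (Fin.last O.k) := O.τ_strictMono (Fin.castSucc_lt_last i)
    have hne : O.base ≠ O.γ (O.τ i.castSucc) := fun h =>
      hpos.ne (O.simple ⟨le_rfl, hpos.trans hlast⟩ ⟨hpos.le, hlast⟩ h)
    obtain ⟨V, V', hV, hV', hb, hp, hd⟩ := t2_separation hne
    exact ⟨V, hV, hb, fun _ => Filter.eventually_of_mem (hV'.mem_nhds hp) fun x hx hxV =>
      disjoint_left.1 hd hxV hx⟩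
  choose V hV hb hp using h
  refine ⟨⋂ i, V i, isOpen_iInter_of_finite hV, mem_iInter.2 hb, fun i hi => ?_⟩
  filter_upwards [hp i hi] with x hx hxV
  exact hx (mem_iInter.1 hxV i)

end SewingOrbit

end Orbits

/-! ### Composition of the segment maps. -/

section FirstReturn

variable {n : ℕ} {M Sig : Set (Eu n)} {m : Eu n → ℝ} {X : Eu n → Eu n}

/-- The composition of the maps along the segments is the sewing Poincaré map for `ε = 0`, and
the end point of an arc of the regularized field which avoids the section for `ε > 0`. -/
theorem SewingOrbit.exists_return_map (O : SewingOrbit M Sig X) (hM : IsOpen M)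
    (hSig : IsNormalCrossings M Sig) (hm : IsMollifier m) {V : Set (Eu n)} (hV : IsOpen V)
    (hbV : O.base ∈ V) (hVi : ∀ i : Fin O.k, (i : ℕ) ≠ 0 →
      ∀ᶠ x in 𝓝 (O.γ (O.τ i.castSucc)), x ∉ V) :
    ∃ Z : Eu n × ℝ → Eu n, (∀ᶠ q in 𝓝 (O.base, (0 : ℝ)), ContDiffAt ℝ ∞ Z q) ∧
      Z (O.base, 0) = O.base ∧ ∀ᶠ q in 𝓝 (O.base, (0 : ℝ)), q.1 ∈ Sig →
        (0 < q.2 → Z q ∈ Sig ∩ V ∧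
          IsArc (regularDomain M m X q.2) (smoothedField m X q.2) (Sig ∩ V)ᶜ q.1 (Z q)) ∧
        (q.2 = 0 → Z q ∈ Sig ∧ ∀ y, O.Returns q.1 y ↔ y = Z q) := by
  obtain ⟨⟨F, hF⟩, -⟩ := O.exists_segment_maps hM hSig hm
  -- Z i (x, ε) is the i-th crossing point; ε is handed on unchanged at each stage.
  set Z : Fin (O.k + 1) → Eu n × ℝ → Eu n :=
    Fin.induction (fun q => q.1) fun i z q => F i (z q, q.2) with hZ
  have hZ0 : ∀ q, Z 0 q = q.1 := fun q => by simp [hZ]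
  have hZs : ∀ (i : Fin O.k) q, Z i.succ q = F i (Z i.castSucc q, q.2) := fun i q => by simp [hZ]
  have hb0 : O.γ (O.τ 0) = O.base := congrArg O.γ O.τ_zero
  have hsmooth : ∀ i, (∀ᶠ q in 𝓝 (O.base, (0 : ℝ)), ContDiffAt ℝ ∞ (Z i) q) ∧
      Z i (O.base, 0) = O.γ (O.τ i) := by
    intro i
    induction i using Fin.induction with
    | zero => exact ⟨Filter.Eventually.of_forall fun q => contDiffAt_fst, (hZ0 _).trans hb0.symm⟩
    | succ i ih =>
      have ht : Filter.Tendsto (fun q : Eu n × ℝ => (Z i.castSucc q, q.2)) (𝓝 (O.base, 0))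
          (𝓝 (O.γ (O.τ i.castSucc), 0)) := by
        rw [← ih.2]
        exact ih.1.self_of_nhds.continuousAt.prodMk continuous_snd.continuousAt
      refine ⟨?_, by rw [hZs, ih.2, (hF i).2.1]⟩
      filter_upwards [ih.1, ht.eventually (hF i).1] with q h1 h2
      have h3 : Z i.succ = F i ∘ fun q => (Z i.castSucc q, q.2) := funext (hZs i)
      rw [h3]
      exact ContDiffAt.comp q h2 (h1.prodMk contDiffAt_snd)
  have htend : ∀ i, Filter.Tendsto (fun q : Eu n × ℝ => (Z i q, q.2)) (𝓝 (O.base, 0))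
      (𝓝 (O.γ (O.τ i), 0)) := fun i => by
    rw [← (hsmooth i).2]
    exact (hsmooth i).1.self_of_nhds.continuousAt.prodMk continuous_snd.continuousAt
  have hlast : O.γ (O.τ (Fin.last O.k)) = O.base := O.closed
  refine ⟨Z (Fin.last O.k), (hsmooth _).1, (hsmooth _).2.trans hlast, ?_⟩
  have hseg := Filter.eventually_all.2 fun i : Fin O.k =>
    (htend i.castSucc).eventually (hF i).2.2
  have hout := Filter.eventually_all.2 fun i : Fin O.k => Filter.eventually_all.2 fun hi =>
    ((continuous_fst.tendsto _).comp (htend i.castSucc)).eventually (hVi i hi)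
  have hret : ∀ᶠ q in 𝓝 (O.base, (0 : ℝ)), Z (Fin.last O.k) q ∈ V :=
    ((continuous_fst.tendsto _).comp (htend (Fin.last O.k))).eventually
      (hV.mem_nhds (by rwa [hlast]))
  filter_upwards [hseg, hout, hret] with q hq hqo hqr hqS
  simp only [← hZs] at hq
  have hlasteq : ∀ hk : O.k - 1 < O.k, Fin.succ ⟨O.k - 1, hk⟩ = Fin.last O.k := fun hk =>
    Fin.ext (Nat.sub_add_cancel O.k_pos)
  refine ⟨fun hε => ?_, fun hε => ?_⟩
  · have harc : ∀ (i : ℕ) (hi : i < O.k), Z (Fin.succ ⟨i, hi⟩) q ∈ Sig ∧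
        IsArc (regularDomain M m X q.2) (smoothedField m X q.2) (Sig ∩ V)ᶜ q.1
          (Z (Fin.succ ⟨i, hi⟩) q) := by
      have hsub : Sigᶜ ⊆ (Sig ∩ V)ᶜ := compl_subset_compl.2 inter_subset_left
      intro i
      induction i with
      | zero =>
        intro hi
        have h0 : Z (Fin.castSucc ⟨0, hi⟩) q = q.1 := hZ0 q
        obtain ⟨h1, h2⟩ := (hq ⟨0, hi⟩ (h0 ▸ hqS)).1 hε
        exact ⟨h1, (h0 ▸ h2).mono subset_rfl hsub⟩
      | succ i ih =>
        intro hi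
        obtain ⟨h1, h2⟩ := ih (by omega)
        obtain ⟨h3, h4⟩ := (hq ⟨i + 1, hi⟩ h1).1 hε
        -- The junction point lies on Σ but outside V, so the joined arc still avoids the section.
        exact ⟨h3, h2.trans (h4.mono subset_rfl hsub)
          fun h => hqo ⟨i + 1, hi⟩ (Nat.succ_ne_zero i) h.2⟩
    have := harc (O.k - 1) (Nat.sub_lt O.k_pos one_pos)
    rw [hlasteq] at this
    exact ⟨⟨this.1, hqr⟩, this.2⟩
  · have hmem : ∀ i, Z i q ∈ Sig := by
      intro i
      induction i using Fin.induction with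
      | zero => rwa [hZ0]
      | succ i ih => exact (((hq i ih).2 hε _).2 rfl).2.1
    refine ⟨hmem _, fun y => ⟨?_, ?_⟩⟩
    · rintro ⟨z, hz0, rfl, hz⟩
      have hzZ : ∀ i, z i = Z i q := by
        intro i
        induction i using Fin.induction with
        | zero => rw [hZ0, hz0]
        | succ i ih => exact ((hq i (hmem _)).2 hε _).1 (ih ▸ hz i)
      exact hzZ _
    · rintro rfl
      exact ⟨fun i => Z i q, hZ0 q, rfl, fun i => ((hq i (hmem _)).2 hε _).2 rfl⟩

end FirstReturn

end PiecewiseSmooth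

/-! ### Choice of the section and of the domain of the return map. -/

theorem mainTheorem4 {n : ℕ} (M Sig : Set (Eu n)) (hM : IsOpen M)
    (hSig : IsNormalCrossings M Sig) (X : Eu n → Eu n) (hX : IsPiecewiseSmoothField M Sig X)
    (m : Eu n → ℝ) (hm : IsMollifier m) (O : SewingOrbit M Sig X) :
    ∃ P : Eu n → Eu n, O.IsPoincareMap P ∧
      ∃ (Preg : Eu n × ℝ → Eu n × ℝ) (S U : Set (Eu n)) (ε₀ : ℝ), 0 < ε₀ ∧
        -- `S` and `U ⊆ S` are open neighbourhoods of `p` in `Sig`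
        (∃ V, IsOpen V ∧ O.base ∈ V ∧ S = Sig ∩ V) ∧
        (∃ V, IsOpen V ∧ O.base ∈ V ∧ U = Sig ∩ V) ∧ U ⊆ S ∧
        -- `Preg` is a smooth map germ `(Sig, p) × (ℝ≥0, 0) → (Sig, p) × (ℝ≥0, 0)` extending `P`
        IsSmoothOnSubset Preg (U ×ˢ Ico 0 ε₀) ∧
        MapsTo Preg (U ×ˢ Ico 0 ε₀) (Sig ×ˢ Ici 0) ∧
        Preg (O.base, 0) = (O.base, 0) ∧
        (∀ x ∈ U, Preg (x, 0) = (P x, 0)) ∧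
        -- for `ε > 0`, `Preg` maps the fiber over `ε` to itself, as the first return map of
        -- `m_ε ∗ X` on the transverse section `S`
        ∀ ε ∈ Ioo 0 ε₀,
          (∀ x ∈ S, IsTransverseAt M Sig x (smoothedField m X ε x)) ∧
          ∀ x ∈ U, (Preg (x, ε)).2 = ε ∧
            ∀ y, IsFirstReturn (smoothedDomain M m ε) (smoothedField m X ε) S x y ↔
              y = (Preg (x, ε)).1 := by
  obtain ⟨V, hV, hbV, hVi⟩ := O.exists_section
  -- shrink the section so that the regularized fields are transverse to it
  have htrans := (O.exists_segment_maps hM hSig hm).2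
  rw [nhds_prod_eq, Filter.eventually_prod_iff] at htrans
  obtain ⟨A, hA, B, hB, hAB⟩ := htrans
  obtain ⟨V', hV'A, hV', hbV'⟩ := mem_nhds_iff.1 hA
  obtain ⟨Z, hZs, hZ0, hZ⟩ := O.exists_return_map hM hSig hm (hV.inter hV') ⟨hbV, hbV'⟩
    fun i hi => (hVi i hi).mono fun x hx h => hx h.1
  have hev := hZs.and (hZ.and ((continuous_snd.tendsto (O.base, (0 : ℝ))).eventually hB))
  -- Balls for the sup metric are products, so δ serves both as the radius defining U and as ε₀.
  -- Only U is cut down by it: returns have to land in S, not in U.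
  obtain ⟨δ, hδ, hball⟩ := Metric.eventually_nhds_iff_ball.1 hev
  have hmem : ∀ x ∈ Metric.ball O.base δ, ∀ ε ∈ Ico 0 δ, (x, ε) ∈ Metric.ball (O.base, (0 : ℝ)) δ := by
    intro x hx ε hε
    rw [Metric.mem_ball, Prod.dist_eq, max_lt_iff]
    exact ⟨hx, by simpa [abs_of_nonneg hε.1] using hε.2⟩
  have hzero : (0 : ℝ) ∈ Ico 0 δ := ⟨le_rfl, hδ⟩
  refine ⟨fun x => Z (x, 0), ?_, fun q => (Z q, q.2), Sig ∩ (V ∩ V'),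
    Sig ∩ (V ∩ V' ∩ Metric.ball O.base δ), δ, hδ, ⟨V ∩ V', hV.inter hV', ⟨hbV, hbV'⟩, rfl⟩,
    ⟨_, (hV.inter hV').inter Metric.isOpen_ball, ⟨⟨hbV, hbV'⟩, Metric.mem_ball_self hδ⟩, rfl⟩,
    inter_subset_inter_right _ inter_subset_left, ?_, ?_, by simp only [hZ0], fun x _ => rfl, ?_⟩
  · filter_upwards [self_mem_nhdsWithin,
      nhdsWithin_le_nhds (Metric.ball_mem_nhds O.base hδ)] with x hxS hx
    exact (((hball _ (hmem x hx 0 hzero)).2.1 hxS).2 rfl).2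
  · rintro ⟨x, ε⟩ ⟨hx, hε⟩
    refine ⟨Metric.ball (O.base, 0) δ, fun q => (Z q, q.2), Metric.isOpen_ball,
      hmem x hx.2.2 ε hε, fun q hq => ?_, fun q _ => rfl⟩
    exact ((hball q hq).1.prodMk contDiffAt_snd).contDiffWithinAt
  · rintro ⟨x, ε⟩ ⟨hx, hε⟩
    have h := (hball _ (hmem x hx.2.2 ε hε)).2.1 hx.1
    refine ⟨?_, hε.1⟩
    rcases eq_or_lt_of_le hε.1 with h0 | h0
    · exact (h.2 h0.symm).1
    · exact (h.1 h0).1.1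
  · intro ε hε
    have hε' : ε ∈ Ico 0 δ := Ioo_subset_Ico_self hε
    refine ⟨fun x hx => ?_, fun x hx => ⟨rfl, fun y => ?_⟩⟩
    · exact hAB (hV'A hx.2.2)
        (hball _ (hmem O.base (Metric.mem_ball_self hδ) ε hε')).2.2 hx.1 hε.1
    · obtain ⟨h1, h2⟩ := ((hball _ (hmem x hx.2.2 ε hε')).2.1 hx.1).1 hε.1
      exact h2.isFirstReturn_iff h1 (fun w hw => hw.1) fun w hw => hw.2
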